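/- **Setting.** Let $\mathcal X$ be a measurable space with a $\sigma$-finite base measure $dx$, let $\mathcal A=\{1,\dots,K\}$, and let $\mathcal M$ be an episodic MDP with horizon $H$, fixed starting state $x_0$, a single available action $a_0$ at time $0$, and transition operators $T_h(\cdot\mid x,a)\in\Delta(\mathcal X)$, $h\in\{0,\dots,H-1\}$. Policies are randomized, Markov, and may depend on the time step. Let $\Phi$ be a finite class of measurable maps $\phi:\mathcal X\times\mathcal A\to\Delta([d_{LV}])$ and $\Upsilon$ a finite class of measurable maps $\mu:\mathcal X\to\mathbb R_{\ge 0}^{d_{LV}}$ each of whose coordinates is a probability density ($\int\mu(x)[i]\,dx=1$). Suppose that for each $h$ there are $\phi_h^\star\in\Phi$, $\mu_h^\star\in\Upsilon$ with $T_h(x'\mid x,a)=\langle\phi^\star_h(x,a),\mu^\star_h(x')\rangle$. Let $z_{h+1}\sim\phi_h^\star(x_h,a_h)$ denote the latent variable that generates $x_{h+1}$, and suppose that for some $\eta_{\min}>0$, for each $h$ and each value $i$ that $z_{h+1}$ takes with positive probability under some policy, $\max_\pi \mathbb P[z_{h+1}=i\mid\pi,\mathcal M]\ge\eta_{\min}$.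 The learner knows $\Phi,\Upsilon$ and interacts with $\mathcal M$ by executing episodes. It has access to an oracle $\mathrm{MLE}(D)\in\arg\max_{\phi\in\Phi,\mu\in\Upsilon}\sum_{(x,a,x')\in D}\log\langle\phi(x,a),\mu(x')\rangle$ (with $\log 0=-\infty$ and arbitrary measurable tie-breaking), and to no sampling oracle for the models $\langle\phi,\mu\rangle$. **Algorithm** (FLAMBE with planning in the environment; sample sizes $n,n'$). For $h=0,\dots,H-1$: collect $n$ triples $D_h=\{(x_h,a_h,x_{h+1})\}$, each in a new episode, by executing the exploratory policy $\rho_h$ ($\rho_0$ takes no action) followed by a uniformly random available action; set $(\hat\phi_h,\hat\mu_h)=\mathrm{MLE}(D_h)$; for $i=1,\dots,d_{LV}$ let $\hat\pi_i$ be the $h$-step policy returned by Linear-FQI; let $\rho_{h+1}$ draw $i$ uniformly, execute $\hat\pi_i$ for $h$ steps, and then take a uniformly random available action. The output is $(\hat\phi_{0:H-1},\hat\mu_{0:H-1})$. Linear-FQI at stage $h$ for coordinate $i$ uses the rewards $R_{h-1}=\hat\phi_{h-1}(\cdot,\cdot)[i]$ and $R_t=0$ for $t<h-1$. Put $\hat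 V_h=0$. For $t=h-1,\dots,0$: collect $n'$ new triples $(x_t,a_t,x_{t+1})$ by executing $\rho_t$ followed by a uniformly random available action; let $\hat\theta_t$ minimize $\sum(\langle\theta,\hat\phi_t(x_t,a_t)\rangle-\hat V_{t+1}(x_{t+1}))^2$ over $\|\theta\|_2\le h\sqrt{d_{LV}}$; put $\hat Q_t=R_t+\langle\hat\theta_t,\hat\phi_t\rangle$, let $\hat\pi_i$ act greedily with respect to $\hat Q_t$ at time $t$, and let $\hat V_t(x)$ be $\max_a\hat Q_t(x,a)$ clipped to $[0,h]$. **Cost model.** Real-number arithmetic: an arithmetic operation, a square root, a comparison, the evaluation of a coordinate of a feature map, a random choice from a finite set, the start of an episode, an action in the environment, and an MLE call each count as one step. **Theorem.** There is a universal polynomial $P$ such that for all $d_{LV},H,K,|\Phi|,|\Upsilon|$, $\eta_{\min},\varepsilon>0$ and $\delta\in(0,1)$ there are $n,n',N$, depending only on these quantities, such that the following holds for every instance of the setting above. Let the least squares problems be solved either (a) exactly (with arbitrary measurable tie-breaking; each solution counted as one step), or (b) approximately, by $N$ rounds of the conditional gradient (Frank–Wolfe) method over the ball, with all its arithmetic operations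 counted. Then in both cases, with probability at least $1-\delta$, $$\forall \pi,\ \forall h\in\{0,\dots,H-1\}:\quad \mathbb E\Big[\big\|\langle\hat\phi_h(x_h,a_h),\hat\mu_h(\cdot)\rangle-T_h(\cdot\mid x_h,a_h)\big\|_{TV}\ \Big|\ \pi,\mathcal M\Big]\le\varepsilon .$$ Moreover, the algorithm collects at most $P\big(d_{LV},H,K,1/\eta_{\min},1/\varepsilon,\log(|\Phi||\Upsilon|/\delta)\big)$ trajectories, makes $H$ calls to MLE, and takes at most $P\big(d_{LV},H,K,1/\eta_{\min},1/\varepsilon,\log(|\Phi||\Upsilon|/\delta)\big)$ steps. -/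

import Mathlib

open MeasureTheory ProbabilityTheory
open scoped ENNReal

universe u v w w'

noncomputable section

namespace Flambe

/-! ### Episodic Markov decision processes -/

/-- An episodic MDP on the state space `X` with actions `Fin K`: a fixed starting state, the only
action available at time `0`, and the (non-stationary) transition operators. With horizon `H`, only
`T 0, …, T (H - 1)` are ever used. -/
structure MDP (X : Type u) [MeasurableSpace X] (K : ℕ) where
  x0 : X
  a0 : Fin K
  T : ℕ → Kernel (X × Fin K) X
  markov : ∀ h, IsMarkovKernel (T h)

/-- A randomized policy, possibly depending on the time step. The value at time `0` is irrelevant,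
since only one action is available there. -/
structure Policy (X : Type u) [MeasurableSpace X] (K : ℕ) where
  ker : ℕ → Kernel X (Fin K)
  markov : ∀ h, IsMarkovKernel (ker h)

/-- The law of the state-action pair `(x_h, a_h)` when `π` is executed in `M`. -/
def MDP.occupancy {X : Type u} [MeasurableSpace X] {K : ℕ} (M : MDP X K) (π : Policy X K) :
    ℕ → Measure (X × Fin K)
  | 0 => Measure.dirac (M.x0, M.a0)
  | h + 1 => ((M.occupancy π h).bind (M.T h)) ⊗ₘ (π.ker (h + 1))

/-- Total variation distance between two probability measures. -/
def tvDist {X : Type u} [MeasurableSpace X] (P Q : Measure X) : ℝ≥0∞ :=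
  ⨆ (s : Set X) (_ : MeasurableSet s), ENNReal.ofReal |P.real s - Q.real s|

/-! ### Embedding functions and low rank models -/

/-- State-action embeddings `φ : X × A → ℝ^d`. -/
abbrev Feature (X : Type u) (K d : ℕ) := X → Fin K → Fin d → ℝ

/-- Next-state embeddings `μ : X → ℝ^d`. -/
abbrev Emission (X : Type u) (d : ℕ) := X → Fin d → ℝ

/-- `⟨φ(x,a), μ(x')⟩`. -/
def density {X : Type u} {K d : ℕ} (φ : Feature X K d) (μ : Emission X d) (x : X) (a : Fin K)
    (x' : X) : ℝ :=
  ∑ i, φ x a i * μ x' i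

/-- The measure with density `⟨φ(x,a), μ(·)⟩` with respect to the base measure. -/
def densityMeasure {X : Type u} [MeasurableSpace X] {K d : ℕ} (vol : Measure X)
    (φ : Feature X K d) (μ : Emission X d) (x : X) (a : Fin K) : Measure X :=
  vol.withDensity fun x' => ENNReal.ofReal (density φ μ x a x')

/-- All candidate features are measurable and take values in the probability simplex. -/
def SimplexFeatures {X : Type u} [MeasurableSpace X] {K d : ℕ} (Φ : Finset (Feature X K d)) :
    Prop :=
  ∀ φ ∈ Φ, (∀ a, Measurable fun x => φ x a) ∧ ∀ x a, φ x a ∈ stdSimplex ℝ (Fin d)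

/-- Every coordinate of every candidate `μ` is a probability density. -/
def DensityEmissions {X : Type u} [MeasurableSpace X] {d : ℕ} (vol : Measure X)
    (Υ : Finset (Emission X d)) : Prop :=
  ∀ μ ∈ Υ, Measurable μ ∧ (∀ x i, 0 ≤ μ x i) ∧ ∀ i, ∫⁻ x, ENNReal.ofReal (μ x i) ∂vol = 1

/-- `(φ_h, μ_h)`, `h < H`, factorizes the transition operators of `M`. -/
def Factorizes {X : Type u} [MeasurableSpace X] {K d : ℕ} (vol : Measure X) (M : MDP X K) (H : ℕ)
    (φ : ℕ → Feature X K d) (μ : ℕ → Emission X d) : Prop :=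
  ∀ h < H, ∀ x a, M.T h (x, a) = densityMeasure vol (φ h) (μ h) x a

/-- `ℙ[z_{h+1} = i | π, M]`, where the latent variable `z_{h+1}` is drawn from `φ_h(x_h, a_h)`. -/
def latentProb {X : Type u} [MeasurableSpace X] {K d : ℕ} (M : MDP X K) (φ : ℕ → Feature X K d)
    (π : Policy X K) (h : ℕ) (i : Fin d) : ℝ :=
  ∫ p, φ h p.1 p.2 i ∂(M.occupancy π h)

/-- Every value that `z_{h+1}` can take is reached with probability at least `η` by some policy. -/
def Reachable {X : Type u} [MeasurableSpace X] {K d : ℕ} (M : MDP X K) (H : ℕ)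
    (φ : ℕ → Feature X K d) (η : ℝ) : Prop :=
  ∀ h < H, ∀ i : Fin d, (∃ π : Policy X K, 0 < latentProb M φ π h i) →
    ∃ π : Policy X K, η ≤ latentProb M φ π h i

/-- A pair `(φ, μ) ∈ Φ × Υ`, as returned by the maximum likelihood oracle. -/
def Model {X : Type u} {K d : ℕ} (Φ : Finset (Feature X K d)) (Υ : Finset (Emission X d)) :
    Type u :=
  {φ // φ ∈ Φ} × {μ // μ ∈ Υ}

instance {X : Type u} {K d : ℕ} (Φ : Finset (Feature X K d)) (Υ : Finset (Emission X d)) :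
    MeasurableSpace (Model Φ Υ) := ⊤

/-- The state-action embedding of a model. -/
def Model.phi {X : Type u} {K d : ℕ} {Φ : Finset (Feature X K d)} {Υ : Finset (Emission X d)}
    (m : Model Φ Υ) : Feature X K d := m.1.1

/-- The next-state embedding of a model. -/
def Model.mu {X : Type u} {K d : ℕ} {Φ : Finset (Feature X K d)} {Υ : Finset (Emission X d)}
    (m : Model Φ Υ) : Emission X d := m.2.1

/-- `n` triples `(x, a, x')`. -/
abbrev Dataset (X : Type u) (K n : ℕ) := Fin n → X × Fin K × X

/-- The log-likelihood of a dataset, with `log 0 = -∞`. -/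
def logLikelihood {X : Type u} {K d : ℕ} (φ : Feature X K d) (μ : Emission X d) {n : ℕ}
    (D : Dataset X K n) : EReal :=
  ∑ j, ENNReal.log (ENNReal.ofReal (density φ μ (D j).1 (D j).2.1 (D j).2.2))

/-- A maximum likelihood oracle: a (measurable) selection of maximizers, ties broken arbitrarily. -/
def IsMLE {X : Type u} [MeasurableSpace X] {K d : ℕ} {Φ : Finset (Feature X K d)}
    {Υ : Finset (Emission X d)} (mle : ∀ n, Dataset X K n → Model Φ Υ) : Prop :=
  (∀ n, Measurable (mle n)) ∧
    ∀ n (D : Dataset X K n), ∀ φ ∈ Φ, ∀ μ ∈ Υ,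
      logLikelihood φ μ D ≤ logLikelihood (mle n D).phi (mle n D).mu D

/-- System identification with accuracy `ε`: under every policy, the expected total variation
distance between the learned and the true transition operator is at most `ε` at each time step. -/
def SysId {X : Type u} [MeasurableSpace X] {K d H : ℕ} (vol : Measure X) (M : MDP X K)
    {Φ : Finset (Feature X K d)} {Υ : Finset (Emission X d)} (ε : ℝ) (m : Fin H → Model Φ Υ) :
    Prop :=
  ∀ (π : Policy X K) (h : Fin H),
    ∫⁻ p, tvDist (densityMeasure vol (m h).phi (m h).mu p.1 p.2) (M.T h p)
      ∂(M.occupancy π h) ≤ ENNReal.ofReal ε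

/-! ### Programs interacting with the environment -/

/-- Interactive programs over the reals. The environment can be accessed only by starting a new
episode (which reveals the starting state) and by taking an action in the current state (which
reveals the next state); the type `M` of models only through the maximum likelihood oracle. `tick`
charges for one elementary operation. -/
inductive Prog (X : Type u) (K : ℕ) (M : Type v) (α : Type w) : Type (max u v w)
  | ret (r : α) : Prog X K M α
  | tick (p : Prog X K M α) : Prog X K M α
  | unif (n : ℕ) (k : Fin n → Prog X K M α) : Prog X K M α
  | reset (k : X → Prog X K M α) : Prog X K M α
  | act (a : Fin K) (k : X → Prog X K M α) : Prog X K M α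
  | mle (n : ℕ) (D : Dataset X K n) (k : M → Prog X K M α) : Prog X K M α

namespace Prog

variable {X : Type u} {K : ℕ} {M : Type v} {α : Type w} {β : Type w'}

/-- Sequential composition. -/
def bind : Prog X K M α → (α → Prog X K M β) → Prog X K M β
  | ret r, f => f r
  | tick p, f => tick (bind p f)
  | unif n k, f => unif n fun i => bind (k i) f
  | reset k, f => reset fun x => bind (k x) f
  | act a k, f => act a fun x => bind (k x) f
  | mle n D k, f => mle n D fun m => bind (k m) f

/-- The joint law of the result and of the final time and state of the environment, when the program
is run in the environment `E` with oracle `oracle` from the given time and state. -/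
def law [MeasurableSpace X] [MeasurableSpace α] (E : MDP X K) (oracle : ∀ n, Dataset X K n → M) :
    Prog X K M α → ℕ × X → Measure (α × (ℕ × X))
  | ret r, s => Measure.dirac (r, s)
  | tick p, s => law E oracle p s
  | unif n k, s => (n : ℝ≥0∞)⁻¹ • ∑ i, law E oracle (k i) s
  | reset k, _ => law E oracle (k E.x0) (0, E.x0)
  | act a k, s => (E.T s.1 (s.2, a)).bind fun x' => law E oracle (k x') (s.1 + 1, x')
  | mle n D k, s => law E oracle (k (oracle n D)) s

/-- Worst-case cost, over all responses of the environment, of the oracle and of the random choices,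
when a new episode costs `r`, an oracle call `o`, and every other instruction `e`. -/
def cost (r o e : ℕ∞) : Prog X K M α → ℕ∞
  | ret _ => 0
  | tick p => e + cost r o e p
  | unif _ k => e + ⨆ i, cost r o e (k i)
  | reset k => r + ⨆ x, cost r o e (k x)
  | act _ k => e + ⨆ x, cost r o e (k x)
  | mle _ _ k => o + ⨆ m, cost r o e (k m)

/-- Number of trajectories collected. -/
def trajectories (p : Prog X K M α) : ℕ∞ := p.cost 1 0 0

/-- Number of calls to the maximum likelihood oracle. -/
def mleCalls (p : Prog X K M α) : ℕ∞ := p.cost 0 1 0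

/-- Number of instructions executed. -/
def steps (p : Prog X K M α) : ℕ∞ := p.cost 1 1 1

/-- One elementary operation (an arithmetic operation, a square root, a comparison, or the
evaluation of one coordinate of a feature map) with result `z`. -/
def op (z : α) : Prog X K M α := tick (ret z)

/-- `for i = 0, …, n-1 do s ← f i s`, with one unit of overhead per round. -/
def loop : (n : ℕ) → (Fin n → α → Prog X K M α) → α → Prog X K M α
  | 0, _, s => ret s
  | n + 1, f, s => tick ((f 0 s).bind fun s' => loop n (fun i => f i.succ) s')

/-- Run `f 0, …, f (n-1)` in this order and collect the results, with one unit of overhead per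
entry. -/
def collect : (n : ℕ) → (Fin n → Prog X K M α) → Prog X K M (Fin n → α)
  | 0, _ => ret Fin.elim0
  | n + 1, f => tick ((f 0).bind fun z =>
      (collect n fun i => f i.succ).bind fun zs => ret (Fin.cons z zs))

/-- `∑ i, f i`. -/
def sum (n : ℕ) (f : Fin n → Prog X K M ℝ) : Prog X K M ℝ :=
  loop n (fun i s => (f i).bind fun z => op (s + z)) 0

/-- Inner product. -/
def dot {n : ℕ} (y z : Fin n → ℝ) : Prog X K M ℝ := sum n fun i => op (y i * z i)

/-- `(argmax_a q a, max_a q a)` by a linear scan that starts at `a0`. -/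
def argmax (a0 : Fin K) (q : Fin K → ℝ) : Prog X K M (Fin K × ℝ) :=
  loop K (fun a b => op (if b.2 < q a then (a, q a) else b)) (a0, q a0)

/-- Evaluate a feature map. -/
def feature {d : ℕ} (φ : Feature X K d) (x : X) (a : Fin K) : Prog X K M (Fin d → ℝ) :=
  collect d fun i => op (φ x a i)

end Prog

/-! ### Norm-constrained least squares -/

/-- Regression data: `n` pairs of a feature vector and a target. -/
abbrev Rows (d n : ℕ) := Fin n → (Fin d → ℝ) × ℝ

/-- The square loss. -/
def sqLoss {d n : ℕ} (D : Rows d n) (θ : Fin d → ℝ) : ℝ :=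
  ∑ j, (∑ i, θ i * (D j).1 i - (D j).2) ^ 2

/-- A subroutine for the least squares problem over the Euclidean ball of radius `B`. -/
abbrev LSRoutine (X : Type u) (K : ℕ) (M : Type v) (d : ℕ) :=
  ∀ n : ℕ, ℝ → Rows d n → Prog X K M (Fin d → ℝ)

/-- A (measurable) selection of minimizers of the square loss over the Euclidean ball of radius `B`,
ties broken arbitrarily. -/
def IsLeastSquares {d : ℕ} (sol : ∀ n : ℕ, ℝ → Rows d n → Fin d → ℝ) : Prop :=
  (∀ n B, Measurable (sol n B)) ∧
    ∀ n B, 0 ≤ B → ∀ D : Rows d n, ∑ i, sol n B D i ^ 2 ≤ B ^ 2 ∧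
      ∀ θ : Fin d → ℝ, ∑ i, θ i ^ 2 ≤ B ^ 2 → sqLoss D (sol n B D) ≤ sqLoss D θ

/-- The idealized routine that returns an exact minimizer in one operation. -/
def exactLS {X : Type u} {K : ℕ} {M : Type v} {d : ℕ}
    (sol : ∀ n : ℕ, ℝ → Rows d n → Fin d → ℝ) : LSRoutine X K M d :=
  fun n B D => Prog.op (sol n B D)

/-- `N` rounds of the conditional gradient (Frank-Wolfe) method, started at `0`: in round `k`, with
`g` half the gradient of the square loss at `θ`, move from `θ` to
`θ + 2 / (k + 2) * (- B g / ‖g‖₂ - θ)`, and stay at `θ` if `g = 0`. -/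
def conditionalGradient {X : Type u} {K : ℕ} {M : Type v} {d : ℕ} (N : ℕ) : LSRoutine X K M d :=
  fun n B D => Prog.loop N (fun k θ =>
    (Prog.collect n fun j => (Prog.dot θ (D j).1).bind fun p => Prog.op (p - (D j).2)).bind
      fun r =>
    (Prog.collect d fun i => Prog.sum n fun j => Prog.op (r j * (D j).1 i)).bind fun g =>
    (Prog.dot g g).bind fun q =>
    (Prog.op (Real.sqrt q)).bind fun s =>
    (Prog.op ((k : ℝ) + 2)).bind fun c =>
    (Prog.op (2 / c)).bind fun γ =>
    Prog.tick <| if s = 0 then Prog.ret θ else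
      Prog.collect d fun i =>
        (Prog.op (B * g i)).bind fun b =>
        (Prog.op (b / s)).bind fun e =>
        (Prog.op (e + θ i)).bind fun z =>
        (Prog.op (γ * z)).bind fun y =>
        Prog.op (θ i - y)) 0

/-! ### The algorithm -/

/-- A planner output: for each `i < d`, the weight vectors `θ_0, θ_1, …` of the greedy policy
`π̂_i`. -/
abbrev Plan (d : ℕ) := Fin d → ℕ → Fin d → ℝ

section Algorithm

variable {X : Type u} {K d : ℕ} {Φ : Finset (Feature X K d)} {Υ : Finset (Emission X d)}

/-- What is known when stage `h` starts: the models of the times `0, …, h-1` and the plans computed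
in the stages `0, …, h-1`. -/
abbrev Memory (Φ : Finset (Feature X K d)) (Υ : Finset (Emission X d)) (h : ℕ) :=
  (Fin h → Model Φ Υ) × (Fin h → Plan d)

/-- The learned feature map `φ̂_t`, for `t < h`. -/
def Memory.feat {h : ℕ} (S : Memory Φ Υ h) (t : ℕ) : Feature X K d :=
  if ht : t < h then (S.1 ⟨t, ht⟩).phi else 0

/-- The plan of stage `t`, for `t < h`. -/
def Memory.plan {h : ℕ} (S : Memory Φ Υ h) (t : ℕ) : Plan d :=
  if ht : t < h then S.2 ⟨t, ht⟩ else 0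

/-- `Q̂_t(x,a) = R_t(x,a) + ⟨θ, φ̂_t(x,a)⟩`, for planning horizon `l` and the reward functions
`R_{l-1} = φ̂_{l-1}(·,·)[i]` and `R_t = 0` for `t < l - 1`. -/
def qValue (φ : Feature X K d) (l : ℕ) (i : Fin d) (t : ℕ) (θ : Fin d → ℝ) (x : X) (a : Fin K) :
    Prog X K (Model Φ Υ) ℝ :=
  (Prog.feature φ x a).bind fun f =>
  (Prog.dot θ f).bind fun p =>
  if t + 1 = l then Prog.op (f i + p) else Prog.ret p

/-- The greedy action at `x` and the maximum of `Q̂_t(x,·)`. -/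
def greedy (a0 : Fin K) (φ : Feature X K d) (l : ℕ) (i : Fin d) (t : ℕ) (θ : Fin d → ℝ) (x : X) :
    Prog X K (Model Φ Υ) (Fin K × ℝ) :=
  (Prog.collect K fun a => qValue φ l i t θ x a).bind fun q => Prog.argmax a0 q

/-- `V̂_t(x)`, the maximum of `Q̂_t(x,·)` clipped to `[0, l]`. -/
def value (a0 : Fin K) (φ : Feature X K d) (l : ℕ) (i : Fin d) (t : ℕ) (θ : Fin d → ℝ) (x : X) :
    Prog X K (Model Φ Υ) ℝ :=
  (greedy a0 φ l i t θ x).bind fun b =>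
  (Prog.op (min b.2 l)).bind fun y => Prog.op (max y 0)

/-- A uniformly random available action at time `t`. -/
def unifAction (a0 : Fin K) (t : ℕ) : Prog X K (Model Φ Υ) (Fin K) :=
  if t = 0 then Prog.ret a0 else Prog.unif K Prog.ret

/-- Execute `ρ_t`, up to the state at time `t`. `ρ_0` takes no action. `ρ_{l+1}` draws `i` uniformly,
executes the greedy policy `π̂_i` of the plan of stage `l` for the times `0, …, l-1`, and takes a
uniform action at time `l`. -/
def explore (a0 : Fin K) {h : ℕ} (S : Memory Φ Υ h) : ℕ → Prog X K (Model Φ Υ) X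
  | 0 => Prog.reset Prog.ret
  | l + 1 =>
    (Prog.unif d Prog.ret).bind fun i =>
    (Prog.reset Prog.ret).bind fun x0 =>
    (Prog.loop l (fun t x =>
      (if (t : ℕ) = 0 then Prog.ret a0 else
        (greedy a0 (S.feat t) l i t (S.plan l i t) x).bind fun b => Prog.ret b.1).bind fun a =>
      Prog.act a Prog.ret) x0).bind fun _ =>
    (unifAction a0 l).bind fun a => Prog.act a Prog.ret

/-- One triple `(x_t, a_t, x_{t+1})` collected in a new episode by `ρ_t` followed by a uniform
action. -/
def sampleTriple (a0 : Fin K) {h : ℕ} (S : Memory Φ Υ h) (t : ℕ) :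
    Prog X K (Model Φ Υ) (X × Fin K × X) :=
  (explore a0 S t).bind fun x =>
  (unifAction a0 t).bind fun a =>
  (Prog.act a Prog.ret).bind fun x' => Prog.ret (x, a, x')

/-- Linear-FQI in the environment with planning horizon `h` and reward the `i`-th coordinate of
`φ̂_{h-1}`: fitted Q-iteration for the times `t = h-1, …, 0`, each with `n` new samples. The weight
vectors are constrained to Euclidean norm at most `h √d`. -/
def linearFQI (ls : LSRoutine X K (Model Φ Υ) d) (a0 : Fin K) (n : ℕ) {h : ℕ} (S : Memory Φ Υ h)
    (i : Fin d) : Prog X K (Model Φ Υ) (ℕ → Fin d → ℝ) :=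
  Prog.loop h (fun k θ =>
    let t := h - 1 - (k : ℕ)
    (Prog.collect n fun _ => sampleTriple a0 S t).bind fun D =>
    (Prog.collect n fun j =>
      (Prog.feature (S.feat t) (D j).1 (D j).2.1).bind fun f =>
      (if t + 1 = h then Prog.ret 0
        else value a0 (S.feat (t + 1)) h i (t + 1) (θ (t + 1)) (D j).2.2).bind fun y =>
      Prog.ret (f, y)).bind fun rows =>
    (ls n (h * Real.sqrt d) rows).bind fun θt => Prog.ret (Function.update θ t θt)) 0

/-- The first `h` stages of FLAMBE with the planner in the environment, with `n` samples for each
call to the maximum likelihood oracle and `n'` samples for each regression. -/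
def flambeStages (ls : LSRoutine X K (Model Φ Υ) d) (a0 : Fin K) (n n' : ℕ) :
    (h : ℕ) → Prog X K (Model Φ Υ) (Memory Φ Υ h)
  | 0 => Prog.ret (Fin.elim0, Fin.elim0)
  | h + 1 =>
    (flambeStages ls a0 n n' h).bind fun S =>
    (Prog.collect n fun _ => sampleTriple a0 S h).bind fun D =>
    (Prog.mle n D Prog.ret).bind fun m =>
    (Prog.collect d fun i => linearFQI ls a0 n' S i).bind fun plan =>
    Prog.ret (Fin.snoc S.1 m, Fin.snoc S.2 plan)

/-- FLAMBE with the planner in the environment; it returns the learned model. -/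
def flambe (ls : LSRoutine X K (Model Φ Υ) d) (a0 : Fin K) (n n' H : ℕ) :
    Prog X K (Model Φ Υ) (Fin H → Model Φ Υ) :=
  (flambeStages ls a0 n n' H).bind fun S => Prog.ret S.1

end Algorithm

end Flambe

end

/-!
The algorithm learns the transition operators one time step after the other. Its analysis maintains
two properties of the collected data: the maximum likelihood model of time `t` is close to the truth
on average over the data of time `t`, and this data covers the state-action distribution at time `t`
of every policy, with density ratio at most `κ = 2 K² d / η`. Together they give the accuracy under
every policy.

*Maximum likelihood.* The expected square root of the likelihood ratio of a wrong and the true model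
is `1 - H²/2` per sample, where `H²` is the squared Hellinger distance, so that Markov's inequality
and a union bound over the models control the mean of `H²` over the data (`measure_mle_bad_le`). It
dominates the square of the mean `L¹` distance, hence that of the mean total variation distance.

*Planning.* In Linear-FQI for reward `φ̂_{h-1}[i]`, the target `V̂_{t+1}(x_{t+1})` has a conditional
mean that, for the learned model in place of the true one, is linear in `φ̂_t` with weights
`∫ V̂_{t+1} dμ̂_t[j]`, which lie in the ball of radius `h √d`. The square loss is determined by
`d² + d` empirical moments, and Hoeffding's inequality for these gives a uniform deviation bound
over the ball; hence an approximate minimizer has a small mean squared Bellman error on the data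
(`measure_bellman_bad_le`). The conditional gradient method is such an approximate minimizer with
excess loss `O(h² d / N)` (`solvesLS_conditionalGradient`). The data covers all policies, so the
Bellman errors are small under every policy, and the greedy policy is nearly optimal, for the true
transitions, at reaching the latent value `i` of the learned model
(`latentMass_le_greedyPolicy`).

*Coverage.* The data of time `h` consists of one step from the states reached by the greedy policies
of the previous stage. If some policy reaches the true latent value `i` with probability `η`, then,
as the learned model of the time before is accurate under every policy, the states at which
`φ*(·, a)[i]` is large are reached through latent values of the learned model, all of which the
greedy policies reach nearly as often as possible. After a uniformly random action, every reachable
true latent value is therefore hit with probability of order `η / (K d)`, and the next state given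
the latent value does not depend on the policy. This closes the induction over time, in which the
errors do not accumulate because the accuracy of all models is deduced from the same constant `κ`
(`modelError_le`).

*Programs.* The law of a program composes along `Prog.bind` as soon as the continuations depend
measurably on the intermediate results (`Prog.WF`, `Prog.MF`). `Prog.Fail` is a Hoare triple that
tracks failure probabilities; it is applied to the three loops of the algorithm, with `goodWeights`
and `goodMemory` as the invariants. The law of one collected triple does not depend on the state in
which the environment was left, so that datasets are independent samples (`law_collect_iid`,
`law_sampleTriple`).
-/

namespace Flambe

/-! ### Sequential composition of programs -/

namespace Prog

variable {X : Type u} {K : ℕ} {M : Type v} {α : Type w} {β : Type w'}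

theorem bind_ret (p : Prog X K M α) : p.bind ret = p := by
  induction p with
  | ret r => rfl
  | tick p ih => simp [bind, ih]
  | unif n k ih => simp [bind, ih]
  | reset k ih => simp [bind, ih]
  | act a k ih => simp [bind, ih]
  | mle n D k ih => simp [bind, ih]

theorem bind_assoc {γ : Type*} (p : Prog X K M α) (f : α → Prog X K M β)
    (g : β → Prog X K M γ) : (p.bind f).bind g = p.bind fun r => (f r).bind g := by
  induction p with
  | ret r => rfl
  | tick p ih => simp [bind, ih]
  | unif n k ih => simp [bind, ih]
  | reset k ih => simp [bind, ih]
  | act a k ih => simp [bind, ih]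
  | mle n D k ih => simp [bind, ih]

/-- A loop can be unrolled at its end as well as at its beginning. -/
theorem loop_succ_last (n : ℕ) (f : ℕ → α → Prog X K M α) (s : α) :
    loop (n + 1) (fun t r => f t r) s =
      (loop n (fun t r => f t r) s).bind fun r => tick (f n r) := by
  induction n generalizing s f with
  | zero => simp [loop, bind, bind_ret]
  | succ n ih =>
    rw [loop]
    have h := fun r => ih (fun t => f (t + 1)) r
    simp only [Fin.val_succ] at h ⊢
    simp only [h]
    rw [loop]
    simp only [bind, Fin.val_succ, bind_assoc]
    rfl

/-! ### Programs without interaction -/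

/-- The program `p` consists of elementary operations only and returns `r`. -/
inductive Evals : Prog X K M α → α → Prop
  | ret (r : α) : Evals (ret r) r
  | tick {p : Prog X K M α} {r : α} : Evals p r → Evals (tick p) r

theorem Evals.op (z : α) : Evals (op z : Prog X K M α) z := .tick (.ret z)

theorem Evals.bind {p : Prog X K M α} {r : α} {f : α → Prog X K M β} {b : β} (hp : Evals p r)
    (hf : Evals (f r) b) : Evals (p.bind f) b := by
  induction hp with
  | ret r => exact hf
  | tick _ ih => exact .tick (ih hf)

/-- The value computed by a loop whose body is a pure computation. -/
def iterate : (n : ℕ) → (Fin n → α → α) → α → α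
  | 0, _, s => s
  | n + 1, g, s => iterate n (fun i => g i.succ) (g 0 s)

theorem Evals.loop {n : ℕ} {f : Fin n → α → Prog X K M α} {g : Fin n → α → α}
    (h : ∀ i s, Evals (f i s) (g i s)) (s : α) : Evals (loop n f s) (iterate n g s) := by
  induction n generalizing s with
  | zero => exact .ret s
  | succ n ih => exact .tick ((h 0 s).bind (ih (fun i => h i.succ) _))

theorem Evals.collect {n : ℕ} {f : Fin n → Prog X K M α} {g : Fin n → α}
    (h : ∀ i, Evals (f i) (g i)) : Evals (collect n f) g := by
  induction n with
  | zero => exact Subsingleton.elim Fin.elim0 g ▸ .ret _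
  | succ n ih =>
    refine .tick ((h 0).bind ((ih fun i => h i.succ).bind ?_))
    convert Evals.ret (X := X) (K := K) (M := M) g
    exact Fin.cons_self_tail g

theorem iterate_add (n : ℕ) (g : Fin n → ℝ) (s : ℝ) :
    iterate n (fun i s => s + g i) s = s + ∑ i, g i := by
  induction n generalizing s with
  | zero => simp [iterate]
  | succ n ih => rw [iterate, ih, Fin.sum_univ_succ, add_assoc]

theorem Evals.sum {n : ℕ} {f : Fin n → Prog X K M ℝ} {g : Fin n → ℝ}
    (h : ∀ i, Evals (f i) (g i)) : Evals (sum n f) (∑ i, g i) := by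
  have := Evals.loop (f := fun i s => (f i).bind fun z => Prog.op (s + z))
    (g := fun i s => s + g i) (fun i s => (h i).bind (.op _)) 0
  rwa [iterate_add, zero_add] at this

theorem Evals.dot {n : ℕ} (y z : Fin n → ℝ) :
    Evals (dot y z : Prog X K M ℝ) (∑ i, y i * z i) :=
  .sum fun _ => .op _

theorem Evals.feature {d : ℕ} (φ : Feature X K d) (x : X) (a : Fin K) :
    Evals (feature φ x a : Prog X K M _) (φ x a) :=
  .collect fun _ => .op _

/-! ### Cost of composed programs -/

section Cost

variable {r o e c c' : ℕ∞}

theorem cost_bind_le {p : Prog X K M α} {f : α → Prog X K M β} (hp : p.cost r o e ≤ c)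
    (hf : ∀ z, (f z).cost r o e ≤ c') : (p.bind f).cost r o e ≤ c + c' := by
  refine le_trans ?_ (add_le_add_left hp c')
  clear hp
  induction p with
  | ret z => simpa [bind, cost] using hf z
  | tick p ih => simp only [bind, cost, add_assoc]; gcongr
  | unif n k ih =>
    simp only [bind, cost, add_assoc]; gcongr
    exact iSup_le fun i => (ih i).trans (by gcongr; exact le_iSup (fun i => cost r o e (k i)) i)
  | reset k ih =>
    simp only [bind, cost, add_assoc]; gcongr
    exact iSup_le fun i => (ih i).trans (by gcongr; exact le_iSup (fun i => cost r o e (k i)) i)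
  | act a k ih =>
    simp only [bind, cost, add_assoc]; gcongr
    exact iSup_le fun i => (ih i).trans (by gcongr; exact le_iSup (fun i => cost r o e (k i)) i)
  | mle n D k ih =>
    simp only [bind, cost, add_assoc]; gcongr
    exact iSup_le fun i => (ih i).trans (by gcongr; exact le_iSup (fun i => cost r o e (k i)) i)

theorem cost_ret (z : α) : (ret z : Prog X K M α).cost r o e ≤ 0 := le_rfl

theorem cost_tick {p : Prog X K M α} (hp : p.cost r o e ≤ c) : (tick p).cost r o e ≤ e + c := by
  simp only [cost]; gcongr

theorem cost_op (z : α) : (op z : Prog X K M α).cost r o e ≤ e := by simp [op, cost]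

theorem cost_loop {n : ℕ} {f : Fin n → α → Prog X K M α} (hf : ∀ i s, (f i s).cost r o e ≤ c)
    (s : α) : (loop n f s).cost r o e ≤ n * (e + c) := by
  induction n generalizing s with
  | zero => simp [loop, cost]
  | succ n ih =>
    refine (cost_tick (cost_bind_le (hf 0 s) fun z => ih (fun i => hf i.succ) z)).trans ?_
    push_cast
    rw [add_mul, one_mul, ← add_assoc, add_comm]

theorem cost_collect {n : ℕ} {f : Fin n → Prog X K M α} (hf : ∀ i, (f i).cost r o e ≤ c) :
    (collect n f).cost r o e ≤ n * (e + c) := by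
  induction n with
  | zero => simp [collect, cost]
  | succ n ih =>
    refine (cost_tick (cost_bind_le (hf 0) fun z => cost_bind_le (ih fun i => hf i.succ)
      fun zs => cost_ret _)).trans ?_
    push_cast
    rw [add_mul, one_mul, ← add_assoc, add_comm, add_zero]

theorem cost_sum {n : ℕ} {f : Fin n → Prog X K M ℝ} (hf : ∀ i, (f i).cost r o e ≤ c) :
    (sum n f).cost r o e ≤ n * (e + (c + e)) :=
  cost_loop (fun i _ => cost_bind_le (hf i) fun _ => cost_op _) 0

theorem cost_dot {n : ℕ} (y z : Fin n → ℝ) :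
    (dot y z : Prog X K M ℝ).cost r o e ≤ n * (e + (e + e)) :=
  cost_sum fun _ => cost_op _

theorem cost_argmax (a0 : Fin K) (q : Fin K → ℝ) :
    (argmax a0 q : Prog X K M _).cost r o e ≤ K * (e + e) :=
  cost_loop (fun _ _ => cost_op _) _

theorem cost_feature {d : ℕ} (φ : Feature X K d) (x : X) (a : Fin K) :
    (feature φ x a : Prog X K M _).cost r o e ≤ d * (e + e) :=
  cost_collect fun _ => cost_op _

theorem cost_mono {r' o' e' : ℕ∞} (hr : r ≤ r') (ho : o ≤ o') (he : e ≤ e')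
    (p : Prog X K M α) : p.cost r o e ≤ p.cost r' o' e' := by
  induction p with
  | ret z => simp [cost]
  | tick p ih => simp only [cost]; gcongr
  | unif n k ih => simp only [cost]; gcongr; exact ih _
  | reset k ih => simp only [cost]; gcongr; exact ih _
  | act a k ih => simp only [cost]; gcongr; exact ih _
  | mle n D k ih => simp only [cost]; gcongr; exact ih _

theorem trajectories_le_steps (p : Prog X K M α) : p.trajectories ≤ p.steps :=
  cost_mono le_rfl zero_le_one zero_le_one p

end Cost

/-! ### Laws of composed programs -/

section Law

variable [MeasurableSpace X] [MeasurableSpace α] [MeasurableSpace β]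
  {E : MDP X K} {orc : ∀ n, Dataset X K n → M}

/-- Well-formedness of a program along its executions against the oracle `orc`: random choices are
from nonempty sets, and the law of the continuation depends measurably on the observed state, so
that the integrals in the definition of `law` are meaningful. -/
def WF (E : MDP X K) (orc : ∀ n, Dataset X K n → M) : Prog X K M α → Prop
  | ret _ => True
  | tick p => WF E orc p
  | unif n k => n ≠ 0 ∧ ∀ i, WF E orc (k i)
  | reset k => WF E orc (k E.x0)
  | act _ k => (∀ x, WF E orc (k x)) ∧ ∀ t, Measurable fun x => law E orc (k x) (t, x)
  | mle n D k => WF E orc (k (orc n D))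

theorem WF.isProbabilityMeasure {p : Prog X K M α} (hp : WF E orc p) (s : ℕ × X) :
    IsProbabilityMeasure (law E orc p s) := by
  induction p generalizing s with
  | ret r => simp only [law]; infer_instance
  | tick p ih => exact ih hp s
  | unif n k ih =>
    refine ⟨?_⟩
    have : ∀ i, law E orc (k i) s Set.univ = 1 := fun i => (ih i (hp.2 i) s).measure_univ
    simp only [law, Measure.smul_apply, Measure.finsetSum_apply, this, Finset.sum_const,
      Finset.card_univ, Fintype.card_fin, nsmul_eq_mul, mul_one, smul_eq_mul]
    exact ENNReal.inv_mul_cancel (by simpa using hp.1) (by simp)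
  | reset k ih => exact ih _ hp _
  | act a k ih =>
    have := E.markov s.1
    refine ⟨?_⟩
    rw [law, Measure.bind_apply MeasurableSet.univ]
    · have : ∀ x, law E orc (k x) (s.1 + 1, x) Set.univ = 1 :=
        fun x => (ih x (hp.1 x) _).measure_univ
      simp [this]
    · exact (hp.2 _).aemeasurable
  | mle n D k ih => exact ih _ hp s

/-- The law of a sequential composition is the composition of the laws. -/
theorem WF.law_bind {p : Prog X K M α} {f : α → Prog X K M β} (hp : WF E orc p)
    (hf : Measurable fun z : α × (ℕ × X) => law E orc (f z.1) z.2) (s : ℕ × X) :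
    law E orc (p.bind f) s = (law E orc p s).bind fun z => law E orc (f z.1) z.2 := by
  induction p generalizing s with
  | ret r => simp only [bind, law]; rw [Measure.dirac_bind hf]
  | tick p ih => exact ih hp s
  | unif n k ih =>
    simp only [bind, law, ih _ (hp.2 _)]
    ext A hA
    rw [Measure.bind_apply hA hf.aemeasurable]
    simp only [lintegral_smul_measure, lintegral_finsetSum_measure, Measure.smul_apply,
      Measure.finsetSum_apply, Measure.bind_apply hA hf.aemeasurable]
  | reset k ih => exact ih _ hp _
  | act a k ih =>
    simp only [bind, law, ih _ (hp.1 _)]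
    rw [Measure.bind_bind (hp.2 _).aemeasurable hf.aemeasurable]
  | mle n D k ih => exact ih _ hp s

theorem WF.bind {p : Prog X K M α} {f : α → Prog X K M β} (hp : WF E orc p)
    (hf : Measurable fun z : α × (ℕ × X) => law E orc (f z.1) z.2) (hf' : ∀ r, WF E orc (f r)) :
    WF E orc (p.bind f) := by
  induction p with
  | ret r => exact hf' r
  | tick p ih => exact ih hp
  | unif n k ih => exact ⟨hp.1, fun i => ih i (hp.2 i)⟩
  | reset k ih => exact ih _ hp
  | act a k ih =>
    refine ⟨fun x => ih x (hp.1 x), fun t => ?_⟩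
    simp only [law_bind (hp.1 _) hf]
    exact (Measure.measurable_bind' hf).comp (hp.2 t)
  | mle n D k ih => exact ih _ hp

/-- A family of well-formed programs whose laws depend measurably on the parameter and on the
initial configuration of the environment. -/
structure MF {Ω : Type*} [MeasurableSpace Ω] (E : MDP X K) (orc : ∀ n, Dataset X K n → M)
    (p : Ω → Prog X K M α) : Prop where
  wf : ∀ ω, WF E orc (p ω)
  meas : Measurable fun z : Ω × (ℕ × X) => law E orc (p z.1) z.2

variable {Ω : Type*} [MeasurableSpace Ω]

theorem MF.comp {Ω' : Type*} [MeasurableSpace Ω'] {p : Ω → Prog X K M α} (hp : MF E orc p)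
    {g : Ω' → Ω} (hg : Measurable g) : MF E orc fun ω => p (g ω) :=
  ⟨fun ω => hp.wf _, hp.meas.comp (f := fun z : Ω' × (ℕ × X) => (g z.1, z.2)) (by fun_prop)⟩

theorem MF.bind {p : Ω → Prog X K M α} {f : Ω → α → Prog X K M β} (hp : MF E orc p)
    (hf : MF E orc fun z : Ω × α => f z.1 z.2) : MF E orc fun ω => (p ω).bind (f ω) := by
  have hf1 : ∀ ω, Measurable fun z : α × (ℕ × X) => law E orc (f ω z.1) z.2 := fun ω =>
    hf.meas.comp (f := fun z : α × (ℕ × X) => ((ω, z.1), z.2)) (by fun_prop)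
  refine ⟨fun ω => (hp.wf ω).bind (hf1 ω) fun r => hf.wf (ω, r), ?_⟩
  refine Measure.measurable_of_measurable_coe _ fun A hA => ?_
  let κ : Kernel (Ω × (ℕ × X)) (α × (ℕ × X)) := ⟨_, hp.meas⟩
  have : IsMarkovKernel κ := ⟨fun z => (hp.wf z.1).isProbabilityMeasure z.2⟩
  simp only [(hp.wf _).law_bind (hf1 _)]
  have h : ∀ z : Ω × (ℕ × X), ((law E orc (p z.1) z.2).bind
      fun y => law E orc (f z.1 y.1) y.2) A = ∫⁻ y, law E orc (f z.1 y.1) y.2 A ∂κ z :=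
    fun z => Measure.bind_apply hA (hf1 _).aemeasurable
  simp only [h]
  refine Measurable.lintegral_kernel_prod_right (κ := κ)
    (f := fun z y => law E orc (f z.1 y.1) y.2 A) ?_
  exact (Measure.measurable_coe hA).comp (hf.meas.comp
    (f := fun z : (Ω × (ℕ × X)) × (α × (ℕ × X)) => ((z.1.1, z.2.1), z.2.2)) (by fun_prop))

theorem Evals.wf {p : Prog X K M α} {r : α} (h : Evals p r) : WF E orc p := by
  induction h with
  | ret r => trivial
  | tick _ ih => exact ih

theorem Evals.law {p : Prog X K M α} {r : α} (h : Evals p r) (s : ℕ × X) :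
    law E orc p s = Measure.dirac (r, s) := by
  induction h with
  | ret r => rfl
  | tick _ ih => exact ih

theorem MF.of_evals {p : Ω → Prog X K M α} {g : Ω → α} (h : ∀ ω, Evals (p ω) (g ω))
    (hg : Measurable g) : MF E orc p := by
  refine ⟨fun ω => (h ω).wf, ?_⟩
  simp only [(h _).law]
  exact Measure.measurable_dirac.comp (by fun_prop)

theorem MF.ret {g : Ω → α} (hg : Measurable g) : MF E orc fun ω => (ret (g ω) : Prog X K M α) :=
  .of_evals (fun _ => .ret _) hg

theorem MF.tick {p : Ω → Prog X K M α} (hp : MF E orc p) : MF E orc fun ω => tick (p ω) :=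
  ⟨hp.wf, hp.meas⟩

theorem MF.unif {n : ℕ} (hn : n ≠ 0) :
    MF E orc fun _ : Ω => (unif n Prog.ret : Prog X K M (Fin n)) := by
  refine ⟨fun ω => ⟨hn, fun i => trivial⟩, ?_⟩
  simp only [Prog.law]
  refine Measure.measurable_of_measurable_coe _ fun A hA => ?_
  simp only [Measure.smul_apply, Measure.finsetSum_apply, smul_eq_mul]
  refine Measurable.const_mul (Finset.measurable_sum _ fun i _ => ?_) _
  exact (Measure.measurable_coe hA).comp (Measure.measurable_dirac.comp (by fun_prop))

theorem MF.reset : MF E orc fun _ : Ω => (reset Prog.ret : Prog X K M X) :=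
  ⟨fun _ => trivial, by simp only [Prog.law]; exact measurable_const⟩

theorem MF.act {a : Ω → Fin K} (ha : Measurable a) :
    MF E orc fun ω => (act (a ω) Prog.ret : Prog X K M X) := by
  have h1 : ∀ t : ℕ, Measurable fun x : X =>
      Prog.law E orc (Prog.ret x : Prog X K M X) (t, x) := fun t => by
    simp only [Prog.law]; exact Measure.measurable_dirac.comp (by fun_prop)
  refine ⟨fun ω => ⟨fun x => trivial, h1⟩, ?_⟩
  simp only [Prog.law]
  have h2 : Measurable fun z : ℕ × (Ω × X) => (E.T z.1 (z.2.2, a z.2.1)).bind fun x' =>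
      Measure.dirac (x', (z.1 + 1, x')) := by
    refine measurable_from_prod_countable_right fun t => ?_
    refine (Measure.measurable_bind' (h1 (t + 1))).comp ?_
    exact (E.T t).measurable.comp (by fun_prop)
  exact h2.comp (f := fun z : Ω × (ℕ × X) => (z.2.1, (z.1, z.2.2))) (by fun_prop)

theorem MF.mle [MeasurableSpace M] (horc : ∀ n, Measurable (orc n)) {n : ℕ}
    {D : Ω → Dataset X K n} (hD : Measurable D) :
    MF E orc fun ω => (mle n (D ω) Prog.ret : Prog X K M M) := by
  refine ⟨fun _ => trivial, ?_⟩
  simp only [Prog.law]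
  have := horc n
  exact Measure.measurable_dirac.comp (by fun_prop)

theorem MF.loop {n : ℕ} {f : Ω → Fin n → α → Prog X K M α}
    (hf : ∀ i, MF E orc fun z : Ω × α => f z.1 i z.2) {s : Ω → α} (hs : Measurable s) :
    MF E orc fun ω => loop n (f ω) (s ω) := by
  suffices h : MF E orc fun z : Ω × α => Prog.loop n (f z.1) z.2 from
    h.comp (g := fun ω => (ω, s ω)) (by fun_prop)
  clear hs s
  induction n with
  | zero => exact .ret measurable_snd
  | succ n ih =>
    refine .tick (.bind (hf 0) ?_)
    exact (ih (f := fun ω i => f ω i.succ) fun i => hf i.succ).comp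
      (g := fun z : (Ω × α) × α => (z.1.1, z.2)) (by fun_prop)

theorem measurable_finCons {n : ℕ} :
    Measurable fun z : α × (Fin n → α) => (Fin.cons z.1 z.2 : Fin (n + 1) → α) := by
  refine measurable_pi_lambda _ fun i => ?_
  refine Fin.cases ?_ (fun i => ?_) i
  · simpa using measurable_fst
  · simpa using! (measurable_pi_apply i).comp measurable_snd

theorem MF.collect {n : ℕ} {f : Ω → Fin n → Prog X K M α} (hf : ∀ i, MF E orc fun ω => f ω i) :
    MF E orc fun ω => collect n (f ω) := by
  induction n with
  | zero => exact .ret measurable_const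
  | succ n ih =>
    refine .tick (.bind (hf 0) (.bind ((ih fun i => hf i.succ).comp measurable_fst) (.ret ?_)))
    exact measurable_finCons.comp (f := fun z : (Ω × α) × (Fin n → α) => (z.1.2, z.2))
      (by fun_prop)

/-! ### Failure probabilities -/

/-- From every configuration of the environment, the result of `p` lies outside `Q` with probability
at most `δ`. -/
def Fail (E : MDP X K) (orc : ∀ n, Dataset X K n → M) (p : Prog X K M α) (Q : Set α)
    (δ : ℝ≥0∞) : Prop :=
  ∀ s, law E orc p s {z | z.1 ∉ Q} ≤ δ

theorem Fail.mono {p : Prog X K M α} {Q Q' : Set α} {δ δ' : ℝ≥0∞} (h : Fail E orc p Q δ)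
    (hQ : Q ⊆ Q') (hδ : δ ≤ δ') : Fail E orc p Q' δ' := fun s =>
  (measure_mono (s := {z : α × (ℕ × X) | z.1 ∉ Q'})
    (t := {z : α × (ℕ × X) | z.1 ∉ Q}) fun _ hz hz' => hz (hQ hz')).trans
    ((h s).trans hδ)

theorem Evals.fail {p : Prog X K M α} {r : α} (h : Evals p r) {Q : Set α} (hr : r ∈ Q)
    (hQ : MeasurableSet Q) : Fail E orc p Q 0 := fun s => by
  have hb : MeasurableSet {z : α × (ℕ × X) | z.1 ∉ Q} := measurable_fst hQ.compl
  rw [h.law, Measure.dirac_apply' _ hb]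
  simp [hr]

theorem Fail.bind {p : Prog X K M α} {f : α → Prog X K M β} {Q : Set α} {Q' : Set β}
    {δ δ' : ℝ≥0∞} (hp : Fail E orc p Q δ) (hf : ∀ r ∈ Q, Fail E orc (f r) Q' δ')
    (wp : WF E orc p) (wf : MF E orc f) (hQ : MeasurableSet Q) (hQ' : MeasurableSet Q') :
    Fail E orc (p.bind f) Q' (δ + δ') := fun s => by
  have := wp.isProbabilityMeasure s
  have hb : MeasurableSet {z : β × (ℕ × X) | z.1 ∉ Q'} := measurable_fst hQ'.compl
  have hb' : MeasurableSet {z : α × (ℕ × X) | z.1 ∉ Q} := measurable_fst hQ.compl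
  rw [wp.law_bind wf.meas, Measure.bind_apply hb wf.meas.aemeasurable]
  calc ∫⁻ z, law E orc (f z.1) z.2 {z | z.1 ∉ Q'} ∂law E orc p s
      ≤ ∫⁻ z, ({z : α × (ℕ × X) | z.1 ∉ Q}.indicator 1 z + δ') ∂law E orc p s := by
        refine lintegral_mono fun z => ?_
        by_cases hz : z.1 ∈ Q
        · simpa [hz] using hf _ hz z.2
        · have := (wf.wf z.1).isProbabilityMeasure z.2
          simpa [hz] using le_add_right (prob_le_one (μ := law E orc (f z.1) z.2))
    _ = law E orc p s {z | z.1 ∉ Q} + δ' := by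
        rw [lintegral_add_right _ measurable_const, lintegral_indicator_one hb']
        simp
    _ ≤ δ + δ' := by gcongr; exact hp s

theorem Fail.loop {n : ℕ} {f : Fin n → α → Prog X K M α} {I : ℕ → Set α} {δ : ℝ≥0∞}
    (hf : ∀ i : Fin n, ∀ s ∈ I i, Fail E orc (f i s) (I (i + 1)) δ)
    (mf : ∀ i, MF E orc (f i)) (hI : ∀ k, MeasurableSet (I k)) {s : α} (hs : s ∈ I 0) :
    Fail E orc (loop n f s) (I n) (n * δ) := by
  induction n generalizing s I with
  | zero => 
    simpa [Prog.loop] using Evals.fail (E := E) (orc := orc) (K := K) (M := M) (.ret s) hs (hI 0)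
  | succ n ih =>
    have h := Fail.bind (hf 0 s hs) (fun r hr => ih (f := fun i => f i.succ)
      (I := fun k => I (k + 1)) (fun i => hf i.succ) (fun i => mf i.succ)
      (fun k => hI _) hr) ((mf 0).wf s) ?_ (hI _) (hI (n + 1))
    · refine Fail.mono (p := Prog.loop (n + 1) f s) (fun s' => h s') le_rfl ?_
      push_cast; rw [add_mul, one_mul, add_comm]
    · exact .loop (f := fun _ i => f i.succ)
        (fun i => (mf i.succ).comp (g := fun z : α × α => z.2) measurable_snd) measurable_id

theorem Fail.collect {n : ℕ} {f : Fin n → Prog X K M α} {Q : Fin n → Set α} {δ : ℝ≥0∞}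
    (hf : ∀ i, Fail E orc (f i) (Q i) δ) (mf : ∀ i, MF E orc fun _ : Unit => f i)
    (hQ : ∀ i, MeasurableSet (Q i)) :
    Fail E orc (collect n f) {z | ∀ i, z i ∈ Q i} (n * δ) := by
  have hm : ∀ {n : ℕ} {Q : Fin n → Set α}, (∀ i, MeasurableSet (Q i)) →
      MeasurableSet {z : Fin n → α | ∀ i, z i ∈ Q i} := fun {n Q} hQ => by
    have : {z : Fin n → α | ∀ i, z i ∈ Q i} = ⋂ i, (fun z => z i) ⁻¹' Q i := by ext; simp
    rw [this]
    exact MeasurableSet.iInter fun i => measurable_pi_apply i (hQ i)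
  induction n with
  | zero =>
    have := Evals.fail (E := E) (orc := orc) (K := K) (M := M)
      (.ret (Fin.elim0 : Fin 0 → α)) (Q := {z | ∀ i, z i ∈ Q i}) (fun i => i.elim0) (hm hQ)
    simpa [Prog.collect] using this
  | succ n ih =>
    have mc : MF E orc fun _ : Unit => Prog.collect n fun i => f i.succ :=
      .collect (f := fun _ i => f i.succ) fun i => mf i.succ
    have h := Fail.bind (hf 0) (Q' := {z | ∀ i, z i ∈ Q i}) (δ' := n * δ + 0)
      (f := fun z => (Prog.collect n fun i => f i.succ).bind fun zs =>
        Prog.ret (Fin.cons z zs : Fin (n + 1) → α)) (fun r hr => Fail.bind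
        (ih (fun i => hf i.succ) (fun i => mf i.succ) fun i => hQ i.succ) (fun zs hzs => ?_)
        (mc.wf ()) ?_ (hm fun i => hQ i.succ) (hm hQ)) ((mf 0).wf ()) ?_ (hQ 0) (hm hQ)
    · refine Fail.mono (p := Prog.collect (n + 1) f) (fun s' => h s') le_rfl ?_
      push_cast; rw [add_mul, one_mul, add_comm, add_zero]
    · exact Evals.fail (.ret _) (Fin.cases hr hzs) (hm hQ)
    · exact .ret (measurable_finCons.comp (f := fun zs => (r, zs)) (by fun_prop))
    · exact .bind (mc.comp (g := fun _ => ()) measurable_const) (.ret measurable_finCons)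

/-- Independent repetitions of a program whose law does not depend on the initial configuration. -/
theorem law_collect_iid {p : Prog X K M α} {ν : Measure α} [IsProbabilityMeasure ν]
    (mp : MF E orc fun _ : Unit => p) (hp : ∀ s, (law E orc p s).map Prod.fst = ν) (n : ℕ)
    (s : ℕ × X) :
    (law E orc (collect n fun _ => p) s).map Prod.fst = Measure.pi fun _ : Fin n => ν := by
  induction n generalizing s with
  | zero =>
    ext A hA
    rw [Measure.map_apply measurable_fst hA, collect, law,
      Measure.dirac_apply' _ (measurable_fst hA), Measure.pi_of_empty (x := Fin.elim0),
      Measure.dirac_apply' _ hA]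
    rfl
  | succ n ih =>
    have h1 : MF E orc fun z : α => (Prog.collect n fun _ => p).bind fun zs =>
        ret (Fin.cons z zs : Fin (n + 1) → α) :=
      .bind (.comp (g := fun _ => ()) (.collect (f := fun _ _ => p) fun _ => mp)
        measurable_const) (.ret measurable_finCons)
    have h2 : ∀ z : α, Measurable fun y : (Fin n → α) × (ℕ × X) =>
        law E orc (ret (Fin.cons z y.1 : Fin (n + 1) → α) : Prog X K M _) y.2 := fun z => by
      have := (MF.ret (E := E) (orc := orc) (measurable_finCons (α := α) (n := n))).meas
      exact this.comp (f := fun y : (Fin n → α) × (ℕ × X) => ((z, y.1), y.2)) (by fun_prop)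
    have h3 : WF E orc (Prog.collect n fun _ => p) :=
      (MF.collect (f := fun _ _ => p) fun _ => mp).wf ()
    ext A hA
    have hA' : MeasurableSet (Prod.fst ⁻¹' A : Set ((Fin (n + 1) → α) × (ℕ × X))) :=
      measurable_fst hA
    have hA2 : MeasurableSet {z : α × (Fin n → α) | (Fin.cons z.1 z.2 : Fin (n + 1) → α) ∈ A} :=
      measurable_finCons hA
    have key : ∀ z : α, ∀ s', law E orc ((Prog.collect n fun _ => p).bind fun zs =>
        ret (Fin.cons z zs : Fin (n + 1) → α)) s' (Prod.fst ⁻¹' A) =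
        (Measure.pi fun _ : Fin n => ν) {zs | (Fin.cons z zs : Fin (n + 1) → α) ∈ A} := by
      intro z s'
      have hA3 : MeasurableSet {zs : Fin n → α | (Fin.cons z zs : Fin (n + 1) → α) ∈ A} :=
        measurable_prodMk_left hA2
      rw [h3.law_bind (h2 z), Measure.bind_apply hA' (h2 z).aemeasurable, ← ih s',
        Measure.map_apply measurable_fst hA3, ← lintegral_indicator_one (measurable_fst hA3)]
      refine lintegral_congr fun y => ?_
      rw [law, Measure.dirac_apply' _ hA']
      rfl
    rw [Measure.map_apply measurable_fst hA, collect, law, (mp.wf ()).law_bind h1.meas,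
      Measure.bind_apply hA' h1.meas.aemeasurable]
    simp only [key]
    have hm : Measurable fun z : α =>
        (Measure.pi fun _ : Fin n => ν) {zs | (Fin.cons z zs : Fin (n + 1) → α) ∈ A} :=
      measurable_measure_prodMk_left hA2
    rw [← lintegral_map (f := fun z : α => (Measure.pi fun _ : Fin n => ν)
      {zs | (Fin.cons z zs : Fin (n + 1) → α) ∈ A}) hm measurable_fst, hp s,
      ← (measurePreserving_piFinSuccAbove (fun _ : Fin (n + 1) => ν) 0).symm.measure_preimage
        hA.nullMeasurableSet,
      Measure.prod_apply ((MeasurableEquiv.piFinSuccAbove (fun _ => α) 0).symm.measurable hA)]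
    refine lintegral_congr fun z => ?_
    congr 1
    ext zs
    simp [MeasurableEquiv.piFinSuccAbove, Fin.consEquiv]

end Law

end Prog

/-! ### Values computed by the pure parts of the algorithm -/

theorem Prog.measurable_iterate {Ω α : Type*} [MeasurableSpace Ω] [MeasurableSpace α] {n : ℕ}
    {g : Ω → Fin n → α → α} (hg : ∀ i, Measurable fun z : Ω × α => g z.1 i z.2) {s : Ω → α}
    (hs : Measurable s) : Measurable fun ω => Prog.iterate n (g ω) (s ω) := by
  induction n generalizing s with
  | zero => exact hs
  | succ n ih =>
    exact ih (g := fun ω i => g ω i.succ) (fun i => hg i.succ)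
      ((hg 0).comp (f := fun ω => (ω, s ω)) (by fun_prop))

/-- The result of the linear scan `Prog.argmax`. -/
noncomputable def argmaxVal {K : ℕ} (a0 : Fin K) (q : Fin K → ℝ) : Fin K × ℝ :=
  Prog.iterate K (fun a b => if b.2 < q a then (a, q a) else b) (a0, q a0)

theorem argmaxVal_spec {K : ℕ} (a0 : Fin K) (q : Fin K → ℝ) :
    (argmaxVal a0 q).2 = q (argmaxVal a0 q).1 ∧ ∀ a, q a ≤ (argmaxVal a0 q).2 := by
  have key : ∀ (n : ℕ) (g : Fin n → Fin K) (b : Fin K × ℝ), b.2 = q b.1 →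
      let r := Prog.iterate n (fun i b => if b.2 < q (g i) then (g i, q (g i)) else b) b
      r.2 = q r.1 ∧ b.2 ≤ r.2 ∧ ∀ i, q (g i) ≤ r.2 := by
    intro n
    induction n with
    | zero => intro g b hb; exact ⟨hb, le_rfl, fun i => i.elim0⟩
    | succ n ih =>
      intro g b hb
      obtain ⟨h1, h2, h3⟩ := ih (fun i => g i.succ)
        (if b.2 < q (g 0) then (g 0, q (g 0)) else b) (by split_ifs <;> simp [hb])
      refine ⟨h1, le_trans ?_ h2, Fin.cases (le_trans ?_ h2) h3⟩ <;> split_ifs with h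
      · exact h.le
      · exact le_rfl
      · exact le_rfl
      · exact not_lt.mp h
  obtain ⟨h1, -, h3⟩ := key K id (a0, q a0) rfl
  exact ⟨h1, h3⟩

variable {X : Type u} {K d : ℕ}

/-- The value of `qValue`. -/
noncomputable def qVal (φ : Feature X K d) (l : ℕ) (i : Fin d) (t : ℕ) (θ : Fin d → ℝ) (x : X)
    (a : Fin K) : ℝ :=
  (if t + 1 = l then φ x a i else 0) + ∑ j, θ j * φ x a j

/-- The value of `greedy`. -/
noncomputable def greedyVal (a0 : Fin K) (φ : Feature X K d) (l : ℕ) (i : Fin d) (t : ℕ)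
    (θ : Fin d → ℝ) (x : X) : Fin K × ℝ :=
  argmaxVal a0 fun a => qVal φ l i t θ x a

/-- The value of `value`. -/
noncomputable def valueVal (a0 : Fin K) (φ : Feature X K d) (l : ℕ) (i : Fin d) (t : ℕ)
    (θ : Fin d → ℝ) (x : X) : ℝ :=
  max (min (greedyVal a0 φ l i t θ x).2 l) 0

theorem valueVal_nonneg (a0 : Fin K) (φ : Feature X K d) (l : ℕ) (i : Fin d) (t : ℕ)
    (θ : Fin d → ℝ) (x : X) : 0 ≤ valueVal a0 φ l i t θ x := le_max_right _ _

theorem valueVal_le (a0 : Fin K) (φ : Feature X K d) (l : ℕ) (i : Fin d) (t : ℕ)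
    (θ : Fin d → ℝ) (x : X) : valueVal a0 φ l i t θ x ≤ l :=
  max_le (min_le_right _ _) (Nat.cast_nonneg l)

/-- The true one-step backup of an action, if it lies in `[0, l]`, exceeds the clipped value by at
most the error of the estimate `Q̂` at that action. -/
theorem le_valueVal_add {a0 : Fin K} {φ : Feature X K d} {l : ℕ} {i : Fin d} {t : ℕ}
    {θ : Fin d → ℝ} {x : X} (a : Fin K) {c b : ℝ} (hc : c ≤ l) (hb : 0 ≤ b)
    (h : c ≤ qVal φ l i t θ x a + b) : c ≤ valueVal a0 φ l i t θ x + b := by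
  have h1 := (argmaxVal_spec a0 fun a => qVal φ l i t θ x a).2 a
  have h2 : min (greedyVal a0 φ l i t θ x).2 (l : ℝ) ≤ valueVal a0 φ l i t θ x := le_max_left _ _
  have h3 : c - b ≤ min (greedyVal a0 φ l i t θ x).2 (l : ℝ) :=
    le_min (by rw [greedyVal]; linarith) (by linarith)
  linarith

/-- At the greedy action, the clipped value exceeds the true one-step backup, if that is
nonnegative, by at most the error of the estimate `Q̂`. -/
theorem valueVal_le_add {a0 : Fin K} {φ : Feature X K d} {l : ℕ} {i : Fin d} {t : ℕ}
    {θ : Fin d → ℝ} {x : X} {c b : ℝ} (hc : 0 ≤ c) (hb : 0 ≤ b)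
    (h : qVal φ l i t θ x (greedyVal a0 φ l i t θ x).1 ≤ c + b) :
    valueVal a0 φ l i t θ x ≤ c + b := by
  have h1 := (argmaxVal_spec a0 fun a => qVal φ l i t θ x a).1
  refine max_le ((min_le_left _ _).trans ?_) (by linarith)
  rw [greedyVal, h1]
  exact h

section Measurability

variable {Ω : Type*} [MeasurableSpace Ω] {φ : Ω → Feature X K d} {x : Ω → X}
  {θ : Ω → Fin d → ℝ}

theorem measurable_qVal (hφ : ∀ a, Measurable fun ω => φ ω (x ω) a) (hθ : Measurable θ) (l : ℕ)
    (i : Fin d) (t : ℕ) (a : Fin K) :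
    Measurable fun ω => qVal (φ ω) l i t (θ ω) (x ω) a := by
  have h1 : ∀ j, Measurable fun ω => φ ω (x ω) a j := fun j =>
    (measurable_pi_apply j).comp (hφ a)
  have h2 : ∀ j, Measurable fun ω => θ ω j := fun j => (measurable_pi_apply j).comp hθ
  unfold qVal
  refine Measurable.add ?_ (Finset.measurable_sum _ fun j _ => (h2 j).mul (h1 j))
  split_ifs
  · exact h1 i
  · exact measurable_const

theorem measurable_greedyVal (a0 : Fin K) (hφ : ∀ a, Measurable fun ω => φ ω (x ω) a)
    (hθ : Measurable θ) (l : ℕ) (i : Fin d) (t : ℕ) :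
    Measurable fun ω => greedyVal a0 (φ ω) l i t (θ ω) (x ω) := by
  have hq := measurable_qVal hφ hθ l i t
  refine Prog.measurable_iterate (fun a => ?_) (measurable_const.prodMk (hq a0))
  have h1 : Measurable fun z : Ω × (Fin K × ℝ) => qVal (φ z.1) l i t (θ z.1) (x z.1) a :=
    (hq a).comp measurable_fst
  exact Measurable.ite (measurableSet_lt (by fun_prop) h1) (measurable_const.prodMk h1)
    measurable_snd

theorem measurable_valueVal (a0 : Fin K) (hφ : ∀ a, Measurable fun ω => φ ω (x ω) a)
    (hθ : Measurable θ) (l : ℕ) (i : Fin d) (t : ℕ) :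
    Measurable fun ω => valueVal a0 (φ ω) l i t (θ ω) (x ω) :=
  (((measurable_greedyVal a0 hφ hθ l i t).snd).min measurable_const).max measurable_const

end Measurability

section Evals

variable {Φ : Finset (Feature X K d)} {Υ : Finset (Emission X d)}

open Prog

theorem evals_qValue (φ : Feature X K d) (l : ℕ) (i : Fin d) (t : ℕ) (θ : Fin d → ℝ) (x : X)
    (a : Fin K) : Evals (qValue φ l i t θ x a : Prog X K (Model Φ Υ) ℝ) (qVal φ l i t θ x a) := by
  refine (Evals.feature φ x a).bind ((Evals.dot θ _).bind ?_)
  unfold qVal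
  split_ifs
  · exact .op _
  · rw [zero_add]; exact .ret _

theorem evals_greedy (a0 : Fin K) (φ : Feature X K d) (l : ℕ) (i : Fin d) (t : ℕ)
    (θ : Fin d → ℝ) (x : X) : Evals (greedy a0 φ l i t θ x : Prog X K (Model Φ Υ) _)
      (greedyVal a0 φ l i t θ x) :=
  (Evals.collect fun a => evals_qValue φ l i t θ x a).bind (.loop (fun _ _ => .op _) _)

theorem evals_value (a0 : Fin K) (φ : Feature X K d) (l : ℕ) (i : Fin d) (t : ℕ)
    (θ : Fin d → ℝ) (x : X) : Evals (value a0 φ l i t θ x : Prog X K (Model Φ Υ) _)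
      (valueVal a0 φ l i t θ x) :=
  (evals_greedy a0 φ l i t θ x).bind ((Evals.op _).bind (.op _))

end Evals

/-! ### Least squares over a ball -/

/-- The routine `ls` computes `sol` by elementary operations only, and if all feature vectors have
norm at most one, the mean square loss of `sol` is within `γ B` of the minimum over the ball of
radius `B`. -/
structure SolvesLS {M : Type v} (ls : LSRoutine X K M d) (sol : ∀ n : ℕ, ℝ → Rows d n → Fin d → ℝ)
    (γ : ℝ → ℝ) : Prop where
  evals : ∀ n B D, Prog.Evals (ls n B D) (sol n B D)
  meas : ∀ n B, Measurable (sol n B)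
  ball : ∀ n B, 0 ≤ B → ∀ D : Rows d n, (∀ j, ∑ i, (D j).1 i ^ 2 ≤ 1) →
    ∑ i, sol n B D i ^ 2 ≤ B ^ 2
  gap : ∀ n B, 0 ≤ B → ∀ D : Rows d n, (∀ j, ∑ i, (D j).1 i ^ 2 ≤ 1) →
    ∀ θ : Fin d → ℝ, ∑ i, θ i ^ 2 ≤ B ^ 2 → sqLoss D (sol n B D) ≤ sqLoss D θ + n * γ B

theorem solvesLS_exactLS {M : Type v} {sol : ∀ n : ℕ, ℝ → Rows d n → Fin d → ℝ}
    (h : IsLeastSquares sol) {γ : ℝ → ℝ} (hγ : ∀ B, 0 ≤ γ B) :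
    SolvesLS (exactLS sol : LSRoutine X K M d) sol γ where
  evals _ _ _ := .op _
  meas := h.1
  ball n B hB D _ := (h.2 n B hB D).1
  gap n B hB D _ θ hθ := ((h.2 n B hB D).2 θ hθ).trans
    (le_add_of_nonneg_right (mul_nonneg n.cast_nonneg (hγ B)))

/-- Half the gradient of the square loss. -/
def halfGrad {n : ℕ} (D : Rows d n) (θ : Fin d → ℝ) (i : Fin d) : ℝ :=
  ∑ j, (∑ i, θ i * (D j).1 i - (D j).2) * (D j).1 i

/-- One round of the conditional gradient method. -/
noncomputable def cgStep {n : ℕ} (B : ℝ) (D : Rows d n) (k : ℕ) (θ : Fin d → ℝ) : Fin d → ℝ :=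
  if √(∑ i, halfGrad D θ i * halfGrad D θ i) = 0 then θ else
    fun i => θ i - 2 / ((k : ℝ) + 2) *
      (B * halfGrad D θ i / √(∑ i, halfGrad D θ i * halfGrad D θ i) + θ i)

theorem evals_conditionalGradient {M : Type v} (N n : ℕ) (B : ℝ) (D : Rows d n) :
    Prog.Evals (conditionalGradient N n B D : Prog X K M _)
      (Prog.iterate N (fun k θ => cgStep B D k θ) 0) := by
  refine .loop (fun k θ => ?_) 0
  refine Prog.Evals.bind (r := fun j => ∑ i, θ i * (D j).1 i - (D j).2)
    (.collect fun j => (Prog.Evals.dot θ _).bind (.op _)) ?_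
  refine Prog.Evals.bind (r := halfGrad D θ) (.collect fun i => .sum fun j => .op _) ?_
  refine (Prog.Evals.dot _ _).bind ((Prog.Evals.op _).bind ((Prog.Evals.op _).bind
    ((Prog.Evals.op _).bind (.tick ?_))))
  unfold cgStep
  change Prog.Evals (if √(∑ i, halfGrad D θ i * halfGrad D θ i) = 0 then _ else _) _
  split_ifs
  · exact .ret θ
  · exact .collect fun i => (Prog.Evals.op _).bind <| (Prog.Evals.op _).bind <|
      (Prog.Evals.op _).bind <| (Prog.Evals.op _).bind <| .op _

theorem measurable_cgStep {n : ℕ} (B : ℝ) (k : ℕ) :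
    Measurable fun z : Rows d n × (Fin d → ℝ) => cgStep B z.1 k z.2 := by
  have h1 : ∀ i, Measurable fun z : Rows d n × (Fin d → ℝ) => halfGrad z.1 z.2 i := fun i => by
    unfold halfGrad; fun_prop
  have h2 : Measurable fun z : Rows d n × (Fin d → ℝ) =>
      √(∑ i, halfGrad z.1 z.2 i * halfGrad z.1 z.2 i) := by fun_prop
  unfold cgStep
  refine Measurable.ite (h2 (measurableSet_singleton 0)) measurable_snd ?_
  fun_prop

theorem sqLoss_add_smul {n : ℕ} (D : Rows d n) (θ v : Fin d → ℝ) (γ : ℝ) :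
    sqLoss D (fun i => θ i + γ * v i) = sqLoss D θ + 2 * γ * ∑ i, halfGrad D θ i * v i +
      γ ^ 2 * ∑ j, (∑ i, v i * (D j).1 i) ^ 2 := by
  have h : ∑ i, halfGrad D θ i * v i =
      ∑ j, (∑ i, θ i * (D j).1 i - (D j).2) * ∑ i, v i * (D j).1 i := by
    simp only [halfGrad, Finset.sum_mul, Finset.mul_sum]
    rw [Finset.sum_comm]
    exact Finset.sum_congr rfl fun j _ => Finset.sum_congr rfl fun i _ => by ring
  rw [h]
  simp only [sqLoss, Finset.mul_sum (s := (Finset.univ : Finset (Fin n))),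
    ← Finset.sum_add_distrib]
  refine Finset.sum_congr rfl fun j _ => ?_
  have : ∑ i, (θ i + γ * v i) * (D j).1 i =
      ∑ i, θ i * (D j).1 i + γ * ∑ i, v i * (D j).1 i := by
    rw [Finset.mul_sum, ← Finset.sum_add_distrib]
    exact Finset.sum_congr rfl fun i _ => by ring
  rw [this]; ring

/-- Progress of one round: the excess loss contracts by `1 - γ`, up to a curvature term of order
`γ ^ 2`, where `γ = 2 / (k + 2)`. -/
theorem cgStep_spec {n : ℕ} {B : ℝ} (hB : 0 ≤ B) {D : Rows d n}
    (hD : ∀ j, ∑ i, (D j).1 i ^ 2 ≤ 1) (k : ℕ) {θ θ' : Fin d → ℝ} (hθ : ∑ i, θ i ^ 2 ≤ B ^ 2)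
    (hθ' : ∑ i, θ' i ^ 2 ≤ B ^ 2) :
    ∑ i, cgStep B D k θ i ^ 2 ≤ B ^ 2 ∧
      (sqLoss D (cgStep B D k θ) ≤ sqLoss D θ' ∨ sqLoss D (cgStep B D k θ) - sqLoss D θ' ≤
        (1 - 2 / ((k : ℝ) + 2)) * (sqLoss D θ - sqLoss D θ') +
          (2 / ((k : ℝ) + 2)) ^ 2 * (4 * n * B ^ 2)) := by
  set g := halfGrad D θ with hg
  set s := √(∑ i, g i * g i) with hs
  set γ : ℝ := 2 / ((k : ℝ) + 2) with hγ
  have hk : (0 : ℝ) ≤ k := k.cast_nonneg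
  have hγ0 : 0 ≤ γ := by positivity
  have hγ1 : γ ≤ 1 := by rw [hγ, div_le_one (by positivity)]; linarith
  have hss : s ^ 2 = ∑ i, g i * g i := Real.sq_sqrt
    (Finset.sum_nonneg fun i _ => mul_self_nonneg _)
  -- Convexity of the square loss.
  have hconv : sqLoss D θ + 2 * ∑ i, g i * (θ' i - θ i) ≤ sqLoss D θ' := by
    have h := sqLoss_add_smul D θ (fun i => θ' i - θ i) 1
    simp only [one_mul, add_sub_cancel, mul_one, one_pow] at h
    rw [h]
    exact le_add_of_nonneg_right (Finset.sum_nonneg fun j _ => sq_nonneg _)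
  by_cases h0 : s = 0
  · have hstep : cgStep B D k θ = θ := if_pos h0
    have hg0 : ∀ i, g i = 0 := fun i => by
      have h1 : ∑ i, g i * g i = 0 := by rw [← hss, h0]; norm_num
      exact mul_self_eq_zero.mp
        ((Finset.sum_eq_zero_iff_of_nonneg fun i _ => mul_self_nonneg _).mp h1 i
          (Finset.mem_univ i))
    rw [hstep]
    refine ⟨hθ, .inl ?_⟩
    simpa [hg0] using hconv
  · have hspos : 0 < s := lt_of_le_of_ne (Real.sqrt_nonneg _) (Ne.symm h0)
    set v : Fin d → ℝ := fun i => -(B * g i / s + θ i) with hv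
    have hstep : cgStep B D k θ = fun i => θ i + γ * v i := by
      rw [cgStep, if_neg h0]; funext i; simp only [hv]; ring
    have hgrad : ∑ i, (B * g i / s) ^ 2 = B ^ 2 := by
      have : ∀ i, (B * g i / s) ^ 2 = B ^ 2 / s ^ 2 * (g i * g i) := fun i => by ring
      simp only [this, ← Finset.mul_sum, ← hss]
      field_simp
    have hmix : ∀ i, (θ i + γ * v i) ^ 2 ≤ (1 - γ) * θ i ^ 2 + γ * (B * g i / s) ^ 2 := fun i => by
      simp only [hv]
      nlinarith [mul_nonneg (mul_nonneg hγ0 (sub_nonneg.mpr hγ1))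
        (sq_nonneg (θ i + B * g i / s))]
    -- `- B g / ‖g‖` minimizes the linearized loss over the ball.
    have hcs : ∑ i, g i * θ' i ≥ -(B * s) := by
      have h1 := Finset.sum_mul_sq_le_sq_mul_sq Finset.univ g θ'
      have h2 : ∑ i, g i ^ 2 = s ^ 2 := by rw [hss]; simp only [sq]
      have h3 : (∑ i, g i * θ' i) ^ 2 ≤ (B * s) ^ 2 := by
        rw [h2] at h1
        calc _ ≤ _ := h1
          _ ≤ s ^ 2 * B ^ 2 := by gcongr
          _ = _ := by ring
      exact (abs_le.mp (abs_le_of_sq_le_sq h3 (by positivity))).1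
    have hgv : ∑ i, g i * v i ≤ ∑ i, g i * (θ' i - θ i) := by
      have h1 : ∑ i, g i * v i = -(B * s) - ∑ i, g i * θ i := by
        have : ∀ i, g i * v i = -(B / s) * (g i * g i) - g i * θ i := fun i => by
          simp only [hv]; ring
        simp only [this, Finset.sum_sub_distrib, ← Finset.mul_sum, ← hss]
        field_simp
      simp only [mul_sub, Finset.sum_sub_distrib]
      linarith
    have hvn : ∑ i, v i ^ 2 ≤ 4 * B ^ 2 := by
      calc ∑ i, v i ^ 2 ≤ ∑ i, (2 * (B * g i / s) ^ 2 + 2 * θ i ^ 2) :=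
            Finset.sum_le_sum fun i _ => by
              simp only [hv]; nlinarith [sq_nonneg (B * g i / s - θ i)]
        _ ≤ 4 * B ^ 2 := by
            rw [Finset.sum_add_distrib, ← Finset.mul_sum, ← Finset.mul_sum, hgrad]; linarith
    have hcurv : ∑ j, (∑ i, v i * (D j).1 i) ^ 2 ≤ 4 * n * B ^ 2 := by
      calc ∑ j, (∑ i, v i * (D j).1 i) ^ 2 ≤ ∑ _j : Fin n, 4 * B ^ 2 :=
            Finset.sum_le_sum fun j _ => by
              refine (Finset.sum_mul_sq_le_sq_mul_sq Finset.univ v (D j).1).trans ?_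
              have h5 : 0 ≤ ∑ i, (D j).1 i ^ 2 := Finset.sum_nonneg fun i _ => sq_nonneg _
              calc _ ≤ 4 * B ^ 2 * 1 := mul_le_mul hvn (hD j) h5 (by positivity)
                _ = _ := mul_one _
        _ = _ := by simp; ring
    refine ⟨?_, .inr ?_⟩
    · rw [hstep]
      refine (Finset.sum_le_sum fun i _ => hmix i).trans ?_
      rw [Finset.sum_add_distrib, ← Finset.mul_sum, ← Finset.mul_sum, hgrad]
      nlinarith
    · rw [hstep, sqLoss_add_smul]
      have h1 : γ ^ 2 * ∑ j, (∑ i, v i * (D j).1 i) ^ 2 ≤ γ ^ 2 * (4 * n * B ^ 2) := by gcongr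
      have h2 : 2 * γ * ∑ i, g i * v i ≤ γ * (sqLoss D θ' - sqLoss D θ) := by
        nlinarith
      linarith

/-- The last round of a pure loop over time-indexed bodies. -/
theorem Prog.iterate_succ_last {α : Type*} (n : ℕ) (g : ℕ → α → α) (s : α) :
    Prog.iterate (n + 1) (fun t r => g t r) s = g n (Prog.iterate n (fun t r => g t r) s) := by
  induction n generalizing s g with
  | zero => rfl
  | succ n ih =>
    rw [Prog.iterate]
    exact ih (fun t => g (t + 1)) _

/-- The `O(1 / N)` rate of the conditional gradient method. -/
theorem conditionalGradient_rate {n : ℕ} {B : ℝ} (hB : 0 ≤ B) {D : Rows d n}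
    (hD : ∀ j, ∑ i, (D j).1 i ^ 2 ≤ 1) {θ' : Fin d → ℝ} (hθ' : ∑ i, θ' i ^ 2 ≤ B ^ 2) (N : ℕ) :
    ∑ i, Prog.iterate N (fun k θ => cgStep B D k θ) 0 i ^ 2 ≤ B ^ 2 ∧
      (1 ≤ N → sqLoss D (Prog.iterate N (fun k θ => cgStep B D k θ) 0) - sqLoss D θ' ≤
        16 * n * B ^ 2 / (N + 2)) := by
  have hC : 0 ≤ 16 * n * B ^ 2 := by positivity
  induction N with
  | zero => refine ⟨?_, fun h => absurd h (by norm_num)⟩; simp [Prog.iterate]; positivity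
  | succ N ih =>
    rw [Prog.iterate_succ_last]
    set θ := Prog.iterate N (fun k θ => cgStep B D k θ) 0
    obtain ⟨h1, h2⟩ := cgStep_spec hB hD N ih.1 hθ'
    refine ⟨h1, fun _ => ?_⟩
    have hN : (0 : ℝ) ≤ N := N.cast_nonneg
    rcases h2 with h2 | h2
    · refine le_trans (sub_nonpos.mpr h2) (by positivity)
    · refine h2.trans ?_
      push_cast
      rcases Nat.eq_zero_or_pos N with rfl | hpos
      · norm_num
        rw [le_div_iff₀ (by norm_num)]
        linarith
      · have h3 := ih.2 hpos
        set C := 16 * n * B ^ 2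
        have h4 : 1 - 2 / ((N : ℝ) + 2) = N / (N + 2) := by field_simp; ring
        have h5 : 4 * n * B ^ 2 = C / 4 := by simp only [C]; ring
        rw [h4, h5]
        calc (N : ℝ) / (N + 2) * (sqLoss D θ - sqLoss D θ') + (2 / ((N : ℝ) + 2)) ^ 2 * (C / 4)
            ≤ N / (N + 2) * (C / (N + 2)) + (2 / ((N : ℝ) + 2)) ^ 2 * (C / 4) := by gcongr
          _ = C * ((N + 1) / (N + 2) ^ 2) := by field_simp; ring
          _ ≤ C * (1 / (N + 1 + 2)) := by
              refine mul_le_mul_of_nonneg_left ?_ hC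
              rw [div_le_div_iff₀ (by positivity) (by positivity)]
              nlinarith
          _ = C / (N + 1 + 2) := by ring

theorem solvesLS_conditionalGradient {M : Type v} {N : ℕ} (hN : 1 ≤ N) :
    SolvesLS (conditionalGradient N : LSRoutine X K M d)
      (fun _ B D => Prog.iterate N (fun k θ => cgStep B D k θ) 0)
      fun B => 16 * B ^ 2 / (N + 2) where
  evals _ _ _ := evals_conditionalGradient N _ _ _
  meas n B := Prog.measurable_iterate (g := fun (D : Rows d n) k θ => cgStep B D k θ)
    (fun k => measurable_cgStep B k) measurable_const
  ball n B hB D hD := (conditionalGradient_rate hB hD (θ' := 0) (by simp; positivity) N).1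
  gap n B hB D hD θ hθ := by
    have := (conditionalGradient_rate hB hD hθ N).2 hN
    have h2 : (n : ℝ) * (16 * B ^ 2 / (N + 2)) = 16 * n * B ^ 2 / (N + 2) := by ring
    rw [h2]; linarith

/-! ### Distances between densities -/

section Distances

variable {X : Type*} [MeasurableSpace X] {vol : Measure X} {f g : X → ℝ}

/-- The squared Hellinger distance of two densities, without the customary factor `1/2`. -/
noncomputable def sqHellinger (vol : Measure X) (f g : X → ℝ) : ℝ≥0∞ :=
  ∫⁻ x, ENNReal.ofReal ((√(f x) - √(g x)) ^ 2) ∂vol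

/-- The `L¹` distance of two densities. -/
noncomputable def l1Dist (vol : Measure X) (f g : X → ℝ) : ℝ≥0∞ :=
  ∫⁻ x, ENNReal.ofReal |f x - g x| ∂vol

/-- By Cauchy–Schwarz, the `L¹` distance is at most twice the Hellinger distance. -/
theorem l1Dist_sq_le (hf : Measurable f) (hg : Measurable g) (hf0 : ∀ x, 0 ≤ f x)
    (hg0 : ∀ x, 0 ≤ g x) (hf1 : ∫⁻ x, ENNReal.ofReal (f x) ∂vol = 1)
    (hg1 : ∫⁻ x, ENNReal.ofReal (g x) ∂vol = 1) :
    l1Dist vol f g ^ 2 ≤ 4 * sqHellinger vol f g := by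
  have hu : Measurable fun x => ENNReal.ofReal |√(f x) - √(g x)| := by fun_prop
  have hv : Measurable fun x => ENNReal.ofReal (√(f x) + √(g x)) := by fun_prop
  have h1 : l1Dist vol f g = ∫⁻ x, ((fun x => ENNReal.ofReal |√(f x) - √(g x)|) *
      fun x => ENNReal.ofReal (√(f x) + √(g x))) x ∂vol := by
    refine lintegral_congr fun x => ?_
    rw [Pi.mul_apply, ← ENNReal.ofReal_mul (abs_nonneg _)]
    congr 1
    have hs : 0 ≤ √(f x) + √(g x) := by positivity
    rw [← abs_of_nonneg hs, ← abs_mul]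
    congr 1
    have h1 := Real.sq_sqrt (hf0 x)
    have h2 := Real.sq_sqrt (hg0 x)
    linear_combination h2 - h1
  have h2 := ENNReal.lintegral_mul_le_Lp_mul_Lq vol Real.HolderConjugate.two_two
    hu.aemeasurable hv.aemeasurable
  rw [← h1] at h2
  have h3 : ∫⁻ x, ENNReal.ofReal |√(f x) - √(g x)| ^ (2 : ℝ) ∂vol = sqHellinger vol f g := by
    refine lintegral_congr fun x => ?_
    rw [ENNReal.rpow_two, ← ENNReal.ofReal_pow (abs_nonneg _), sq_abs]
  have h4 : ∫⁻ x, ENNReal.ofReal (√(f x) + √(g x)) ^ (2 : ℝ) ∂vol ≤ 4 := by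
    calc ∫⁻ x, ENNReal.ofReal (√(f x) + √(g x)) ^ (2 : ℝ) ∂vol
        ≤ ∫⁻ x, (2 * ENNReal.ofReal (f x) + 2 * ENNReal.ofReal (g x)) ∂vol := by
          refine lintegral_mono fun x => ?_
          have h5 : (2 : ℝ≥0∞) = ENNReal.ofReal 2 := by simp
          rw [ENNReal.rpow_two, ← ENNReal.ofReal_pow (by positivity), h5,
            ← ENNReal.ofReal_mul (by norm_num), ← ENNReal.ofReal_mul (by norm_num),
            ← ENNReal.ofReal_add (mul_nonneg (by norm_num) (hf0 x))
              (mul_nonneg (by norm_num) (hg0 x))]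
          refine ENNReal.ofReal_le_ofReal ?_
          nlinarith [Real.sq_sqrt (hf0 x), Real.sq_sqrt (hg0 x), sq_nonneg (√(f x) - √(g x))]
      _ = 4 := by
          rw [lintegral_add_left (by fun_prop), lintegral_const_mul _ (by fun_prop),
            lintegral_const_mul _ (by fun_prop), hf1, hg1]
          norm_num
  rw [h3] at h2
  calc l1Dist vol f g ^ 2
      ≤ (sqHellinger vol f g ^ (1 / 2 : ℝ) * 4 ^ (1 / 2 : ℝ)) ^ 2 := by
        gcongr
        exact h2.trans (by gcongr)
    _ = 4 * sqHellinger vol f g := by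
        rw [mul_pow, ← ENNReal.rpow_two, ← ENNReal.rpow_two, ← ENNReal.rpow_mul,
          ← ENNReal.rpow_mul, mul_comm]
        norm_num

/-- Under `g`, the square root of the likelihood ratio `f / g` has mean `1 - H² / 2`. -/
theorem two_mul_lintegral_sqrt_div_add (hf : Measurable f) (hg : Measurable g)
    (hf0 : ∀ x, 0 ≤ f x) (hg0 : ∀ x, 0 ≤ g x) (hf1 : ∫⁻ x, ENNReal.ofReal (f x) ∂vol = 1)
    (hg1 : ∫⁻ x, ENNReal.ofReal (g x) ∂vol = 1) :
    2 * ∫⁻ x, ENNReal.ofReal √(f x / g x) ∂(vol.withDensity fun x => ENNReal.ofReal (g x)) +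
      sqHellinger vol f g = 2 := by
  rw [lintegral_withDensity_eq_lintegral_mul _ (by fun_prop) (by fun_prop), sqHellinger,
    ← lintegral_const_mul _ (by fun_prop), ← lintegral_add_left (by fun_prop)]
  calc _ = ∫⁻ x, (ENNReal.ofReal (f x) + ENNReal.ofReal (g x)) ∂vol := by
        refine lintegral_congr fun x => ?_
        have h5 : (2 : ℝ≥0∞) = ENNReal.ofReal 2 := by simp
        rw [Pi.mul_apply, ← ENNReal.ofReal_mul (hg0 x), h5, ← ENNReal.ofReal_mul (by norm_num),
          ← ENNReal.ofReal_add (mul_nonneg (by norm_num) (mul_nonneg (hg0 x) (by positivity)))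
            (by positivity), ← ENNReal.ofReal_add (hf0 x) (hg0 x)]
        congr 1
        have h6 : g x * √(f x / g x) = √(f x) * √(g x) := by
          rcases (hg0 x).eq_or_lt with h | h
          · simp [← h]
          · rw [Real.sqrt_div (hf0 x)]
            have : g x = √(g x) * √(g x) := (Real.mul_self_sqrt (hg0 x)).symm
            have h7 : √(g x) ≠ 0 := (Real.sqrt_pos.mpr h).ne'
            nth_rw 1 [this]
            field_simp
        rw [h6]
        linear_combination Real.sq_sqrt (hf0 x) + Real.sq_sqrt (hg0 x)
    _ = 2 := by
        rw [lintegral_add_left (by fun_prop), hf1, hg1]; norm_num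

end Distances

/-! ### Low rank models -/

section Densities

variable {X : Type u} [MeasurableSpace X] {K d : ℕ} {vol : Measure X} {φ : Feature X K d}
  {μ : Emission X d}

/-- A feature map with values in the probability simplex. -/
structure GoodFeature (φ : Feature X K d) : Prop where
  meas : ∀ a, Measurable fun x => φ x a
  simplex : ∀ x a, φ x a ∈ stdSimplex ℝ (Fin d)

/-- An embedding of next states whose coordinates are probability densities. -/
structure GoodEmission (vol : Measure X) (μ : Emission X d) : Prop where
  meas : Measurable μ
  nonneg : ∀ x i, 0 ≤ μ x i
  lintegral : ∀ i, ∫⁻ x, ENNReal.ofReal (μ x i) ∂vol = 1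

theorem GoodFeature.nonneg (hφ : GoodFeature φ) (x : X) (a : Fin K) (i : Fin d) :
    0 ≤ φ x a i := (hφ.simplex x a).1 i

theorem GoodFeature.sum_eq (hφ : GoodFeature φ) (x : X) (a : Fin K) : ∑ i, φ x a i = 1 :=
  (hφ.simplex x a).2

theorem GoodFeature.le_one (hφ : GoodFeature φ) (x : X) (a : Fin K) (i : Fin d) :
    φ x a i ≤ 1 :=
  (Finset.single_le_sum (fun j _ => hφ.nonneg x a j) (Finset.mem_univ i)).trans_eq
    (hφ.sum_eq x a)

theorem GoodFeature.sum_sq_le (hφ : GoodFeature φ) (x : X) (a : Fin K) :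
    ∑ i, φ x a i ^ 2 ≤ 1 := by
  rw [← hφ.sum_eq x a]
  exact Finset.sum_le_sum fun i _ => by nlinarith [hφ.nonneg x a i, hφ.le_one x a i]

theorem GoodFeature.measurable_uncurry (hφ : GoodFeature φ) :
    Measurable fun p : X × Fin K => φ p.1 p.2 :=
  measurable_from_prod_countable_left hφ.meas

theorem GoodFeature.measurable_coord (hφ : GoodFeature φ) (i : Fin d) :
    Measurable fun p : X × Fin K => φ p.1 p.2 i :=
  (measurable_pi_apply i).comp hφ.measurable_uncurry

theorem GoodEmission.measurable_coord (hμ : GoodEmission vol μ) (i : Fin d) :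
    Measurable fun x => μ x i :=
  (measurable_pi_apply i).comp hμ.meas

theorem density_nonneg (hφ : GoodFeature φ) (hμ : GoodEmission vol μ) (x : X) (a : Fin K)
    (x' : X) : 0 ≤ density φ μ x a x' :=
  Finset.sum_nonneg fun i _ => mul_nonneg (hφ.nonneg x a i) (hμ.nonneg x' i)

theorem measurable_density (hφ : GoodFeature φ) (hμ : GoodEmission vol μ) :
    Measurable fun z : (X × Fin K) × X => density φ μ z.1.1 z.1.2 z.2 :=
  Finset.measurable_sum _ fun i _ => ((hφ.measurable_coord i).comp measurable_fst).mul
    ((hμ.measurable_coord i).comp measurable_snd)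

theorem measurable_density_right (hμ : GoodEmission vol μ) (x : X) (a : Fin K) :
    Measurable fun x' => density φ μ x a x' :=
  Finset.measurable_sum _ fun i _ => (hμ.measurable_coord i).const_mul _

/-- The measure of the `i`-th coordinate of `μ`. -/
noncomputable def emissionMeasure (vol : Measure X) (μ : Emission X d) (i : Fin d) : Measure X :=
  vol.withDensity fun x => ENNReal.ofReal (μ x i)

theorem GoodEmission.isProbabilityMeasure (hμ : GoodEmission vol μ) (i : Fin d) :
    IsProbabilityMeasure (emissionMeasure vol μ i) :=
  ⟨by rw [emissionMeasure, withDensity_apply _ MeasurableSet.univ, Measure.restrict_univ,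
    hμ.lintegral i]⟩

/-- The measure `⟨φ(x,a), μ(·)⟩` is a mixture of the coordinates of `μ` with weights `φ(x,a)`. -/
theorem lintegral_densityMeasure (hφ : GoodFeature φ) (hμ : GoodEmission vol μ) (x : X)
    (a : Fin K) {g : X → ℝ≥0∞} (hg : Measurable g) :
    ∫⁻ x', g x' ∂densityMeasure vol φ μ x a =
      ∑ i, ENNReal.ofReal (φ x a i) * ∫⁻ x', g x' ∂emissionMeasure vol μ i := by
  have h1 := measurable_density_right (φ := φ) hμ x a
  have h2 := hμ.measurable_coord
  rw [densityMeasure, lintegral_withDensity_eq_lintegral_mul _ (by fun_prop) hg]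
  have h3 : ∀ i, ENNReal.ofReal (φ x a i) * ∫⁻ x', g x' ∂emissionMeasure vol μ i =
      ∫⁻ x', ENNReal.ofReal (φ x a i) * (ENNReal.ofReal (μ x' i) * g x') ∂vol := fun i => by
    have := h2 i
    rw [lintegral_const_mul _ (by fun_prop), emissionMeasure,
      lintegral_withDensity_eq_lintegral_mul _ (by fun_prop) hg]
    rfl
  simp only [h3]
  rw [← lintegral_finsetSum _ fun i _ => by have := h2 i; fun_prop]
  refine lintegral_congr fun x' => ?_
  rw [Pi.mul_apply, density,
    ENNReal.ofReal_sum_of_nonneg fun i _ => mul_nonneg (hφ.nonneg x a i) (hμ.nonneg x' i),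
    Finset.sum_mul]
  refine Finset.sum_congr rfl fun i _ => ?_
  rw [ENNReal.ofReal_mul (hφ.nonneg x a i), mul_assoc]

theorem isProbabilityMeasure_densityMeasure (hφ : GoodFeature φ) (hμ : GoodEmission vol μ)
    (x : X) (a : Fin K) : IsProbabilityMeasure (densityMeasure vol φ μ x a) := ⟨by
  have h := lintegral_densityMeasure hφ hμ x a (measurable_const (a := (1 : ℝ≥0∞)))
  have h2 : ∀ i, emissionMeasure vol μ i Set.univ = 1 := fun i =>
    (hμ.isProbabilityMeasure i).measure_univ
  simp only [lintegral_const, one_mul, h2, mul_one] at h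
  rw [h, ← ENNReal.ofReal_sum_of_nonneg fun i _ => hφ.nonneg x a i, hφ.sum_eq,
    ENNReal.ofReal_one]⟩

theorem lintegral_density (hφ : GoodFeature φ) (hμ : GoodEmission vol μ) (x : X) (a : Fin K) :
    ∫⁻ x', ENNReal.ofReal (density φ μ x a x') ∂vol = 1 := by
  have := (isProbabilityMeasure_densityMeasure hφ hμ x a).measure_univ
  rwa [densityMeasure, withDensity_apply _ MeasurableSet.univ, Measure.restrict_univ] at this

/-- Integrals of functions with values in `[0, 1]` differ by at most the `L¹` distance. -/
theorem lintegral_densityMeasure_le {φ' : Feature X K d} {μ' : Emission X d}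
    (hμ : GoodEmission vol μ) (hμ' : GoodEmission vol μ') (x : X)
    (a : Fin K) {g : X → ℝ≥0∞} (hg : Measurable g) (hg1 : ∀ x, g x ≤ 1) :
    ∫⁻ x', g x' ∂densityMeasure vol φ μ x a ≤ ∫⁻ x', g x' ∂densityMeasure vol φ' μ' x a +
      l1Dist vol (density φ μ x a) (density φ' μ' x a) := by
  have h1 := measurable_density_right (φ := φ) hμ x a
  have h2 := measurable_density_right (φ := φ') hμ' x a
  rw [densityMeasure, densityMeasure, lintegral_withDensity_eq_lintegral_mul _ (by fun_prop) hg,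
    lintegral_withDensity_eq_lintegral_mul _ (by fun_prop) hg, l1Dist,
    ← lintegral_add_left (by fun_prop)]
  refine lintegral_mono fun x' => ?_
  simp only [Pi.mul_apply]
  calc ENNReal.ofReal (density φ μ x a x') * g x'
      ≤ (ENNReal.ofReal (density φ' μ' x a x') +
          ENNReal.ofReal |density φ μ x a x' - density φ' μ' x a x'|) * g x' := by
        gcongr
        refine le_trans (ENNReal.ofReal_le_ofReal ?_) ENNReal.ofReal_add_le
        linarith [le_abs_self (density φ μ x a x' - density φ' μ' x a x')]
    _ ≤ _ := by
        rw [add_mul]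
        gcongr
        exact mul_le_of_le_one_right' (hg1 x')

theorem tvDist_le_l1Dist {φ' : Feature X K d} {μ' : Emission X d} (hφ : GoodFeature φ)
    (hφ' : GoodFeature φ') (hμ : GoodEmission vol μ) (hμ' : GoodEmission vol μ') (x : X)
    (a : Fin K) : tvDist (densityMeasure vol φ μ x a) (densityMeasure vol φ' μ' x a) ≤
      l1Dist vol (density φ μ x a) (density φ' μ' x a) := by
  have i1 := isProbabilityMeasure_densityMeasure hφ hμ x a
  have i2 := isProbabilityMeasure_densityMeasure hφ' hμ' x a
  refine iSup₂_le fun s hs => ?_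
  have key : ∀ s, MeasurableSet s → ∀ (φ φ' : Feature X K d) (μ μ' : Emission X d),
      GoodEmission vol μ → GoodEmission vol μ' →
      densityMeasure vol φ μ x a s ≤ densityMeasure vol φ' μ' x a s +
        l1Dist vol (density φ μ x a) (density φ' μ' x a) := by
    intro s hs φ φ' μ μ' hμ hμ'
    have := lintegral_densityMeasure_le (φ := φ) (φ' := φ') hμ hμ' x a
      (measurable_one.indicator hs) (g := s.indicator 1)
      (fun x => by by_cases h : x ∈ s <;> simp [h])
    rwa [lintegral_indicator_one hs, lintegral_indicator_one hs] at this
  have hsymm : l1Dist vol (density φ' μ' x a) (density φ μ x a) =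
      l1Dist vol (density φ μ x a) (density φ' μ' x a) := by
    simp only [l1Dist, abs_sub_comm]
  have k1 := key s hs φ φ' μ μ' hμ hμ'
  have k2 := key s hs φ' φ μ' μ hμ' hμ
  rw [hsymm] at k2
  set D := l1Dist vol (density φ μ x a) (density φ' μ' x a)
  rcases eq_or_ne D ⊤ with hD | hD
  · rw [hD]; exact le_top
  rw [← ENNReal.ofReal_toReal hD]
  refine ENNReal.ofReal_le_ofReal (abs_sub_le_iff.mpr ?_)
  simp only [measureReal_def]
  have e1 := ENNReal.toReal_mono (by finiteness) k1
  have e2 := ENNReal.toReal_mono (by finiteness) k2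
  rw [ENNReal.toReal_add (by finiteness) hD] at e1 e2
  constructor <;> linarith

end Densities

/-! ### Concentration for independent samples -/

section Concentration

variable {Z : Type*} [MeasurableSpace Z] {ν : Measure Z} [IsProbabilityMeasure ν]

theorem lintegral_pi_prod (n : ℕ) {f : Z → ℝ≥0∞} (hf : Measurable f) :
    ∫⁻ D, ∏ j, f (D j) ∂Measure.pi (fun _ : Fin n => ν) = (∫⁻ z, f z ∂ν) ^ n := by
  induction n with
  | zero => simp
  | succ n ih =>
    have h1 := (measurePreserving_piFinSuccAbove (fun _ : Fin (n + 1) => ν) 0).lintegral_comp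
      (f := fun z : Z × (Fin n → Z) => f z.1 * ∏ j, f (z.2 j)) (by fun_prop)
    rw [lintegral_prod_mul (f := f) (g := fun D : Fin n → Z => ∏ j, f (D j)) hf.aemeasurable
      (Finset.measurable_prod _ fun j _ => hf.comp (measurable_pi_apply j)).aemeasurable, ih] at h1
    rw [pow_succ', ← h1]
    refine lintegral_congr fun D => ?_
    rw [Fin.prod_univ_succ]
    rfl

theorem hasSubgaussianMGF_pi {n : ℕ} {q : Z → ℝ} (hq : Measurable q)
    (hq01 : ∀ z, q z ∈ Set.Icc (0 : ℝ) 1) (j : Fin n) :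
    HasSubgaussianMGF (fun D : Fin n → Z => q (D j) - ∫ z, q z ∂ν) (1 / 4)
      (Measure.pi fun _ : Fin n => ν) := by
  have h := hasSubgaussianMGF_of_mem_Icc (μ := ν) hq.aemeasurable (.of_forall hq01)
  have h2 : ((‖(1 : ℝ) - 0‖₊ / 2) ^ 2 : NNReal) = 1 / 4 := by
    ext; norm_num
  rw [h2] at h
  have h3 := (measurePreserving_eval (fun _ : Fin n => ν) j)
  rw [← h3.map_eq] at h
  have h4 := h.of_map h3.measurable.aemeasurable
  convert h4 using 1
  funext D
  simp only [Function.comp]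
  rw [h3.map_eq]

/-- Two-sided Hoeffding inequality. -/
theorem hoeffding_pi {n : ℕ} {q : Z → ℝ} (hq : Measurable q)
    (hq01 : ∀ z, q z ∈ Set.Icc (0 : ℝ) 1) {τ : ℝ} (hτ : 0 ≤ τ) :
    (Measure.pi fun _ : Fin n => ν) {D | n * τ ≤ |∑ j, q (D j) - n * ∫ z, q z ∂ν|} ≤
      ENNReal.ofReal (2 * Real.exp (-2 * n * τ ^ 2)) := by
  set P := Measure.pi fun _ : Fin n => ν
  set m := ∫ z, q z ∂ν
  have hind : iIndepFun (fun (j : Fin n) (D : Fin n → Z) => q (D j) - m) P :=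
    iIndepFun_pi (X := fun _ z => q z - m) fun _ => by fun_prop
  have hind' : iIndepFun (fun (j : Fin n) (D : Fin n → Z) => -(q (D j) - m)) P :=
    iIndepFun_pi (X := fun _ z => -(q z - m)) fun _ => by fun_prop
  have hsub := fun j => hasSubgaussianMGF_pi (ν := ν) hq hq01 (n := n) j
  have hexp : Real.exp (-(n * τ) ^ 2 / (2 * ↑(∑ _j : Fin n, (1 / 4 : NNReal)))) =
      Real.exp (-2 * n * τ ^ 2) := by
    congr 1
    rcases Nat.eq_zero_or_pos n with rfl | hn
    · simp
    · have : (0 : ℝ) < n := by exact_mod_cast hn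
      simp
      field_simp
      norm_num
  have b1 := HasSubgaussianMGF.measure_sum_ge_le_of_iIndepFun hind (s := Finset.univ)
    (fun j _ => hsub j) (ε := n * τ) (by positivity)
  have b2 := HasSubgaussianMGF.measure_sum_ge_le_of_iIndepFun hind' (s := Finset.univ)
    (fun j _ => (hsub j).neg) (ε := n * τ) (by positivity)
  rw [hexp] at b1 b2
  have hsum : ∀ D : Fin n → Z, ∑ j, (q (D j) - m) = ∑ j, q (D j) - n * m := fun D => by
    simp [Finset.sum_sub_distrib]
  simp only [Finset.sum_neg_distrib, hsum] at b1 b2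
  have hsub : {D : Fin n → Z | n * τ ≤ |∑ j, q (D j) - n * m|} ⊆
      {D | n * τ ≤ ∑ j, q (D j) - n * m} ∪ {D | n * τ ≤ -(∑ j, q (D j) - n * m)} :=
    fun D (hD : n * τ ≤ |∑ j, q (D j) - n * m|) => le_abs.mp hD
  rw [← ENNReal.toReal_le_toReal (by finiteness) (by finiteness),
    ENNReal.toReal_ofReal (by positivity)]
  refine (measureReal_mono (μ := P) hsub).trans ((measureReal_union_le _ _).trans ?_)
  linarith

end Concentration

/-! ### Maximum likelihood estimation -/

section MLE

variable {X : Type u} [MeasurableSpace X] {K d : ℕ} {vol : Measure X}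
  {Φ : Finset (Feature X K d)} {Υ : Finset (Emission X d)}

/-- The law of `(x, a, x')` when `(x, a)` has law `ν` and `x'` is drawn from `κ`. -/
noncomputable def triples (ν : Measure (X × Fin K)) (κ : Kernel (X × Fin K) X) :
    Measure (X × Fin K × X) :=
  (ν ⊗ₘ κ).map fun z => (z.1.1, z.1.2, z.2)

variable {ν : Measure (X × Fin K)} [IsProbabilityMeasure ν] {κ : Kernel (X × Fin K) X}
  [IsMarkovKernel κ]

instance : IsProbabilityMeasure (triples ν κ) :=
  Measure.isProbabilityMeasure_map (by fun_prop)

theorem lintegral_triples {g : X × Fin K × X → ℝ≥0∞} (hg : Measurable g) :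
    ∫⁻ z, g z ∂triples ν κ = ∫⁻ p, ∫⁻ x', g (p.1, p.2, x') ∂κ p ∂ν := by
  rw [triples, lintegral_map hg (by fun_prop), Measure.lintegral_compProd (by fun_prop)]

theorem goodFeature_of_mem (hΦ : SimplexFeatures Φ) {φ : Feature X K d} (h : φ ∈ Φ) :
    GoodFeature φ := ⟨(hΦ φ h).1, (hΦ φ h).2⟩

theorem goodEmission_of_mem (hΥ : DensityEmissions vol Υ) {μ : Emission X d} (h : μ ∈ Υ) :
    GoodEmission vol μ := ⟨(hΥ μ h).1, (hΥ μ h).2.1, (hΥ μ h).2.2⟩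

theorem Model.goodFeature (hΦ : SimplexFeatures Φ) (m : Model Φ Υ) : GoodFeature m.phi :=
  goodFeature_of_mem hΦ m.1.2

theorem Model.goodEmission (hΥ : DensityEmissions vol Υ) (m : Model Φ Υ) :
    GoodEmission vol m.mu :=
  goodEmission_of_mem hΥ m.2.2

instance : Finite (Model Φ Υ) :=
  inferInstanceAs (Finite ({φ // φ ∈ Φ} × {μ // μ ∈ Υ}))

instance : DiscreteMeasurableSpace (Model Φ Υ) := ⟨fun _ => trivial⟩

/-- The mean squared Hellinger distance between two models under the law `ν` of `(x, a)`. -/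
noncomputable def meanHellinger (vol : Measure X) (ν : Measure (X × Fin K)) (φ φ' : Feature X K d)
    (μ μ' : Emission X d) : ℝ≥0∞ :=
  ∫⁻ p, sqHellinger vol (density φ μ p.1 p.2) (density φ' μ' p.1 p.2) ∂ν

variable {φ φs : Feature X K d} {μ μs : Emission X d}

theorem logLikelihood_eq {X : Type*} {φ : Feature X K d} {μ : Emission X d} {n : ℕ}
    (D : Dataset X K n) : logLikelihood φ μ D =
    ENNReal.log (∏ j, ENNReal.ofReal (density φ μ (D j).1 (D j).2.1 (D j).2.2)) := by
  rw [logLikelihood]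
  induction (Finset.univ : Finset (Fin n)) using Finset.induction_on with
  | empty => simp
  | insert j s hj ih => rw [Finset.sum_insert hj, Finset.prod_insert hj, ih, ENNReal.log_mul_add]

theorem measurable_density_triple (hφ : GoodFeature φ) (hμ : GoodEmission vol μ) :
    Measurable fun z : X × Fin K × X => density φ μ z.1 z.2.1 z.2.2 :=
  (measurable_density hφ hμ).comp
    (f := fun z : X × Fin K × X => ((z.1, z.2.1), z.2.2)) (by fun_prop)

theorem measurable_sqHellinger [SigmaFinite vol] (hφ : GoodFeature φ) (hμ : GoodEmission vol μ)
    (hφs : GoodFeature φs) (hμs : GoodEmission vol μs) :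
    Measurable fun p : X × Fin K =>
      sqHellinger vol (density φ μ p.1 p.2) (density φs μs p.1 p.2) := by
  have h1 := measurable_density hφ hμ
  have h2 := measurable_density hφs hμs
  exact Measurable.lintegral_prod_right' (f := fun z : (X × Fin K) × X => ENNReal.ofReal
    ((√(density φ μ z.1.1 z.1.2 z.2) - √(density φs μs z.1.1 z.1.2 z.2)) ^ 2)) (by fun_prop)

theorem measurable_l1Dist [SigmaFinite vol] (hφ : GoodFeature φ) (hμ : GoodEmission vol μ)
    (hφs : GoodFeature φs) (hμs : GoodEmission vol μs) :
    Measurable fun p : X × Fin K =>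
      l1Dist vol (density φ μ p.1 p.2) (density φs μs p.1 p.2) := by
  have h1 := measurable_density hφ hμ
  have h2 := measurable_density hφs hμs
  exact Measurable.lintegral_prod_right' (f := fun z : (X × Fin K) × X => ENNReal.ofReal
    |density φ μ z.1.1 z.1.2 z.2 - density φs μs z.1.1 z.1.2 z.2|) (by fun_prop)

/-- A model that is far from the truth has, with overwhelming probability, a smaller likelihood than
the truth: the expected square root of the likelihood ratio of one sample is `1 - H² / 2`. -/
theorem measure_likelihood_ge_le [SigmaFinite vol] (hφ : GoodFeature φ) (hμ : GoodEmission vol μ)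
    (hφs : GoodFeature φs) (hμs : GoodEmission vol μs)
    (hκ : ∀ x a, κ (x, a) = densityMeasure vol φs μs x a) {ζ : ℝ} (hζ : 0 ≤ ζ)
    (h : ENNReal.ofReal (2 * ζ) ≤ meanHellinger vol ν φ φs μ μs) (n : ℕ) :
    (Measure.pi fun _ : Fin n => triples ν κ) {D | logLikelihood φs μs D ≤ logLikelihood φ μ D} ≤
      ENNReal.ofReal (Real.exp (-n * ζ)) := by
  set p := fun z : X × Fin K × X => density φ μ z.1 z.2.1 z.2.2 with hp
  set ps := fun z : X × Fin K × X => density φs μs z.1 z.2.1 z.2.2 with hps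
  have mp : Measurable p := measurable_density_triple hφ hμ
  have mps : Measurable ps := measurable_density_triple hφs hμs
  -- The square root of the likelihood ratio of one sample.
  set r : X × Fin K × X → ℝ≥0∞ := fun z => ENNReal.ofReal √(p z / ps z)
  have mr : Measurable r := by fun_prop
  have hr : ∫⁻ z, r z ∂triples ν κ ≤ ENNReal.ofReal (Real.exp (-ζ)) := by
    rw [lintegral_triples mr]
    have h1 : ∀ q : X × Fin K, 2 * ∫⁻ x', r (q.1, q.2, x') ∂κ q +
        sqHellinger vol (density φ μ q.1 q.2) (density φs μs q.1 q.2) = 2 := fun q => by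
      rw [show κ q = densityMeasure vol φs μs q.1 q.2 from hκ q.1 q.2]
      exact two_mul_lintegral_sqrt_div_add (measurable_density_right hμ q.1 q.2)
        (measurable_density_right hμs q.1 q.2) (density_nonneg hφ hμ q.1 q.2)
        (density_nonneg hφs hμs q.1 q.2) (lintegral_density hφ hμ q.1 q.2)
        (lintegral_density hφs hμs q.1 q.2)
    have h2 : 2 * ∫⁻ q, ∫⁻ x', r (q.1, q.2, x') ∂κ q ∂ν +
        meanHellinger vol ν φ φs μ μs = 2 := by
      have hm : Measurable fun q : X × Fin K => ∫⁻ x', r (q.1, q.2, x') ∂κ q :=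
        Measurable.lintegral_kernel_prod_right (f := fun (q : X × Fin K) x' => r (q.1, q.2, x'))
          (by fun_prop)
      rw [meanHellinger, ← lintegral_const_mul _ hm, ← lintegral_add_left (by fun_prop),
        lintegral_congr h1]
      simp
    set I := ∫⁻ q, ∫⁻ x', r (q.1, q.2, x') ∂κ q ∂ν
    have h3 : 2 * I + ENNReal.ofReal (2 * ζ) ≤ 2 :=
      (add_le_add_right h _).trans_eq h2
    have hI : I ≠ ⊤ := by
      rintro hI
      rw [hI] at h3
      simp at h3
    rw [← ENNReal.ofReal_toReal hI]
    refine ENNReal.ofReal_le_ofReal ?_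
    have h4 := ENNReal.toReal_mono (by simp) h3
    rw [ENNReal.toReal_add (by finiteness) (by finiteness), ENNReal.toReal_mul,
      ENNReal.toReal_ofReal (by positivity)] at h4
    simp only [ENNReal.toReal_ofNat] at h4
    linarith [Real.add_one_le_exp (-ζ)]
  -- The true density is almost surely positive, so that `0 / 0 = 0` does not occur in the ratio.
  have hpos : ∀ᵐ D ∂(Measure.pi fun _ : Fin n => triples ν κ), ∀ j, 0 < ps (D j) := by
    rw [ae_all_iff]
    intro j
    have h1 : ∀ᵐ z ∂triples ν κ, 0 < ps z := by
      rw [ae_iff]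
      have hms : MeasurableSet {z | ¬ 0 < ps z} := (measurableSet_lt measurable_const mps).compl
      rw [← lintegral_indicator_one hms, lintegral_triples (measurable_one.indicator hms)]
      refine (lintegral_congr fun q => ?_).trans (lintegral_zero)
      rw [show κ q = densityMeasure vol φs μs q.1 q.2 from hκ q.1 q.2, densityMeasure]
      have h5 := measurable_density_right (φ := φs) hμs q.1 q.2
      rw [lintegral_withDensity_eq_lintegral_mul _ (by fun_prop)
        (g := fun x' => {z | ¬ 0 < ps z}.indicator 1 (q.1, q.2, x'))
        ((measurable_one.indicator hms).comp (by fun_prop : Measurable fun x' => (q.1, q.2, x')))]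
      refine (lintegral_congr fun x' => ?_).trans lintegral_zero
      by_cases h0 : 0 < ps (q.1, q.2, x')
      · simp [h0]
      · simp only [Pi.mul_apply]
        rw [ENNReal.ofReal_of_nonpos (not_lt.mp h0), zero_mul]
    exact (measurePreserving_eval (fun _ : Fin n => triples ν κ) j).quasiMeasurePreserving.ae h1
  calc (Measure.pi fun _ : Fin n => triples ν κ) {D | logLikelihood φs μs D ≤ logLikelihood φ μ D}
      ≤ (Measure.pi fun _ : Fin n => triples ν κ) {D | 1 ≤ ∏ j, r (D j)} := by
        refine measure_mono_ae ?_
        filter_upwards [hpos] with D hD hle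
        change logLikelihood φs μs D ≤ logLikelihood φ μ D at hle
        rw [logLikelihood_eq, logLikelihood_eq, ENNReal.log_le_log_iff] at hle
        change 1 ≤ ∏ j, r (D j)
        have h0 : ∀ j, 0 ≤ p (D j) := fun j => density_nonneg hφ hμ _ _ _
        rw [← ENNReal.ofReal_prod_of_nonneg fun j _ => (hD j).le,
          ← ENNReal.ofReal_prod_of_nonneg fun j _ => h0 j,
          ENNReal.ofReal_le_ofReal_iff (Finset.prod_nonneg fun j _ => h0 j)] at hle
        change 1 ≤ ∏ j, ENNReal.ofReal √(p (D j) / ps (D j))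
        rw [← ENNReal.ofReal_prod_of_nonneg fun j _ => Real.sqrt_nonneg _, ENNReal.one_le_ofReal,
          ← Real.sqrt_prod _ fun j _ => div_nonneg (h0 j) (hD j).le, Real.one_le_sqrt,
          Finset.prod_div_distrib, one_le_div (Finset.prod_pos fun j _ => hD j)]
        exact hle
    _ ≤ ∫⁻ D, ∏ j, r (D j) ∂Measure.pi fun _ : Fin n => triples ν κ := by
        have := mul_meas_ge_le_lintegral (μ := Measure.pi fun _ : Fin n => triples ν κ)
          (f := fun D => ∏ j, r (D j)) (by fun_prop) 1
        rwa [one_mul] at this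
    _ = (∫⁻ z, r z ∂triples ν κ) ^ n := lintegral_pi_prod n mr
    _ ≤ ENNReal.ofReal (Real.exp (-ζ)) ^ n := by gcongr
    _ = ENNReal.ofReal (Real.exp (-n * ζ)) := by
        rw [← ENNReal.ofReal_pow (Real.exp_nonneg _), ← Real.exp_nat_mul]
        congr 2; ring

/-- Maximum likelihood estimation over a finite class, by a union bound over the bad models. -/
theorem measure_mle_bad_le [SigmaFinite vol] (hΦ : SimplexFeatures Φ)
    (hΥ : DensityEmissions vol Υ) (hφs : φs ∈ Φ) (hμs : μs ∈ Υ)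
    (hκ : ∀ x a, κ (x, a) = densityMeasure vol φs μs x a)
    {mle : ∀ n, Dataset X K n → Model Φ Υ} (hmle : IsMLE mle) {ζ : ℝ} (hζ : 0 ≤ ζ) (n : ℕ) :
    (Measure.pi fun _ : Fin n => triples ν κ) {D | ¬ meanHellinger vol ν (mle n D).phi φs
      (mle n D).mu μs ≤ ENNReal.ofReal (2 * ζ)} ≤
      ENNReal.ofReal (Φ.card * Υ.card * Real.exp (-n * ζ)) := by
  have hgs := goodFeature_of_mem hΦ hφs
  have hes := goodEmission_of_mem hΥ hμs
  let bad : Finset ({φ // φ ∈ Φ} × {μ // μ ∈ Υ}) := by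
    classical
    exact Finset.univ.filter fun m => ¬ meanHellinger vol ν m.1.1 φs m.2.1 μs ≤
      ENNReal.ofReal (2 * ζ)
  calc _ ≤ (Measure.pi fun _ : Fin n => triples ν κ) (⋃ m ∈ bad,
        {D | logLikelihood φs μs D ≤ logLikelihood m.1.1 m.2.1 D}) := by
        refine measure_mono fun D hD => ?_
        simp only [Set.mem_iUnion]
        exact ⟨mle n D, Finset.mem_filter.mpr ⟨Finset.mem_univ _, hD⟩, hmle.2 n D φs hφs μs hμs⟩
    _ ≤ ∑ m ∈ bad, (Measure.pi fun _ : Fin n => triples ν κ)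
          {D | logLikelihood φs μs D ≤ logLikelihood m.1.1 m.2.1 D} :=
        measure_biUnion_finset_le _ _
    _ ≤ ∑ m ∈ bad, ENNReal.ofReal (Real.exp (-n * ζ)) := by
        refine Finset.sum_le_sum fun m hm => measure_likelihood_ge_le
          (goodFeature_of_mem hΦ m.1.2) (goodEmission_of_mem hΥ m.2.2) hgs hes hκ hζ ?_ n
        have : ¬ meanHellinger vol ν m.1.1 φs m.2.1 μs ≤ ENNReal.ofReal (2 * ζ) := by
          simpa [bad] using hm
        exact (not_le.mp this).le
    _ ≤ ∑ m : {φ // φ ∈ Φ} × {μ // μ ∈ Υ}, ENNReal.ofReal (Real.exp (-n * ζ)) :=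
        Finset.sum_le_sum_of_subset (Finset.subset_univ _)
    _ = _ := by
        rw [Finset.sum_const, Finset.card_univ, Fintype.card_prod, Fintype.card_coe,
          Fintype.card_coe, nsmul_eq_mul, ENNReal.ofReal_mul (by positivity)]
        congr 1
        rw [← Nat.cast_mul, ENNReal.ofReal_natCast]

end MLE

/-! ### Linear regression -/

section Regression

variable {Z : Type*} [MeasurableSpace Z] {ν : Measure Z} [IsProbabilityMeasure ν] {d : ℕ}
  {f : Z → Fin d → ℝ} {y g : Z → ℝ} {h : ℝ}

/-- The part of a quadratic loss that depends on the weights, in terms of the second moments `A` of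
the features and the correlations `v` of features and target. -/
def quadLoss (A : Fin d → Fin d → ℝ) (v : Fin d → ℝ) (θ : Fin d → ℝ) : ℝ :=
  ∑ a, ∑ b, θ a * θ b * A a b - 2 * ∑ a, θ a * v a

theorem sq_sub_eq_quadLoss (w θ : Fin d → ℝ) (c : ℝ) :
    (∑ i, θ i * w i - c) ^ 2 = quadLoss (fun a b => w a * w b) (fun a => w a * c) θ + c ^ 2 := by
  have h1 : (∑ i, θ i * w i) ^ 2 = ∑ a, ∑ b, θ a * θ b * (w a * w b) := by
    rw [sq, Finset.sum_mul_sum]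
    exact Finset.sum_congr rfl fun a _ => Finset.sum_congr rfl fun b _ => by ring
  have h2 : (∑ i, θ i * w i) * c = ∑ a, θ a * (w a * c) := by
    rw [Finset.sum_mul]; exact Finset.sum_congr rfl fun a _ => by ring
  rw [quadLoss, ← h1, ← h2]; ring

theorem sqLoss_eq_quadLoss {n : ℕ} (D : Rows d n) (θ : Fin d → ℝ) :
    sqLoss D θ = quadLoss (fun a b => ∑ j, (D j).1 a * (D j).1 b)
      (fun a => ∑ j, (D j).1 a * (D j).2) θ + ∑ j, (D j).2 ^ 2 := by
  simp only [sqLoss, sq_sub_eq_quadLoss, Finset.sum_add_distrib]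
  congr 1
  simp only [quadLoss, Finset.sum_sub_distrib, ← Finset.mul_sum]
  congr 1
  · rw [Finset.sum_comm]
    refine Finset.sum_congr rfl fun a _ => ?_
    rw [Finset.sum_comm]
    exact Finset.sum_congr rfl fun b _ => by rw [Finset.mul_sum]
  · rw [Finset.sum_comm]
    congr 1
    exact Finset.sum_congr rfl fun a _ => by rw [Finset.mul_sum]

/-- Two quadratic losses with entrywise close coefficients are uniformly close over a ball. -/
theorem abs_quadLoss_sub_le (hd : 0 < d) (hh : 0 ≤ h) {A A' : Fin d → Fin d → ℝ}
    {v v' : Fin d → ℝ} {τ : ℝ} (hA : ∀ a b, |A a b - A' a b| ≤ τ)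
    (hv : ∀ a, |v a - v' a| ≤ h * τ) {θ : Fin d → ℝ} (hθ : ∑ i, θ i ^ 2 ≤ h ^ 2 * d) :
    |quadLoss A v θ - quadLoss A' v' θ| ≤ 3 * (d : ℝ) ^ 2 * h ^ 2 * τ := by
  have hd1 : (1 : ℝ) ≤ d := by exact_mod_cast hd
  have hτ : 0 ≤ τ := (abs_nonneg _).trans (hA ⟨0, hd⟩ ⟨0, hd⟩)
  set S := ∑ a, |θ a| with hS
  have hS0 : 0 ≤ S := Finset.sum_nonneg fun a _ => abs_nonneg _
  have hSd : S ≤ d * h := by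
    refine abs_le_of_sq_le_sq' ?_ (by positivity) |>.2
    have h1 := sq_sum_le_card_mul_sum_sq (s := Finset.univ) (f := fun a => |θ a|)
    simp only [sq_abs, Finset.card_univ, Fintype.card_fin] at h1
    calc S ^ 2 ≤ d * ∑ a, θ a ^ 2 := h1
      _ ≤ d * (h ^ 2 * d) := by gcongr
      _ = (d * h) ^ 2 := by ring
  have e : quadLoss A v θ - quadLoss A' v' θ =
      ∑ a, ∑ b, θ a * θ b * (A a b - A' a b) - 2 * ∑ a, θ a * (v a - v' a) := by
    simp only [quadLoss, mul_sub, Finset.sum_sub_distrib]; ring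
  have b1 : |∑ a, ∑ b, θ a * θ b * (A a b - A' a b)| ≤ S * S * τ := by
    calc |∑ a, ∑ b, θ a * θ b * (A a b - A' a b)|
        ≤ ∑ a, ∑ b, |θ a| * |θ b| * τ := by
          refine (Finset.abs_sum_le_sum_abs _ _).trans (Finset.sum_le_sum fun a _ =>
            (Finset.abs_sum_le_sum_abs _ _).trans (Finset.sum_le_sum fun b _ => ?_))
          rw [abs_mul, abs_mul]
          gcongr
          exact hA a b
      _ = S * S * τ := by
          rw [hS, Finset.sum_mul_sum]; simp only [Finset.sum_mul]
  have b2 : |∑ a, θ a * (v a - v' a)| ≤ S * (h * τ) := by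
    calc |∑ a, θ a * (v a - v' a)| ≤ ∑ a, |θ a| * (h * τ) := by
          refine (Finset.abs_sum_le_sum_abs _ _).trans (Finset.sum_le_sum fun a _ => ?_)
          rw [abs_mul]
          gcongr
          exact hv a
      _ = S * (h * τ) := by rw [hS, Finset.sum_mul]
  rw [e]
  calc |∑ a, ∑ b, θ a * θ b * (A a b - A' a b) - 2 * ∑ a, θ a * (v a - v' a)|
      ≤ |∑ a, ∑ b, θ a * θ b * (A a b - A' a b)| + |2 * ∑ a, θ a * (v a - v' a)| := abs_sub _ _
    _ ≤ S * S * τ + 2 * (S * (h * τ)) := by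
        rw [abs_mul, abs_of_pos (by norm_num : (0 : ℝ) < 2)]
        gcongr
    _ ≤ (d * h) * (d * h) * τ + 2 * ((d * h) * (h * τ)) := by gcongr
    _ ≤ 3 * (d : ℝ) ^ 2 * h ^ 2 * τ := by
        have : (d : ℝ) * (h ^ 2 * τ) ≤ (d : ℝ) ^ 2 * (h ^ 2 * τ) := by
          gcongr; nlinarith
        nlinarith

theorem integrable_of_bound {q : Z → ℝ} (hq : Measurable q) {c : ℝ} (hb : ∀ z, |q z| ≤ c) :
    Integrable q ν :=
  Integrable.of_bound hq.aestronglyMeasurable c (.of_forall hb)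

theorem integral_sq_sub_eq_quadLoss (hf : Measurable f) (hf01 : ∀ z i, f z i ∈ Set.Icc (0 : ℝ) 1)
    (hy : Measurable y) (hyh : ∀ z, y z ∈ Set.Icc 0 h) (θ : Fin d → ℝ) :
    ∫ z, (∑ i, θ i * f z i - y z) ^ 2 ∂ν = quadLoss (fun a b => ∫ z, f z a * f z b ∂ν)
      (fun a => ∫ z, f z a * y z ∂ν) θ + ∫ z, y z ^ 2 ∂ν := by
  have mf : ∀ a, Measurable fun z => f z a := fun a => (measurable_pi_apply a).comp hf
  have i1 : ∀ a b, Integrable (fun z => f z a * f z b) ν := fun a b =>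
    integrable_of_bound ((mf a).mul (mf b)) (c := 1) fun z => by
      rw [abs_of_nonneg (mul_nonneg (hf01 z a).1 (hf01 z b).1)]
      exact mul_le_one₀ (hf01 z a).2 (hf01 z b).1 (hf01 z b).2
  have i2 : ∀ a, Integrable (fun z => f z a * y z) ν := fun a =>
    integrable_of_bound ((mf a).mul hy) (c := h) fun z => by
      rw [abs_of_nonneg (mul_nonneg (hf01 z a).1 (hyh z).1)]
      nlinarith [(hf01 z a).1, (hf01 z a).2, (hyh z).1, (hyh z).2]
  have i3 : Integrable (fun z => y z ^ 2) ν :=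
    integrable_of_bound (hy.pow_const 2) (c := h ^ 2) fun z => by
      rw [abs_of_nonneg (sq_nonneg _)]
      exact pow_le_pow_left₀ (hyh z).1 (hyh z).2 2
  simp only [sq_sub_eq_quadLoss, quadLoss]
  have j1 : ∀ a, Integrable (fun z => ∑ b, θ a * θ b * (f z a * f z b)) ν := fun a =>
    integrable_finsetSum _ fun b _ => (i1 a b).const_mul _
  have j2 : Integrable (fun z => ∑ a, ∑ b, θ a * θ b * (f z a * f z b)) ν :=
    integrable_finsetSum _ fun a _ => j1 a
  have j3 : Integrable (fun z => ∑ a, θ a * (f z a * y z)) ν :=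
    integrable_finsetSum _ fun a _ => (i2 a).const_mul _
  have j4 : Integrable (fun z => ∑ a, ∑ b, θ a * θ b * (f z a * f z b) -
      2 * ∑ a, θ a * (f z a * y z)) ν := j2.sub (j3.const_mul 2)
  rw [integral_add j4 i3, integral_sub j2 (j3.const_mul 2),
    integral_const_mul, integral_finsetSum _ fun a _ => j1 a,
    integral_finsetSum _ fun a _ => (i2 a).const_mul _]
  congr 2
  · refine Finset.sum_congr rfl fun a _ => ?_
    rw [integral_finsetSum _ fun b _ => (i1 a b).const_mul _]
    exact Finset.sum_congr rfl fun b _ => integral_const_mul _ _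
  · congr 1
    exact Finset.sum_congr rfl fun a _ => integral_const_mul _ _

/-- Generalization of norm-constrained least squares with bounded features and targets: if `g` is
the regression function, then every approximate minimizer of the empirical loss is nearly as close
to `g` as any competitor `θ'`. The sample enters only through the empirical second moments, which
concentrate by Hoeffding's inequality. -/
theorem measure_regression_bad_le (hd : 0 < d) (hh : 0 < h) (hf : Measurable f)
    (hf01 : ∀ z i, f z i ∈ Set.Icc (0 : ℝ) 1) (hy : Measurable y) (hyh : ∀ z, y z ∈ Set.Icc 0 h)
    (hg : Measurable g) (hgh : ∀ z, g z ∈ Set.Icc 0 h)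
    (horth : ∀ θ : Fin d → ℝ, ∫ z, (∑ i, θ i * f z i - g z) * (y z - g z) ∂ν = 0)
    {θ' : Fin d → ℝ} (hθ' : ∑ i, θ' i ^ 2 ≤ h ^ 2 * d) (γ : ℝ) {τ : ℝ} (hτ : 0 ≤ τ) {n : ℕ}
    (hn : 0 < n) :
    (Measure.pi fun _ : Fin n => ν) {D | ¬ ∀ θ : Fin d → ℝ, ∑ i, θ i ^ 2 ≤ h ^ 2 * d →
      sqLoss (fun j => (f (D j), y (D j)) : Rows d n) θ ≤
        sqLoss (fun j => (f (D j), y (D j)) : Rows d n) θ' + n * γ →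
      ∫ z, (∑ i, θ i * f z i - g z) ^ 2 ∂ν ≤
        ∫ z, (∑ i, θ' i * f z i - g z) ^ 2 ∂ν + γ + 6 * (d : ℝ) ^ 2 * h ^ 2 * τ} ≤
      ENNReal.ofReal ((d ^ 2 + d) * (2 * Real.exp (-2 * n * τ ^ 2))) := by
  have mf : ∀ a, Measurable fun z => f z a := fun a => (measurable_pi_apply a).comp hf
  have hn' : (0 : ℝ) < n := by exact_mod_cast hn
  -- The products whose means determine the square loss, with the target scaled to `[0, 1]`.
  let q : (Fin d × Fin d) ⊕ Fin d → Z → ℝ :=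
    Sum.elim (fun ab z => f z ab.1 * f z ab.2) fun a z => f z a * (y z / h)
  have mq : ∀ k, Measurable (q k) := by
    rintro (⟨a, b⟩ | a)
    · exact (mf a).mul (mf b)
    · exact (mf a).mul (hy.div_const h)
  have hy01 : ∀ z, y z / h ∈ Set.Icc (0 : ℝ) 1 := fun z =>
    ⟨div_nonneg (hyh z).1 hh.le, (div_le_one hh).mpr (hyh z).2⟩
  have hq01 : ∀ k z, q k z ∈ Set.Icc (0 : ℝ) 1 := by
    rintro (⟨a, b⟩ | a) z
    · exact ⟨mul_nonneg (hf01 z a).1 (hf01 z b).1,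
        mul_le_one₀ (hf01 z a).2 (hf01 z b).1 (hf01 z b).2⟩
    · exact ⟨mul_nonneg (hf01 z a).1 (hy01 z).1,
        mul_le_one₀ (hf01 z a).2 (hy01 z).1 (hy01 z).2⟩
  calc _ ≤ (Measure.pi fun _ : Fin n => ν)
        (⋃ k ∈ (Finset.univ : Finset ((Fin d × Fin d) ⊕ Fin d)),
          {D | n * τ ≤ |∑ j, q k (D j) - n * ∫ z, q k z ∂ν|}) := ?_
    _ ≤ ∑ k : (Fin d × Fin d) ⊕ Fin d, (Measure.pi fun _ : Fin n => ν)
          {D | n * τ ≤ |∑ j, q k (D j) - n * ∫ z, q k z ∂ν|} := measure_biUnion_finset_le _ _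
    _ ≤ ∑ k : (Fin d × Fin d) ⊕ Fin d, ENNReal.ofReal (2 * Real.exp (-2 * n * τ ^ 2)) :=
        Finset.sum_le_sum fun k _ => hoeffding_pi (mq k) (hq01 k) hτ
    _ = _ := by
        rw [Finset.sum_const, Finset.card_univ, Fintype.card_sum, Fintype.card_prod,
          Fintype.card_fin, nsmul_eq_mul,
          ENNReal.ofReal_mul (p := (d : ℝ) ^ 2 + d) (by positivity)]
        congr 1
        rw [← ENNReal.ofReal_natCast]
        push_cast
        rw [sq]
  refine measure_mono fun D hD => ?_
  by_contra hnot
  refine hD fun θ hθ hgap => ?_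
  simp only [Finset.mem_univ, Set.iUnion_true, Set.mem_iUnion, Set.mem_ofPred_eq, not_exists,
    not_le] at hnot
  set R : Rows d n := fun j => (f (D j), y (D j)) with hR
  set A := fun a b => ∫ z, f z a * f z b ∂ν with hA
  set v := fun a => ∫ z, f z a * y z ∂ν with hv
  have hscale : ∀ θ, quadLoss (fun a b => n * A a b) (fun a => n * v a) θ = n * quadLoss A v θ :=
    fun θ => by
      simp only [quadLoss, mul_sub, Finset.mul_sum]
      congr 1
      · exact Finset.sum_congr rfl fun a _ => Finset.sum_congr rfl fun b _ => by ring
      · exact Finset.sum_congr rfl fun a _ => by ring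
  have hclose : ∀ θ : Fin d → ℝ, ∑ i, θ i ^ 2 ≤ h ^ 2 * d →
      |quadLoss (fun a b => ∑ j, f (D j) a * f (D j) b) (fun a => ∑ j, f (D j) a * y (D j)) θ -
        n * quadLoss A v θ| ≤ 3 * (d : ℝ) ^ 2 * h ^ 2 * (n * τ) := fun θ hθ => by
    rw [← hscale]
    refine abs_quadLoss_sub_le hd hh.le (fun a b => (hnot (.inl (a, b))).le) (fun a => ?_) hθ
    have h1 := (hnot (.inr a)).le
    have h2 : ∑ j, f (D j) a * y (D j) - n * v a =
        h * (∑ j, q (.inr a) (D j) - n * ∫ z, q (.inr a) z ∂ν) := by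
      have h3 : ∀ z, f z a * y z = h * q (.inr a) z := fun z => by
        change _ = h * (f z a * (y z / h))
        field_simp
      simp only [hv, h3, integral_const_mul, ← Finset.mul_sum]
      ring
    rw [h2, abs_mul, abs_of_pos hh]
    gcongr
  -- The population loss is the distance to `g` plus a variance that does not depend on `θ`.
  have hbias : ∀ θ : Fin d → ℝ, ∫ z, (∑ i, θ i * f z i - y z) ^ 2 ∂ν =
      ∫ z, (∑ i, θ i * f z i - g z) ^ 2 ∂ν + ∫ z, (y z - g z) ^ 2 ∂ν := fun θ => by
    have hB : ∃ c, ∀ z, |∑ i, θ i * f z i - g z| ≤ c := by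
      refine ⟨∑ i, |θ i| + h, fun z => (abs_sub _ _).trans (add_le_add ?_ ?_)⟩
      · refine (Finset.abs_sum_le_sum_abs _ _).trans (Finset.sum_le_sum fun i _ => ?_)
        rw [abs_mul, abs_of_nonneg (hf01 z i).1]
        exact mul_le_of_le_one_right (abs_nonneg _) (hf01 z i).2
      · rw [abs_of_nonneg (hgh z).1]; exact (hgh z).2
    obtain ⟨c, hc⟩ := hB
    have hc' : ∀ z, |y z - g z| ≤ h := fun z =>
      abs_sub_le_iff.mpr ⟨by linarith [(hyh z).2, (hgh z).1], by linarith [(hyh z).1, (hgh z).2]⟩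
    have hc0 : 0 ≤ c := (abs_nonneg _).trans (hc ((nonempty_of_isProbabilityMeasure ν).some))
    have mA : Measurable fun z => ∑ i, θ i * f z i - g z := by fun_prop
    have i1 : Integrable (fun z => (∑ i, θ i * f z i - g z) ^ 2) ν :=
      integrable_of_bound (mA.pow_const 2) (c := c ^ 2) fun z => by
        rw [abs_pow]; exact pow_le_pow_left₀ (abs_nonneg _) (hc z) 2
    have i2 : Integrable (fun z => (∑ i, θ i * f z i - g z) * (y z - g z)) ν :=
      integrable_of_bound (mA.mul (hy.sub hg)) (c := c * h) fun z => by
        rw [abs_mul]; exact mul_le_mul (hc z) (hc' z) (abs_nonneg _) hc0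
    have i3 : Integrable (fun z => (y z - g z) ^ 2) ν :=
      integrable_of_bound ((hy.sub hg).pow_const 2) (c := h ^ 2) fun z => by
        rw [abs_pow]; exact pow_le_pow_left₀ (abs_nonneg _) (hc' z) 2
    have e : ∀ z, (∑ i, θ i * f z i - y z) ^ 2 = (∑ i, θ i * f z i - g z) ^ 2 -
        2 * ((∑ i, θ i * f z i - g z) * (y z - g z)) + (y z - g z) ^ 2 := fun z => by ring
    have i4 : Integrable (fun z => (∑ i, θ i * f z i - g z) ^ 2 -
        2 * ((∑ i, θ i * f z i - g z) * (y z - g z))) ν := i1.sub (i2.const_mul 2)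
    simp only [e]
    rw [integral_add i4 i3, integral_sub i1 (i2.const_mul 2),
      integral_const_mul, horth]
    ring
  have hq1 := hbias θ
  have hq2 := hbias θ'
  rw [integral_sq_sub_eq_quadLoss hf hf01 hy hyh] at hq1 hq2
  rw [sqLoss_eq_quadLoss, sqLoss_eq_quadLoss] at hgap
  have c1 := (abs_le.mp (hclose θ hθ)).1
  have c2 := (abs_le.mp (hclose θ' hθ')).2
  simp only [hR] at hgap
  refine le_of_mul_le_mul_left ?_ hn'
  have e1 : ∫ z, (∑ i, θ i * f z i - g z) ^ 2 ∂ν - ∫ z, (∑ i, θ' i * f z i - g z) ^ 2 ∂ν =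
      quadLoss A v θ - quadLoss A v θ' := by linarith
  have e2 : ∫ z, (∑ i, θ i * f z i - g z) ^ 2 ∂ν =
      ∫ z, (∑ i, θ' i * f z i - g z) ^ 2 ∂ν + (quadLoss A v θ - quadLoss A v θ') := by linarith
  rw [e2]
  linarith

end Regression

/-! ### Occupancy measures -/

section Occupancy

variable {X : Type u} [MeasurableSpace X] {K d : ℕ}

/-- The uniform distribution on the actions. -/
noncomputable def unifMeasure (K : ℕ) : Measure (Fin K) :=
  (K : ℝ≥0∞)⁻¹ • ∑ a, Measure.dirac a

theorem lintegral_unifMeasure (f : Fin K → ℝ≥0∞) :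
    ∫⁻ a, f a ∂unifMeasure K = (K : ℝ≥0∞)⁻¹ * ∑ a, f a := by
  rw [unifMeasure, lintegral_smul_measure, lintegral_finsetSum_measure]
  simp

theorem isProbabilityMeasure_unifMeasure (a0 : Fin K) : IsProbabilityMeasure (unifMeasure K) := ⟨by
  have hK : K ≠ 0 := fun h => by subst h; exact a0.elim0
  have := lintegral_unifMeasure (K := K) fun _ => 1
  simp only [lintegral_const, one_mul, Finset.sum_const, Finset.card_univ, Fintype.card_fin,
    nsmul_eq_mul, mul_one] at this
  rw [this]
  exact ENNReal.inv_mul_cancel (by simpa using hK) (by simp)⟩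

/-- Any distribution on the actions has density at most `K` with respect to the uniform one. -/
theorem lintegral_le_unifMeasure (a0 : Fin K) (ν : Measure (Fin K)) [IsProbabilityMeasure ν]
    (f : Fin K → ℝ≥0∞) : ∫⁻ a, f a ∂ν ≤ K * ∫⁻ a, f a ∂unifMeasure K := by
  have hK : K ≠ 0 := fun h => by subst h; exact a0.elim0
  rw [lintegral_unifMeasure, ← mul_assoc, ENNReal.mul_inv_cancel (by simpa using hK) (by simp),
    one_mul, lintegral_fintype]
  exact Finset.sum_le_sum fun a _ => mul_le_of_le_one_right' prob_le_one

instance (M : MDP X K) (t : ℕ) : IsMarkovKernel (M.T t) := M.markov t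

instance (π : Policy X K) (t : ℕ) : IsMarkovKernel (π.ker t) := π.markov t

instance (M : MDP X K) (π : Policy X K) (t : ℕ) : IsProbabilityMeasure (M.occupancy π t) := by
  induction t with
  | zero => rw [MDP.occupancy]; infer_instance
  | succ t ih => rw [MDP.occupancy]; infer_instance

variable {M : MDP X K} {π : Policy X K}

/-- The law of the state at time `t + 1` under the policy `π`. -/
noncomputable def MDP.nextLaw (M : MDP X K) (π : Policy X K) (t : ℕ) : Measure X :=
  (M.occupancy π t).bind (M.T t)

theorem lintegral_nextLaw (t : ℕ) {f : X → ℝ≥0∞} (hf : Measurable f) :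
    ∫⁻ x, f x ∂M.nextLaw π t = ∫⁻ p, ∫⁻ x, f x ∂M.T t p ∂M.occupancy π t :=
  Measure.lintegral_bind (M.T t).aemeasurable hf.aemeasurable

theorem lintegral_occupancy_succ (t : ℕ) {f : X × Fin K → ℝ≥0∞} (hf : Measurable f) :
    ∫⁻ p, f p ∂M.occupancy π (t + 1) =
      ∫⁻ x, ∫⁻ a, f (x, a) ∂π.ker (t + 1) x ∂M.nextLaw π t :=
  Measure.lintegral_compProd hf

theorem lintegral_occupancy_zero {f : X × Fin K → ℝ≥0∞} (hf : Measurable f) :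
    ∫⁻ p, f p ∂M.occupancy π 0 = f (M.x0, M.a0) := by
  rw [MDP.occupancy, lintegral_dirac' _ hf]

theorem lintegral_occupancy_succ_le (t : ℕ) {f : X × Fin K → ℝ≥0∞} (hf : Measurable f) :
    ∫⁻ p, f p ∂M.occupancy π (t + 1) ≤
      K * ∫⁻ x, ∫⁻ a, f (x, a) ∂unifMeasure K ∂M.nextLaw π t := by
  have hm : Measurable fun x => ∫⁻ a, f (x, a) ∂unifMeasure K := by
    simp only [lintegral_unifMeasure]; fun_prop
  rw [lintegral_occupancy_succ t hf, ← lintegral_const_mul _ hm]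
  exact lintegral_mono fun x => lintegral_le_unifMeasure M.a0 _ _

/-- The mean of the `i`-th coordinate of `φ` at time `t` under `π`. -/
noncomputable def latentMass (M : MDP X K) (φ : Feature X K d) (π : Policy X K) (t : ℕ)
    (i : Fin d) : ℝ≥0∞ :=
  ∫⁻ p, ENNReal.ofReal (φ p.1 p.2 i) ∂M.occupancy π t

theorem ofReal_latentProb {φ : ℕ → Feature X K d} {t : ℕ} (hφ : GoodFeature (φ t)) (i : Fin d) :
    ENNReal.ofReal (latentProb M φ π t i) = latentMass M (φ t) π t i := by
  rw [latentProb, latentMass, ofReal_integral_eq_lintegral_ofReal]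
  · exact integrable_of_bound (hφ.measurable_coord i) (c := 1) fun p => by
      rw [abs_of_nonneg (hφ.nonneg _ _ _)]; exact hφ.le_one _ _ _
  · exact .of_forall fun p => hφ.nonneg _ _ _

theorem latentMass_le_one {φ : Feature X K d} (hφ : GoodFeature φ) (t : ℕ) (i : Fin d) :
    latentMass M φ π t i ≤ 1 := by
  calc latentMass M φ π t i ≤ ∫⁻ _, 1 ∂M.occupancy π t :=
        lintegral_mono fun p => ENNReal.ofReal_le_one.mpr (hφ.le_one _ _ _)
    _ = 1 := by simp

variable {vol : Measure X} {φ φs : Feature X K d} {μ μs : Emission X d}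

/-- If the transitions at time `t` are generated by `⟨φ, μ⟩`, then the law of the next state is the
mixture of the coordinates of `μ` with the latent masses as weights. -/
theorem lintegral_lintegral_densityMeasure (hφ : GoodFeature φ) (hμ : GoodEmission vol μ) (t : ℕ)
    {f : X → ℝ≥0∞} (hf : Measurable f) :
    ∫⁻ p, ∫⁻ x, f x ∂densityMeasure vol φ μ p.1 p.2 ∂M.occupancy π t =
      ∑ i, latentMass M φ π t i * ∫⁻ x, f x ∂emissionMeasure vol μ i := by
  simp only [lintegral_densityMeasure hφ hμ _ _ hf]
  have h := hφ.measurable_coord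
  rw [lintegral_finsetSum _ fun i _ => by have := h i; fun_prop]
  refine Finset.sum_congr rfl fun i _ => ?_
  have := h i
  rw [lintegral_mul_const _ (by fun_prop), latentMass]

end Occupancy

/-! ### The exploratory distributions -/

section Explore

variable {X : Type u} [MeasurableSpace X] {K d : ℕ}

/-- The policy that acts greedily with respect to the weights `θ` before time `l`, and uniformly at
random from time `l` on. -/
noncomputable def greedyPolicy (a0 : Fin K) (F : ℕ → Feature X K d)
    (hF : ∀ t a, Measurable fun x => F t x a) (l : ℕ) (i : Fin d) (θ : ℕ → Fin d → ℝ) :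
    Policy X K where
  ker t := if t < l then Kernel.deterministic (fun x => (greedyVal a0 (F t) l i t (θ t) x).1)
      (measurable_greedyVal a0 (φ := fun _ => F t) (x := fun x => x) (θ := fun _ => θ t)
        (hF t) measurable_const l i t).fst
    else Kernel.const X (unifMeasure K)
  markov t := by
    have := isProbabilityMeasure_unifMeasure a0
    split_ifs <;> infer_instance

variable {a0 : Fin K} {F : ℕ → Feature X K d} {hF : ∀ t a, Measurable fun x => F t x a} {l : ℕ}
  {i : Fin d} {θ : ℕ → Fin d → ℝ}

theorem greedyPolicy_ker_of_le {t : ℕ} (h : l ≤ t) (x : X) :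
    (greedyPolicy a0 F hF l i θ).ker t x = unifMeasure K := by
  simp [greedyPolicy, not_lt.mpr h]

theorem lintegral_greedyPolicy_ker {t : ℕ} (h : t < l) (x : X) {f : Fin K → ℝ≥0∞} :
    ∫⁻ a, f a ∂(greedyPolicy a0 F hF l i θ).ker t x = f (greedyVal a0 (F t) l i t (θ t) x).1 := by
  simp [greedyPolicy, h, Kernel.deterministic_apply]

/-- The policy depends only on the features used before time `l`. -/
theorem greedyPolicy_congr {F' : ℕ → Feature X K d} {hF' : ∀ t a, Measurable fun x => F' t x a}
    (h : ∀ t < l, F t = F' t) :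
    greedyPolicy a0 F hF l i θ = greedyPolicy a0 F' hF' l i θ := by
  unfold greedyPolicy
  congr 1
  funext t
  split_ifs with ht
  · congr 1
    funext x
    rw [h t ht]
  · rfl

/-- The law of the state-action pair at time `t` in the data collected at time `t`: `ρ_t` followed
by a uniformly random available action. -/
noncomputable def dataLaw (M : MDP X K) (F : ℕ → Feature X K d)
    (hF : ∀ t a, Measurable fun x => F t x a) (P : ℕ → Plan d) : ℕ → Measure (X × Fin K)
  | 0 => Measure.dirac (M.x0, M.a0)
  | l + 1 => (d : ℝ≥0∞)⁻¹ • ∑ i, M.occupancy (greedyPolicy M.a0 F hF l i (P l i)) (l + 1)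

variable {M : MDP X K} {P : ℕ → Plan d}

theorem isProbabilityMeasure_dataLaw (hd : 0 < d) (t : ℕ) :
    IsProbabilityMeasure (dataLaw M F hF P t) := by
  cases t with
  | zero => rw [dataLaw]; infer_instance
  | succ l =>
    refine ⟨?_⟩
    simp only [dataLaw, Measure.smul_apply, Measure.finsetSum_apply, measure_univ,
      Finset.sum_const, Finset.card_univ, Fintype.card_fin, nsmul_eq_mul, mul_one, smul_eq_mul]
    exact ENNReal.inv_mul_cancel (by simpa using hd.ne') (by simp)

theorem dataLaw_congr {F' : ℕ → Feature X K d} {hF' : ∀ t a, Measurable fun x => F' t x a}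
    {P' : ℕ → Plan d} {t : ℕ} (h : ∀ s < t, F s = F' s) (h' : ∀ s < t, P s = P' s) :
    dataLaw M F hF P t = dataLaw M F' hF' P' t := by
  cases t with
  | zero => rfl
  | succ l =>
    rw [dataLaw, dataLaw]
    congr 1
    refine Finset.sum_congr rfl fun i _ => ?_
    rw [h' l l.lt_succ_self,
      greedyPolicy_congr (F' := F') (hF' := hF') fun s hs => h s (hs.trans l.lt_succ_self)]

end Explore

/-! ### Planning in the environment -/

section Planning

variable {X : Type u} {K d : ℕ}

/-- The estimated value function at time `t` for planning horizon `l`. It vanishes at time `l`. -/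
noncomputable def planValue (a0 : Fin K) (φ : Feature X K d) (l : ℕ) (i : Fin d) (t : ℕ)
    (θ : Fin d → ℝ) (x : X) : ℝ :=
  if t = l then 0 else valueVal a0 φ l i t θ x

theorem planValue_mem (a0 : Fin K) (φ : Feature X K d) (l : ℕ) (i : Fin d) (t : ℕ)
    (θ : Fin d → ℝ) (x : X) : planValue a0 φ l i t θ x ∈ Set.Icc (0 : ℝ) l := by
  unfold planValue
  split_ifs
  · exact ⟨le_rfl, l.cast_nonneg⟩
  · exact ⟨valueVal_nonneg _ _ _ _ _ _ _, valueVal_le _ _ _ _ _ _ _⟩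

theorem measurable_planValue {Ω : Type*} [MeasurableSpace Ω] {φ : Ω → Feature X K d} {x : Ω → X}
    {θ : Ω → Fin d → ℝ} (a0 : Fin K) (hφ : ∀ a, Measurable fun ω => φ ω (x ω) a)
    (hθ : Measurable θ) (l : ℕ) (i : Fin d) (t : ℕ) :
    Measurable fun ω => planValue a0 (φ ω) l i t (θ ω) (x ω) := by
  unfold planValue
  split_ifs
  · exact measurable_const
  · exact measurable_valueVal a0 hφ hθ l i t

variable [MeasurableSpace X]

/-- The error at `p = (x, a)` of the regression at time `t`, for weights `θ` at time `t` and `θ'` at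
time `t + 1`. -/
noncomputable def bellmanError (M : MDP X K) (φ φ' : Feature X K d) (l : ℕ) (i : Fin d) (t : ℕ)
    (θ θ' : Fin d → ℝ) (p : X × Fin K) : ℝ :=
  ∑ j, θ j * φ p.1 p.2 j - ∫ x, planValue M.a0 φ' l i (t + 1) θ' x ∂M.T t p

variable {M : MDP X K} {F : ℕ → Feature X K d} {hF : ∀ t a, Measurable fun x => F t x a} {l : ℕ}
  {i : Fin d} {θ : ℕ → Fin d → ℝ} {π : Policy X K}

theorem integrable_planValue (hF : ∀ t a, Measurable fun x => F t x a) (t : ℕ) (ν : Measure X)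
    [IsProbabilityMeasure ν] :
    Integrable (fun x => planValue M.a0 (F t) l i t (θ t) x) ν :=
  integrable_of_bound (measurable_planValue M.a0 (φ := fun _ => F t) (x := fun x => x) (hF t)
    measurable_const l i t) (c := l) fun x => by
      have := planValue_mem M.a0 (F t) l i t (θ t) x
      rw [abs_of_nonneg this.1]; exact this.2

theorem integral_planValue_mem (hF : ∀ t a, Measurable fun x => F t x a) (t : ℕ) (ν : Measure X)
    [IsProbabilityMeasure ν] :
    ∫ x, planValue M.a0 (F t) l i t (θ t) x ∂ν ∈ Set.Icc (0 : ℝ) l := by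
  refine ⟨integral_nonneg fun x => (planValue_mem _ _ _ _ _ _ x).1, ?_⟩
  calc ∫ x, planValue M.a0 (F t) l i t (θ t) x ∂ν ≤ ∫ _, (l : ℝ) ∂ν :=
        integral_mono (integrable_planValue hF t ν) (integrable_const _)
          fun x => (planValue_mem _ _ _ _ _ _ x).2
    _ = l := by simp

/-- The mean of the estimated value at the state of time `t + 1`. -/
noncomputable def meanValue (M : MDP X K) (F : ℕ → Feature X K d) (l : ℕ) (i : Fin d)
    (θ : ℕ → Fin d → ℝ) (π : Policy X K) (t : ℕ) : ℝ≥0∞ :=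
  ∫⁻ x, ENNReal.ofReal (planValue M.a0 (F (t + 1)) l i (t + 1) (θ (t + 1)) x) ∂M.nextLaw π t

theorem measurable_planValue_right (hF : ∀ t a, Measurable fun x => F t x a) (t : ℕ) :
    Measurable fun x => planValue M.a0 (F t) l i t (θ t) x :=
  measurable_planValue M.a0 (φ := fun _ => F t) (x := fun x => x) (hF t) measurable_const l i t

theorem measurable_backup (hF : ∀ t a, Measurable fun x => F t x a) (t : ℕ) :
    Measurable fun p => ∫ x, planValue M.a0 (F (t + 1)) l i (t + 1) (θ (t + 1)) x ∂M.T t p :=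
  (StronglyMeasurable.integral_kernel (κ := M.T t)
    (measurable_planValue_right hF (t + 1)).stronglyMeasurable).measurable

theorem measurable_bellmanError (hF : ∀ t a, Measurable fun x => F t x a) (t : ℕ) :
    Measurable (bellmanError M (F t) (F (t + 1)) l i t (θ t) (θ (t + 1))) := by
  have h1 : Measurable fun p : X × Fin K => F t p.1 p.2 :=
    measurable_from_prod_countable_left (hF t)
  have h2 : ∀ j, Measurable fun p : X × Fin K => F t p.1 p.2 j := fun j =>
    (measurable_pi_apply j).comp h1
  exact (Finset.measurable_sum _ fun j _ => (h2 j).const_mul _).sub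
    (measurable_backup (M := M) hF t)

theorem lintegral_backup (hF : ∀ t a, Measurable fun x => F t x a) (t : ℕ) :
    ∫⁻ p, ENNReal.ofReal (∫ x, planValue M.a0 (F (t + 1)) l i (t + 1) (θ (t + 1)) x ∂M.T t p)
      ∂M.occupancy π t = meanValue M F l i θ π t := by
  rw [meanValue, lintegral_nextLaw t (measurable_planValue_right hF _).ennreal_ofReal]
  refine lintegral_congr fun p => ?_
  rw [ofReal_integral_eq_lintegral_ofReal (integrable_planValue hF _ _)
    (.of_forall fun x => (planValue_mem _ _ _ _ _ _ x).1)]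

/-- The reward collected at time `t`, plus the mean estimated value at time `t + 1`. -/
noncomputable def backupValue (M : MDP X K) (F : ℕ → Feature X K d) (l : ℕ) (i : Fin d)
    (θ : ℕ → Fin d → ℝ) (π : Policy X K) (t : ℕ) : ℝ≥0∞ :=
  if t + 1 = l then latentMass M (F t) π t i else meanValue M F l i θ π t

theorem lintegral_reward_add_backup (hF : ∀ t a, Measurable fun x => F t x a) (t : ℕ) :
    ∫⁻ p, ENNReal.ofReal ((if t + 1 = l then F t p.1 p.2 i else 0) +
      ∫ x, planValue M.a0 (F (t + 1)) l i (t + 1) (θ (t + 1)) x ∂M.T t p) ∂M.occupancy π t =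
      backupValue M F l i θ π t := by
  unfold backupValue
  split_ifs with h
  · simp [planValue, h, latentMass]
  · simp only [zero_add]
    exact lintegral_backup hF t

theorem qVal_eq (t : ℕ) (p : X × Fin K) :
    qVal (F t) l i t (θ t) p.1 p.2 = ((if t + 1 = l then F t p.1 p.2 i else 0) +
      ∫ x, planValue M.a0 (F (t + 1)) l i (t + 1) (θ (t + 1)) x ∂M.T t p) +
        bellmanError M (F t) (F (t + 1)) l i t (θ t) (θ (t + 1)) p := by
  rw [qVal, bellmanError]; ring

theorem reward_add_backup_mem (hF : ∀ t a, Measurable fun x => F t x a) {t : ℕ}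
    (hg : GoodFeature (F t)) (p : X × Fin K) :
    (if t + 1 = l then F t p.1 p.2 i else 0) +
      ∫ x, planValue M.a0 (F (t + 1)) l i (t + 1) (θ (t + 1)) x ∂M.T t p ∈ Set.Icc (0 : ℝ) l := by
  have h1 := integral_planValue_mem (M := M) (l := l) (i := i) (θ := θ) hF (t + 1) (M.T t p)
  split_ifs with h
  · have h2 : ∫ x, planValue M.a0 (F (t + 1)) l i (t + 1) (θ (t + 1)) x ∂M.T t p = 0 := by
      simp [planValue, h]
    have h3 : (1 : ℝ) ≤ l := by rw [← h]; push_cast; linarith [t.cast_nonneg (α := ℝ)]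
    rw [h2, add_zero]
    exact ⟨hg.nonneg _ _ _, (hg.le_one _ _ _).trans h3⟩
  · simpa using h1

/-- No policy gains more than its mean regression error over the estimated values in one step. -/
theorem backupValue_le (hF : ∀ t a, Measurable fun x => F t x a) {t : ℕ} (ht : t + 1 < l)
    (hg : GoodFeature (F (t + 1))) {β : ℝ≥0∞}
    (hβ : ∫⁻ p, ENNReal.ofReal |bellmanError M (F (t + 1)) (F (t + 2)) l i (t + 1) (θ (t + 1))
      (θ (t + 2)) p| ∂M.occupancy π (t + 1) ≤ β) :
    backupValue M F l i θ π (t + 1) ≤ meanValue M F l i θ π t + β := by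
  have hV := (measurable_planValue_right (M := M) (l := l) (i := i) (θ := θ) hF
    (t + 1)).ennreal_ofReal
  have hV' : Measurable fun p : X × Fin K => ENNReal.ofReal
      (planValue M.a0 (F (t + 1)) l i (t + 1) (θ (t + 1)) p.1) := hV.comp measurable_fst
  have h1 : meanValue M F l i θ π t = ∫⁻ p, ENNReal.ofReal
      (planValue M.a0 (F (t + 1)) l i (t + 1) (θ (t + 1)) p.1) ∂M.occupancy π (t + 1) := by
    rw [lintegral_occupancy_succ t hV']
    simp [meanValue]
  rw [← lintegral_reward_add_backup hF, h1]
  refine le_trans ?_ (add_le_add_right hβ _)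
  rw [← lintegral_add_left hV']
  refine lintegral_mono fun p => ?_
  refine le_trans (ENNReal.ofReal_le_ofReal ?_) ENNReal.ofReal_add_le
  have hpv : planValue M.a0 (F (t + 1)) l i (t + 1) (θ (t + 1)) p.1 =
      valueVal M.a0 (F (t + 1)) l i (t + 1) (θ (t + 1)) p.1 := if_neg (by omega)
  rw [hpv]
  refine le_valueVal_add p.2 (reward_add_backup_mem hF hg p).2 (abs_nonneg _) ?_
  rw [qVal_eq (M := M)]
  have := neg_abs_le (bellmanError M (F (t + 1)) (F (t + 1 + 1)) l i (t + 1) (θ (t + 1))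
    (θ (t + 1 + 1)) p)
  linarith

/-- The greedy policy loses at most its mean regression error against the estimated values in one
step. -/
theorem meanValue_le {t : ℕ} (ht : t + 1 < l) (hg : GoodFeature (F (t + 1))) {β : ℝ≥0∞}
    (hβ : ∫⁻ p, ENNReal.ofReal |bellmanError M (F (t + 1)) (F (t + 2)) l i (t + 1) (θ (t + 1))
      (θ (t + 2)) p| ∂M.occupancy (greedyPolicy M.a0 F hF l i θ) (t + 1) ≤ β) :
    meanValue M F l i θ (greedyPolicy M.a0 F hF l i θ) t ≤
      backupValue M F l i θ (greedyPolicy M.a0 F hF l i θ) (t + 1) + β := by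
  set π := greedyPolicy M.a0 F hF l i θ with hπ
  have hb := measurable_bellmanError (M := M) (l := l) (i := i) (θ := θ) hF (t + 1)
  have h2 : Measurable fun p : X × Fin K => F (t + 1) p.1 p.2 i :=
    (measurable_pi_apply i).comp (measurable_from_prod_countable_left (hF (t + 1)))
  have hc : Measurable fun p : X × Fin K => (if t + 1 + 1 = l then F (t + 1) p.1 p.2 i else 0) +
      ∫ x, planValue M.a0 (F (t + 2)) l i (t + 2) (θ (t + 2)) x ∂M.T (t + 1) p := by
    refine Measurable.add ?_ (measurable_backup (M := M) hF (t + 1))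
    split_ifs
    · exact h2
    · exact measurable_const
  rw [← lintegral_reward_add_backup hF]
  refine le_trans ?_ (add_le_add_right hβ _)
  rw [← lintegral_add_left hc.ennreal_ofReal,
    lintegral_occupancy_succ t (f := fun p => ENNReal.ofReal _ + ENNReal.ofReal _)
      (hc.ennreal_ofReal.add (by fun_prop)), meanValue]
  refine lintegral_mono fun x => ?_
  rw [hπ, lintegral_greedyPolicy_ker ht]
  refine le_trans (ENNReal.ofReal_le_ofReal ?_) ENNReal.ofReal_add_le
  have hpv : planValue M.a0 (F (t + 1)) l i (t + 1) (θ (t + 1)) x =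
      valueVal M.a0 (F (t + 1)) l i (t + 1) (θ (t + 1)) x := if_neg (by omega)
  rw [hpv]
  refine valueVal_le_add (reward_add_backup_mem hF hg _).1 (abs_nonneg _) ?_
  rw [qVal_eq (M := M) (t + 1) (x, (greedyVal M.a0 (F (t + 1)) l i (t + 1) (θ (t + 1)) x).1)]
  have := le_abs_self (bellmanError M (F (t + 1)) (F (t + 1 + 1)) l i (t + 1) (θ (t + 1))
    (θ (t + 1 + 1)) (x, (greedyVal M.a0 (F (t + 1)) l i (t + 1) (θ (t + 1)) x).1))
  linarith

/-- If all policies have mean regression error at most `β` at the times `1, …, m`, then the greedy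
policy maximizes the mean of the `i`-th coordinate of the feature map at time `m` up to `2 m β`. -/
theorem latentMass_le_greedyPolicy {m : ℕ} (hg : ∀ t ≤ m, GoodFeature (F t)) {β : ℝ≥0∞}
    (hβ : ∀ (π : Policy X K) (t : ℕ), t + 1 ≤ m →
      ∫⁻ p, ENNReal.ofReal |bellmanError M (F (t + 1)) (F (t + 2)) (m + 1) i (t + 1) (θ (t + 1))
        (θ (t + 2)) p| ∂M.occupancy π (t + 1) ≤ β) (π : Policy X K) :
    latentMass M (F m) π m i ≤
      latentMass M (F m) (greedyPolicy M.a0 F hF (m + 1) i θ) m i + 2 * (m * β) := by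
  have hV := fun t => (measurable_planValue_right (M := M) (l := m + 1) (i := i) (θ := θ) hF
    t).ennreal_ofReal
  rcases Nat.eq_zero_or_pos m with rfl | hm
  · have h1 := ((hg 0 le_rfl).measurable_coord i).ennreal_ofReal
    simp only [latentMass]
    rw [lintegral_occupancy_zero h1, lintegral_occupancy_zero h1]
    exact le_self_add
  set π' := greedyPolicy M.a0 F hF (m + 1) i θ with hπ'
  -- Only one action is available at time `0`, so that all policies agree there.
  have h0 : meanValue M F (m + 1) i θ π 0 = meanValue M F (m + 1) i θ π' 0 := by
    simp only [meanValue]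
    rw [lintegral_nextLaw 0 (hV 1), lintegral_nextLaw 0 (hV 1), MDP.occupancy, MDP.occupancy]
  have hup : ∀ t, t + 1 ≤ m → backupValue M F (m + 1) i θ π (t + 1) ≤
      meanValue M F (m + 1) i θ π 0 + (t + 1 : ℕ) * β := fun t => by
    induction t with
    | zero =>
      intro ht
      simpa using backupValue_le hF (by omega) (hg _ ht) (hβ π 0 ht)
    | succ t ih =>
      intro ht
      refine (backupValue_le hF (by omega) (hg _ ht) (hβ π (t + 1) ht)).trans ?_
      have h1 := ih (by omega)
      rw [backupValue, if_neg (by omega)] at h1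
      calc _ ≤ meanValue M F (m + 1) i θ π 0 + (t + 1 : ℕ) * β + β := by gcongr
        _ = _ := by push_cast; ring
  have hdown : ∀ t, t + 1 ≤ m → meanValue M F (m + 1) i θ π' 0 ≤
      backupValue M F (m + 1) i θ π' (t + 1) + (t + 1 : ℕ) * β := fun t => by
    induction t with
    | zero =>
      intro ht
      simpa using meanValue_le (hF := hF) (by omega) (hg _ ht) (hβ π' 0 ht)
    | succ t ih =>
      intro ht
      have h1 := ih (by omega)
      rw [backupValue, if_neg (by omega)] at h1
      refine h1.trans ?_
      have h2 := meanValue_le (hF := hF) (θ := θ) (i := i) (l := m + 1) (by omega) (hg _ ht)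
        (hβ π' (t + 1) ht)
      calc _ ≤ backupValue M F (m + 1) i θ π' (t + 1 + 1) + β + (t + 1 : ℕ) * β := by gcongr
        _ = _ := by push_cast; ring
  obtain ⟨t, rfl⟩ : ∃ t, m = t + 1 := ⟨m - 1, by omega⟩
  have h1 := hup t le_rfl
  have h2 := hdown t le_rfl
  rw [backupValue, if_pos rfl] at h1 h2
  rw [h0] at h1
  exact h1.trans ((add_le_add_left h2 _).trans_eq (by ring))

end Planning

/-! ### Coverage -/

section Coverage

variable {X : Type u} [MeasurableSpace X] {K d H : ℕ} {vol : Measure X}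
  {M : MDP X K} {φs : ℕ → Feature X K d} {μs : ℕ → Emission X d} {F : ℕ → Feature X K d}
  {hF : ∀ t a, Measurable fun x => F t x a} {G : ℕ → Emission X d} {P : ℕ → Plan d} {η : ℝ}

/-- The mean `L¹` error at time `t`, under the policy `π`, of the learned transition operator. -/
noncomputable def modelError (vol : Measure X) (M : MDP X K) (F φs : ℕ → Feature X K d)
    (G μs : ℕ → Emission X d) (π : Policy X K) (t : ℕ) : ℝ≥0∞ :=
  ∫⁻ p, l1Dist vol (density (F t) (G t) p.1 p.2) (density (φs t) (μs t) p.1 p.2)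
    ∂M.occupancy π t

/-- The total mass that the policies of the plan of stage `l` put on the latent state `i` of the
true model. -/
noncomputable def coveredMass (M : MDP X K) (φs F : ℕ → Feature X K d)
    (hF : ∀ t a, Measurable fun x => F t x a) (P : ℕ → Plan d) (l : ℕ) (i : Fin d) : ℝ≥0∞ :=
  ∑ j, latentMass M (φs l) (greedyPolicy M.a0 F hF l j (P l j)) l i

theorem lintegral_dataLaw_succ (hfac : Factorizes vol M H φs μs)
    (gs : ∀ t < H, GoodFeature (φs t)) (es : ∀ t < H, GoodEmission vol (μs t)) {l : ℕ} (hl : l < H)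
    {g : X × Fin K → ℝ≥0∞} (hg : Measurable g) :
    ∫⁻ p, g p ∂dataLaw M F hF P (l + 1) = (d : ℝ≥0∞)⁻¹ * ∑ i, coveredMass M φs F hF P l i *
      ∫⁻ x, ∫⁻ a, g (x, a) ∂unifMeasure K ∂emissionMeasure vol (μs l) i := by
  have hm : Measurable fun x => ∫⁻ a, g (x, a) ∂unifMeasure K := by
    simp only [lintegral_unifMeasure]; fun_prop
  rw [dataLaw, lintegral_smul_measure, lintegral_finsetSum_measure, smul_eq_mul]
  congr 1
  simp only [coveredMass, Finset.sum_mul]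
  rw [Finset.sum_comm]
  refine Finset.sum_congr rfl fun j _ => ?_
  rw [lintegral_occupancy_succ l hg]
  simp only [greedyPolicy_ker_of_le (Nat.le_succ l)]
  rw [lintegral_nextLaw l hm, ← lintegral_lintegral_densityMeasure (gs l hl) (es l hl) l hm]
  exact lintegral_congr fun p => by rw [hfac l hl p.1 p.2]

/-- If every latent state of the true model that can be reached at all is covered by the plan of
stage `l`, then the data distribution at time `l + 1` dominates all occupancy measures. -/
theorem lintegral_occupancy_le_of_covered (hfac : Factorizes vol M H φs μs)
    (gs : ∀ t < H, GoodFeature (φs t)) (es : ∀ t < H, GoodEmission vol (μs t)) (hd : 0 < d)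
    {l : ℕ} (hl : l < H) {c : ℝ≥0∞}
    (hc : ∀ (π : Policy X K) i, latentMass M (φs l) π l i ≤ c * coveredMass M φs F hF P l i)
    (π : Policy X K) {g : X × Fin K → ℝ≥0∞} (hg : Measurable g) :
    ∫⁻ p, g p ∂M.occupancy π (l + 1) ≤ K * (c * d) * ∫⁻ p, g p ∂dataLaw M F hF P (l + 1) := by
  have hm : Measurable fun x => ∫⁻ a, g (x, a) ∂unifMeasure K := by
    simp only [lintegral_unifMeasure]; fun_prop
  have h1 : ∫⁻ x, ∫⁻ a, g (x, a) ∂unifMeasure K ∂M.nextLaw π l =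
      ∑ i, latentMass M (φs l) π l i *
        ∫⁻ x, ∫⁻ a, g (x, a) ∂unifMeasure K ∂emissionMeasure vol (μs l) i := by
    rw [lintegral_nextLaw l hm, ← lintegral_lintegral_densityMeasure (gs l hl) (es l hl) l hm]
    exact lintegral_congr fun p => by rw [hfac l hl p.1 p.2]
  refine (lintegral_occupancy_succ_le l hg).trans ?_
  rw [h1, lintegral_dataLaw_succ hfac gs es hl hg, mul_assoc (K : ℝ≥0∞), mul_assoc c,
    ← mul_assoc (d : ℝ≥0∞),
    ENNReal.mul_inv_cancel (by simpa using hd.ne') (by simp), one_mul, Finset.mul_sum (a := c)]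
  refine mul_le_mul_right (Finset.sum_le_sum fun i _ => ?_) _
  rw [← mul_assoc]
  exact mul_le_mul_left (hc π i) _

/-- One step of the coverage argument. The state at time `m + 1` is generated, up to the model error
at time `m`, by the latent variable of the learned model; the plan of stage `m + 1` covers this
variable, hence, after a uniformly random action, also the latent variable of the true model. -/
theorem latentMass_le_coveredMass [SigmaFinite vol] (hfac : Factorizes vol M H φs μs)
    (gs : ∀ t < H, GoodFeature (φs t)) (es : ∀ t < H, GoodEmission vol (μs t))
    (gF : ∀ t < H, GoodFeature (F t)) (eG : ∀ t < H, GoodEmission vol (G t)) {m : ℕ}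
    (hm : m + 1 < H) {ε ε' : ℝ≥0∞} (hε : ∀ π, modelError vol M F φs G μs π m ≤ ε)
    (hopt : ∀ π j, latentMass M (F m) π m j ≤
      latentMass M (F m) (greedyPolicy M.a0 F hF (m + 1) j (P (m + 1) j)) m j + ε')
    (π : Policy X K) (i : Fin d) :
    latentMass M (φs (m + 1)) π (m + 1) i ≤
      K * (coveredMass M φs F hF P (m + 1) i + (ε + d * ε' + d * ε)) := by
  have hm' : m < H := by omega
  have hφ := (gs (m + 1) hm).measurable_coord i
  set f : X → ℝ≥0∞ := fun x => ∫⁻ a, ENNReal.ofReal (φs (m + 1) x a i) ∂unifMeasure K with hf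
  have mf : Measurable f := by
    have : ∀ a, Measurable fun x => φs (m + 1) x a i := fun a =>
      (measurable_pi_apply i).comp ((gs (m + 1) hm).meas a)
    simp only [hf, lintegral_unifMeasure]; fun_prop
  have := isProbabilityMeasure_unifMeasure M.a0
  have hf1 : ∀ x, f x ≤ 1 := fun x => by
    calc f x ≤ ∫⁻ _, 1 ∂unifMeasure K := lintegral_mono fun a =>
          ENNReal.ofReal_le_one.mpr ((gs (m + 1) hm).le_one _ _ _)
      _ = 1 := by simp
  set w : Fin d → ℝ≥0∞ := fun j => ∫⁻ x, f x ∂emissionMeasure vol (G m) j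
  have hw1 : ∀ j, w j ≤ 1 := fun j => by
    have := (eG m hm').isProbabilityMeasure j
    calc w j ≤ ∫⁻ _, 1 ∂emissionMeasure vol (G m) j := lintegral_mono hf1
      _ = 1 := by simp
  have mD := measurable_l1Dist (gF m hm') (eG m hm') (gs m hm') (es m hm')
  have hnext : ∀ π, ∫⁻ x, f x ∂M.nextLaw π m = ∫⁻ p, ∫⁻ x, f x
      ∂densityMeasure vol (φs m) (μs m) p.1 p.2 ∂M.occupancy π m := fun π => by
    rw [lintegral_nextLaw m mf]
    exact lintegral_congr fun p => by rw [hfac m hm' p.1 p.2]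
  have hup : ∀ π, ∫⁻ x, f x ∂M.nextLaw π m ≤ ∑ j, latentMass M (F m) π m j * w j + ε := fun π => by
    rw [hnext, ← lintegral_lintegral_densityMeasure (gF m hm') (eG m hm') m mf]
    refine le_trans ?_ (add_le_add_right (hε π) _)
    rw [modelError, ← lintegral_add_right _ mD]
    refine lintegral_mono fun p => ?_
    have := lintegral_densityMeasure_le (φ := φs m) (φ' := F m) (es m hm') (eG m hm') p.1 p.2 mf hf1
    simpa only [l1Dist, abs_sub_comm] using this
  have hdown : ∀ π, ∑ j, latentMass M (F m) π m j * w j ≤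
      ∫⁻ x, f x ∂M.nextLaw π m + ε := fun π => by
    rw [hnext, ← lintegral_lintegral_densityMeasure (gF m hm') (eG m hm') m mf]
    refine le_trans ?_ (add_le_add_right (hε π) _)
    rw [modelError, ← lintegral_add_right _ mD]
    exact lintegral_mono fun p =>
      lintegral_densityMeasure_le (φ := F m) (φ' := φs m) (eG m hm') (es m hm') p.1 p.2 mf hf1
  set πs := fun j => greedyPolicy M.a0 F hF (m + 1) j (P (m + 1) j)
  -- The greedy policy of stage `m + 1` acts uniformly at time `m + 1`.
  have hcov : coveredMass M φs F hF P (m + 1) i = ∑ j, ∫⁻ x, f x ∂M.nextLaw (πs j) m := by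
    refine Finset.sum_congr rfl fun j _ => ?_
    rw [latentMass, lintegral_occupancy_succ m (by fun_prop)]
    simp only [greedyPolicy_ker_of_le le_rfl]
    rfl
  refine (lintegral_occupancy_succ_le m (by fun_prop)).trans ?_
  gcongr
  calc ∫⁻ x, f x ∂M.nextLaw π m ≤ ∑ j, latentMass M (F m) π m j * w j + ε := hup π
    _ ≤ ∑ j, (∫⁻ x, f x ∂M.nextLaw (πs j) m + ε + ε') + ε := by
        gcongr with j
        calc latentMass M (F m) π m j * w j
            ≤ (latentMass M (F m) (πs j) m j + ε') * w j := by gcongr; exact hopt π j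
          _ ≤ latentMass M (F m) (πs j) m j * w j + ε' := by
              rw [add_mul]; gcongr; exact mul_le_of_le_one_right' (hw1 j)
          _ ≤ ∑ j', latentMass M (F m) (πs j) m j' * w j' + ε' := by
              gcongr
              exact Finset.single_le_sum (f := fun j' => latentMass M (F m) (πs j) m j' * w j')
                (fun _ _ => zero_le) (Finset.mem_univ j)
          _ ≤ _ := by gcongr; exact hdown (πs j)
    _ = _ := by
        rw [hcov]
        simp only [Finset.sum_add_distrib, Finset.sum_const, Finset.card_univ, Fintype.card_fin,
          nsmul_eq_mul]
        ring

/-- Bounds on the regression and model errors under the data distributions imply a bound on the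
model error under every policy: coverage at time `t` follows by induction from the accuracy of the
learned model and of the plans at earlier times, and because the latent states that matter have
probability at least `η`, the constant in the coverage does not deteriorate with `t`. -/
theorem modelError_le [SigmaFinite vol] (hfac : Factorizes vol M H φs μs)
    (gs : ∀ t < H, GoodFeature (φs t)) (es : ∀ t < H, GoodEmission vol (μs t))
    (gF : ∀ t < H, GoodFeature (F t)) (eG : ∀ t < H, GoodEmission vol (G t)) (hd : 0 < d)
    (hη : 0 < η) (hη1 : η ≤ 1) (hreach : Reachable M H φs η) {κ ε ε₁ ε₂ : ℝ≥0∞}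
    (hκ : κ = K * ((ENNReal.ofReal η)⁻¹ * (2 * K) * d))
    (hmodel : ∀ t < H, ∫⁻ p, l1Dist vol (density (F t) (G t) p.1 p.2)
      (density (φs t) (μs t) p.1 p.2) ∂dataLaw M F hF P t ≤ ε₁)
    (hreg : ∀ l < H, ∀ i t, 1 ≤ t → t < l →
      ∫⁻ p, ENNReal.ofReal |bellmanError M (F t) (F (t + 1)) l i t (P l i t) (P l i (t + 1)) p|
        ∂dataLaw M F hF P t ≤ ε₂)
    (hε : κ * ε₁ ≤ ε)
    (hsmall : 2 * (K * (ε + d * (2 * (H * (κ * ε₂))) + d * ε)) ≤ ENNReal.ofReal η) :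
    ∀ t < H, ∀ π, modelError vol M F φs G μs π t ≤ ε := by
  have hK : 0 < K := Nat.pos_of_ne_zero fun h => by subst h; exact M.a0.elim0
  have hηE : ENNReal.ofReal η ≠ 0 := by simpa using hη
  have h1K : (1 : ℝ≥0∞) ≤ K := by exact_mod_cast hK
  have h1d : (1 : ℝ≥0∞) ≤ d := by exact_mod_cast hd
  have hηinv : 1 ≤ (ENNReal.ofReal η)⁻¹ := by
    rw [ENNReal.one_le_inv]; exact ENNReal.ofReal_le_one.mpr hη1
  have hκ1 : 1 ≤ κ := by
    rw [hκ]
    refine one_le_mul h1K (one_le_mul (one_le_mul hηinv (one_le_mul one_le_two h1K)) h1d)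
  suffices hcover : ∀ t < H, ∀ (π : Policy X K) (g : X × Fin K → ℝ≥0∞), Measurable g →
      ∫⁻ p, g p ∂M.occupancy π t ≤ κ * ∫⁻ p, g p ∂dataLaw M F hF P t by
    intro t ht π
    refine (hcover t ht π _ (measurable_l1Dist (gF t ht) (eG t ht) (gs t ht) (es t ht))).trans ?_
    exact (mul_le_mul_right (hmodel t ht) κ).trans hε
  intro t
  induction t using Nat.strong_induction_on with
  | _ t ih =>
  intro ht π g hg
  have herr : ∀ s < t, ∀ π, modelError vol M F φs G μs π s ≤ ε := fun s hs π =>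
    (ih s hs (hs.trans ht) π _ (measurable_l1Dist (gF s (hs.trans ht)) (eG s (hs.trans ht))
      (gs s (hs.trans ht)) (es s (hs.trans ht)))).trans
      ((mul_le_mul_right (hmodel s (hs.trans ht)) κ).trans hε)
  rcases t with _ | l
  · rw [dataLaw, MDP.occupancy]
    exact le_mul_of_one_le_left' hκ1
  have hl : l < H := by omega
  rw [hκ]
  refine lintegral_occupancy_le_of_covered hfac gs es hd hl (fun π i => ?_) π hg
  rcases eq_or_ne (latentMass M (φs l) π l i) 0 with h0 | h0
  · rw [h0]; exact zero_le
  obtain ⟨π₀, hπ₀⟩ := hreach l hl i ⟨π, by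
    rw [← ofReal_latentProb (gs l hl)] at h0
    exact ENNReal.ofReal_pos.mp (pos_iff_ne_zero.mpr h0)⟩
  have hπ₀' : ENNReal.ofReal η ≤ latentMass M (φs l) π₀ l i := by
    rw [← ofReal_latentProb (gs l hl)]; exact ENNReal.ofReal_le_ofReal hπ₀
  have hS : ENNReal.ofReal η ≤ 2 * K * coveredMass M φs F hF P l i := by
    rcases l with _ | m
    -- The state and the action at time `0` do not depend on the policy.
    · refine hπ₀'.trans ?_
      have h1 := ((gs 0 hl).measurable_coord i).ennreal_ofReal
      have h2 : latentMass M (φs 0) π₀ 0 i ≤ coveredMass M φs F hF P 0 i := by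
        refine le_trans (le_of_eq ?_) (Finset.single_le_sum (f := fun j =>
          latentMass M (φs 0) (greedyPolicy M.a0 F hF 0 j (P 0 j)) 0 i) (fun _ _ => zero_le)
            (Finset.mem_univ (⟨0, hd⟩ : Fin d)))
        simp only [latentMass]
        rw [lintegral_occupancy_zero h1, lintegral_occupancy_zero h1]
      exact h2.trans (le_mul_of_one_le_left' (one_le_mul one_le_two h1K))
    · have hopt : ∀ π j, latentMass M (F m) π m j ≤ latentMass M (F m)
          (greedyPolicy M.a0 F hF (m + 1) j (P (m + 1) j)) m j + 2 * (H * (κ * ε₂)) :=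
        fun π j => by
          refine (latentMass_le_greedyPolicy (M := M) (hF := hF) (β := κ * ε₂)
            (θ := P (m + 1) j) (fun s hs => gF s (by omega)) (fun π s hs => ?_) π).trans ?_
          · refine (ih (s + 1) (by omega) (by omega) π _ ?_).trans
              (mul_le_mul_right (hreg (m + 1) hl j (s + 1) (by omega) (by omega)) κ)
            have := measurable_bellmanError (M := M) (l := m + 1) (i := j) (θ := P (m + 1) j) hF
              (s + 1)
            fun_prop
          · gcongr
            omega
      have h1 := hπ₀'.trans (latentMass_le_coveredMass (hF := hF) (P := P) hfac gs es gF eG hl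
        (herr m (by omega)) hopt π₀ i)
      -- The error terms amount to at most `η / 2`, at most half the mass of `i` under `π₀`.
      have h2 : ENNReal.ofReal η + ENNReal.ofReal η ≤
          2 * K * coveredMass M φs F hF P (m + 1) i + ENNReal.ofReal η := by
        rw [← two_mul]
        calc 2 * ENNReal.ofReal η ≤ 2 * (K * (coveredMass M φs F hF P (m + 1) i +
              (ε + d * (2 * (H * (κ * ε₂))) + d * ε))) := by gcongr
          _ = 2 * K * coveredMass M φs F hF P (m + 1) i +
              2 * (K * (ε + d * (2 * (H * (κ * ε₂))) + d * ε)) := by ring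
          _ ≤ _ := by gcongr
      exact ENNReal.le_of_add_le_add_right ENNReal.ofReal_ne_top h2
  -- Covered mass of order `η` dominates the mass under any policy, whatever the error terms were;
  -- hence the induction does not lose a factor.
  calc latentMass M (φs l) π l i ≤ 1 := latentMass_le_one (gs l hl) l i
    _ = (ENNReal.ofReal η)⁻¹ * ENNReal.ofReal η := (ENNReal.inv_mul_cancel hηE (by simp)).symm
    _ ≤ (ENNReal.ofReal η)⁻¹ * (2 * K * coveredMass M φs F hF P l i) := by gcongr
    _ = _ := by ring

end Coverage

/-! ### The memory of the algorithm -/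

section Memory

variable {X : Type u} {K d : ℕ} {Φ : Finset (Feature X K d)} {Υ : Finset (Emission X d)}

theorem Memory.measurable_plan {h : ℕ} (t : ℕ) :
    Measurable fun S : Memory Φ Υ h => S.plan t := by
  unfold Memory.plan
  split_ifs with ht
  · fun_prop
  · exact measurable_const

theorem measurable_snoc {α : Type*} [MeasurableSpace α] {n : ℕ} :
    Measurable fun z : (Fin n → α) × α => (Fin.snoc z.1 z.2 : Fin (n + 1) → α) := by
  refine measurable_pi_lambda _ fun i => ?_
  refine Fin.lastCases ?_ (fun i => ?_) i
  · simpa using measurable_snd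
  · simpa using! (measurable_pi_apply i).comp measurable_fst

/-- The memory after one more stage. -/
def Memory.snoc {h : ℕ} (S : Memory Φ Υ h) (m : Model Φ Υ) (plan : Plan d) : Memory Φ Υ (h + 1) :=
  (Fin.snoc S.1 m, Fin.snoc S.2 plan)

theorem Memory.feat_snoc {h : ℕ} (S : Memory Φ Υ h) (m : Model Φ Υ) (plan : Plan d) {t : ℕ}
    (ht : t < h) : (S.snoc m plan).feat t = S.feat t := by
  rw [Memory.feat, Memory.feat, dif_pos ht, dif_pos (by omega)]
  congr 1
  exact Fin.snoc_castSucc (α := fun _ => Model Φ Υ) m S.1 ⟨t, ht⟩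

theorem Memory.plan_snoc {h : ℕ} (S : Memory Φ Υ h) (m : Model Φ Υ) (plan : Plan d) {t : ℕ}
    (ht : t < h) : (S.snoc m plan).plan t = S.plan t := by
  rw [Memory.plan, Memory.plan, dif_pos ht, dif_pos (by omega)]
  exact Fin.snoc_castSucc (α := fun _ => Plan d) plan S.2 ⟨t, ht⟩

theorem Memory.plan_snoc_last {h : ℕ} (S : Memory Φ Υ h) (m : Model Φ Υ) (plan : Plan d) :
    (S.snoc m plan).plan h = plan := by
  rw [Memory.plan, dif_pos (by omega)]
  exact Fin.snoc_last (α := fun _ => Plan d) plan S.2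

variable [MeasurableSpace X]

theorem Memory.measurable_feat_uncurry (hΦ : SimplexFeatures Φ) {h : ℕ} (t : ℕ) (a : Fin K) :
    Measurable fun z : Memory Φ Υ h × X => z.1.feat t z.2 a := by
  unfold Memory.feat
  split_ifs with ht
  · have h1 : Measurable fun z : Model Φ Υ × X => z.1.phi z.2 a :=
      measurable_from_prod_countable_right fun m => (m.goodFeature hΦ).meas a
    exact h1.comp (f := fun z : Memory Φ Υ h × X => (z.1.1 ⟨t, ht⟩, z.2)) (by fun_prop)
  · exact measurable_const

theorem Memory.measurable_feat (hΦ : SimplexFeatures Φ) {h : ℕ} (S : Memory Φ Υ h) (t : ℕ)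
    (a : Fin K) : Measurable fun x => S.feat t x a :=
  (Memory.measurable_feat_uncurry hΦ t a).comp (f := fun x => (S, x)) (by fun_prop)

theorem Memory.goodFeature_feat (hΦ : SimplexFeatures Φ) {h : ℕ} (S : Memory Φ Υ h) {t : ℕ}
    (ht : t < h) : GoodFeature (S.feat t) := by
  rw [Memory.feat, dif_pos ht]
  exact (S.1 ⟨t, ht⟩).goodFeature hΦ

end Memory

/-! ### The law of the collected data -/

section SampleLaw

open Prog

variable {X : Type u} {K d : ℕ} {Φ : Finset (Feature X K d)}
  {Υ : Finset (Emission X d)}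

/-- The action of `ρ_{l+1}` at time `t < l`. -/
noncomputable def exploreAction (a0 : Fin K) {h : ℕ} (S : Memory Φ Υ h) (l : ℕ) (i : Fin d)
    (t : ℕ) (x : X) : Fin K :=
  if t = 0 then a0 else (greedyVal a0 (S.feat t) l i t (S.plan l i t) x).1

/-- One step of `ρ_{l+1}` before time `l`. -/
noncomputable def exploreBody (a0 : Fin K) {h : ℕ} (S : Memory Φ Υ h) (l : ℕ) (i : Fin d)
    (t : ℕ) (x : X) : Prog X K (Model Φ Υ) X :=
  (if t = 0 then Prog.ret a0 else
    (greedy a0 (S.feat t) l i t (S.plan l i t) x).bind fun b => Prog.ret b.1).bind fun a =>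
  Prog.act a Prog.ret

theorem evals_exploreAction (a0 : Fin K) {h : ℕ} (S : Memory Φ Υ h) (l : ℕ) (i : Fin d)
    (t : ℕ) (x : X) : Evals (if t = 0 then Prog.ret a0 else
      (greedy a0 (S.feat t) l i t (S.plan l i t) x).bind fun b => Prog.ret b.1 :
      Prog X K (Model Φ Υ) (Fin K)) (exploreAction a0 S l i t x) := by
  unfold exploreAction
  split_ifs
  · exact .ret _
  · exact (evals_greedy _ _ _ _ _ _ _).bind (.ret _)

variable [MeasurableSpace X] {M : MDP X K} {mle : ∀ n, Dataset X K n → Model Φ Υ}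

theorem Prog.MF.of_countable {Ω ι α : Type*} [MeasurableSpace Ω] [MeasurableSpace ι] [Countable ι]
    [MeasurableSingletonClass ι] [MeasurableSpace α] {p : Ω → ι → Prog X K (Model Φ Υ) α}
    (hp : ∀ i, MF M mle fun ω => p ω i) : MF M mle fun z : Ω × ι => p z.1 z.2 := by
  refine ⟨fun z => (hp z.2).wf z.1, ?_⟩
  have h1 : Measurable fun z : ι × (Ω × (ℕ × X)) => Prog.law M mle (p z.2.1 z.1) z.2.2 :=
    measurable_from_prod_countable_right fun i => (hp i).meas
  exact h1.comp (f := fun z : (Ω × ι) × (ℕ × X) => (z.1.2, (z.1.1, z.2))) (by fun_prop)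

theorem Prog.WF.lintegral_bind {α β : Type*} [MeasurableSpace α] [MeasurableSpace β]
    {p : Prog X K (Model Φ Υ) α} {f : α → Prog X K (Model Φ Υ) β} (hp : WF M mle p)
    (hf : MF M mle f) (s : ℕ × X) {g : β × (ℕ × X) → ℝ≥0∞} (hg : Measurable g) :
    ∫⁻ z, g z ∂law M mle (p.bind f) s =
      ∫⁻ z, ∫⁻ y, g y ∂law M mle (f z.1) z.2 ∂law M mle p s := by
  rw [hp.law_bind hf.meas, Measure.lintegral_bind hf.meas.aemeasurable hg.aemeasurable]

/-- The law of a uniformly random available action at time `t`. -/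
noncomputable def actionLaw (a0 : Fin K) (t : ℕ) : Measure (Fin K) :=
  if t = 0 then Measure.dirac a0 else unifMeasure K

theorem lintegral_unifAction_bind {α : Type*} [MeasurableSpace α] (t : ℕ)
    (f : Fin K → Prog X K (Model Φ Υ) α) (s : ℕ × X) (g : α × (ℕ × X) → ℝ≥0∞) :
    ∫⁻ z, g z ∂law M mle ((unifAction M.a0 t).bind f) s =
      ∫⁻ a, ∫⁻ z, g z ∂law M mle (f a) s ∂actionLaw M.a0 t := by
  unfold unifAction actionLaw
  split_ifs
  · simp [Prog.bind]
  · simp only [Prog.bind, law, lintegral_unifMeasure, lintegral_smul_measure,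
      lintegral_finsetSum_measure, smul_eq_mul]

theorem lintegral_act (a : Fin K) (t : ℕ) (x : X) {g : X × (ℕ × X) → ℝ≥0∞} (hg : Measurable g) :
    ∫⁻ z, g z ∂law M mle (act a Prog.ret : Prog X K (Model Φ Υ) X) (t, x) =
      ∫⁻ x', g (x', (t + 1, x')) ∂M.T t (x, a) := by
  have h1 : Measurable fun x' : X => Measure.dirac (x', (t + 1, x')) :=
    Measure.measurable_dirac.comp (by fun_prop)
  simp only [law]
  rw [Measure.lintegral_bind h1.aemeasurable hg.aemeasurable]
  exact lintegral_congr fun x' => lintegral_dirac' _ hg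

theorem mf_unifAction {Ω : Type*} [MeasurableSpace Ω] (a0 : Fin K) (t : ℕ) :
    MF M mle fun _ : Ω => (unifAction a0 t : Prog X K (Model Φ Υ) (Fin K)) := by
  unfold unifAction
  split_ifs
  · exact .ret measurable_const
  · exact .unif fun h => by subst h; exact a0.elim0

theorem measurable_exploreAction (hΦ : SimplexFeatures Φ) (a0 : Fin K) {h : ℕ} (l : ℕ)
    (i : Fin d) (t : ℕ) :
    Measurable fun z : Memory Φ Υ h × X => exploreAction a0 z.1 l i t z.2 := by
  unfold exploreAction
  split_ifs
  · exact measurable_const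
  · refine (measurable_greedyVal a0 (φ := fun z : Memory Φ Υ h × X => z.1.feat t)
      (x := fun z => z.2) (θ := fun z => z.1.plan l i t)
      (fun a => Memory.measurable_feat_uncurry hΦ t a) ?_ l i t).fst
    have := Memory.measurable_plan (Φ := Φ) (Υ := Υ) (h := h) l
    fun_prop

theorem mf_exploreBody (hΦ : SimplexFeatures Φ) (a0 : Fin K) {h : ℕ} (l : ℕ) (i : Fin d) (t : ℕ) :
    MF M mle fun z : Memory Φ Υ h × X => exploreBody a0 z.1 l i t z.2 :=
  .bind (.of_evals (fun z => evals_exploreAction a0 z.1 l i t z.2)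
    (measurable_exploreAction hΦ a0 l i t)) (.act measurable_snd)

theorem lintegral_exploreBody {h : ℕ} (S : Memory Φ Υ h) (l : ℕ) (i : Fin d) (t : ℕ) (x : X)
    {g : X × (ℕ × X) → ℝ≥0∞} (hg : Measurable g) :
    ∫⁻ z, g z ∂law M mle (exploreBody M.a0 S l i t x) (t, x) =
      ∫⁻ x', g (x', (t + 1, x')) ∂M.T t (x, exploreAction M.a0 S l i t x) := by
  have h1 := evals_exploreAction M.a0 S l i t x
  have h2 : MF M mle fun a : Fin K => (Prog.act a Prog.ret : Prog X K (Model Φ Υ) X) :=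
    .act measurable_id
  have h3 : Measurable fun z : Fin K × (ℕ × X) => ∫⁻ y, g y
      ∂law M mle (Prog.act z.1 Prog.ret : Prog X K (Model Φ Υ) X) z.2 :=
    (Measure.measurable_lintegral hg).comp h2.meas
  rw [exploreBody, (h1.wf).lintegral_bind h2 _ hg, h1.law, lintegral_dirac' _ h3]
  exact lintegral_act _ _ _ hg

theorem mf_explore (hΦ : SimplexFeatures Φ) (hd : d ≠ 0) (a0 : Fin K) {h : ℕ} (t : ℕ) :
    MF M mle fun S : Memory Φ Υ h => explore a0 S t := by
  cases t with
  | zero => exact .reset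
  | succ l =>
    refine .bind (.unif hd) (MF.of_countable (p := fun (S : Memory Φ Υ h) i =>
      (Prog.reset Prog.ret).bind fun x0 =>
        (Prog.loop l (fun t x => exploreBody a0 S l i t x) x0).bind fun _ =>
          (unifAction a0 l).bind fun a => Prog.act a Prog.ret) fun i => ?_)
    refine .bind .reset (.bind (.loop (fun t => ?_) measurable_snd)
      (.bind (mf_unifAction a0 l) (.act measurable_snd)))
    exact (mf_exploreBody hΦ a0 l i t).comp
      (g := fun z : (Memory Φ Υ h × X) × X => (z.1.1, z.2)) (by fun_prop)

theorem mf_sampleTriple (hΦ : SimplexFeatures Φ) (hd : d ≠ 0) (a0 : Fin K) {h : ℕ} (t : ℕ) :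
    MF M mle fun S : Memory Φ Υ h => sampleTriple a0 S t :=
  .bind (mf_explore hΦ hd a0 t) (.bind (mf_unifAction a0 t)
    (.bind (.act measurable_snd) (.ret (by fun_prop))))

/-- The law of the state at time `t`. -/
noncomputable def stateLaw (M : MDP X K) (π : Policy X K) : ℕ → Measure X
  | 0 => Measure.dirac M.x0
  | t + 1 => M.nextLaw π t

/-- The policy executed by `ρ_{l+1}` followed by a uniformly random action, for a given `i`. -/
noncomputable def explorePolicy (hΦ : SimplexFeatures Φ) (a0 : Fin K) {h : ℕ} (S : Memory Φ Υ h)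
    (l : ℕ) (i : Fin d) : Policy X K :=
  greedyPolicy a0 S.feat (S.measurable_feat hΦ) l i (S.plan l i)

/-- The law of the state-action pairs at time `t` in the data collected by the algorithm. -/
noncomputable def Memory.dataLaw (M : MDP X K) (hΦ : SimplexFeatures Φ) {h : ℕ} (S : Memory Φ Υ h)
    (t : ℕ) : Measure (X × Fin K) :=
  Flambe.dataLaw M S.feat (S.measurable_feat hΦ) S.plan t

theorem lintegral_occupancy_greedy (hΦ : SimplexFeatures Φ) {h : ℕ} (S : Memory Φ Υ h) {l : ℕ}
    (i : Fin d) {t : ℕ} (ht : t < l) {f : X × Fin K → ℝ≥0∞} (hf : Measurable f) :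
    ∫⁻ p, f p ∂M.occupancy (explorePolicy hΦ M.a0 S l i) t =
      ∫⁻ x, f (x, exploreAction M.a0 S l i t x) ∂stateLaw M (explorePolicy hΦ M.a0 S l i) t := by
  have h1 : Measurable fun x => f (x, exploreAction M.a0 S l i t x) :=
    hf.comp (measurable_id.prodMk ((measurable_exploreAction (Υ := Υ) hΦ M.a0 (h := h) l i t).comp
      (f := fun x => (S, x)) (by fun_prop)))
  cases t with
  | zero =>
    rw [lintegral_occupancy_zero hf, stateLaw, lintegral_dirac' _ h1]
    rfl
  | succ t =>
    rw [lintegral_occupancy_succ t hf, stateLaw]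
    refine lintegral_congr fun x => ?_
    rw [explorePolicy, lintegral_greedyPolicy_ker ht]
    rfl

theorem lintegral_occupancy_unif (hΦ : SimplexFeatures Φ) {h : ℕ} (S : Memory Φ Υ h) {l : ℕ}
    (i : Fin d) {t : ℕ} (ht : l ≤ t) {f : X × Fin K → ℝ≥0∞} (hf : Measurable f) :
    ∫⁻ p, f p ∂M.occupancy (explorePolicy hΦ M.a0 S l i) t =
      ∫⁻ x, ∫⁻ a, f (x, a) ∂actionLaw M.a0 t ∂stateLaw M (explorePolicy hΦ M.a0 S l i) t := by
  cases t with
  | zero =>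
    simp only [actionLaw, if_true, lintegral_dirac]
    rw [lintegral_occupancy_zero hf, stateLaw, lintegral_dirac' _ (by fun_prop)]
  | succ t =>
    rw [lintegral_occupancy_succ t hf, stateLaw]
    refine lintegral_congr fun x => ?_
    rw [explorePolicy, greedyPolicy_ker_of_le ht, actionLaw, if_neg (Nat.succ_ne_zero t)]

theorem wf_exploreLoop (hΦ : SimplexFeatures Φ) {h : ℕ} (S : Memory Φ Υ h) (l : ℕ) (i : Fin d)
    (k : ℕ) (x : X) : WF M mle (Prog.loop k (fun t x => exploreBody M.a0 S l i t x) x) :=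
  (MF.loop (Ω := Unit) (f := fun _ t x => exploreBody M.a0 S l i t x) (s := fun _ => x)
    (fun t => (mf_exploreBody hΦ M.a0 l i t).comp (g := fun z : Unit × X => (S, z.2))
      (by fun_prop)) measurable_const).wf ()

/-- The loop of `ρ_{l+1}` has been run for `k` of its `l` rounds, so that the environment is at time
`k`; the state has the law that it has under the policy `explorePolicy`. -/
theorem lintegral_exploreLoop (hΦ : SimplexFeatures Φ) {h : ℕ} (S : Memory Φ Υ h) (l : ℕ)
    (i : Fin d) {k : ℕ} (hk : k ≤ l) {g : X × (ℕ × X) → ℝ≥0∞} (hg : Measurable g) :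
    ∫⁻ z, g z ∂law M mle (Prog.loop k (fun t x => exploreBody M.a0 S l i t x) M.x0) (0, M.x0) =
      ∫⁻ x, g (x, (k, x)) ∂stateLaw M (explorePolicy hΦ M.a0 S l i) k := by
  induction k generalizing g with
  | zero =>
    simp only [Prog.loop, law]
    rw [stateLaw, lintegral_dirac' _ hg, lintegral_dirac' _ (by fun_prop)]
  | succ k ih =>
    have h1 : MF M mle fun x => exploreBody M.a0 S l i k x :=
      (mf_exploreBody hΦ M.a0 l i k).comp (g := fun x => (S, x)) (by fun_prop)
    have h2 : Measurable fun z : X × (ℕ × X) =>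
        ∫⁻ y, g y ∂law M mle (Prog.tick (exploreBody M.a0 S l i k z.1)) z.2 :=
      (Measure.measurable_lintegral hg).comp h1.tick.meas
    have h3 : Measurable fun p : X × Fin K => ∫⁻ x', g (x', (k + 1, x')) ∂M.T k p :=
      (Measure.measurable_lintegral (by fun_prop)).comp (M.T k).measurable
    rw [Prog.loop_succ_last, (wf_exploreLoop hΦ S l i k M.x0).lintegral_bind h1.tick _ hg,
      ih (by omega) h2]
    simp only [law, lintegral_exploreBody _ _ _ _ _ hg]
    rw [stateLaw, lintegral_nextLaw k (by fun_prop),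
      lintegral_occupancy_greedy hΦ S i (by omega) h3]

theorem lintegral_explore_succ (hΦ : SimplexFeatures Φ) {h : ℕ} (S : Memory Φ Υ h) (l : ℕ)
    (s : ℕ × X) {g : X × (ℕ × X) → ℝ≥0∞} (hg : Measurable g) :
    ∫⁻ z, g z ∂law M mle (explore M.a0 S (l + 1)) s =
      (d : ℝ≥0∞)⁻¹ * ∑ i, ∫⁻ x, g (x, (l + 1, x))
        ∂stateLaw M (explorePolicy hΦ M.a0 S l i) (l + 1) := by
  have h0 : explore M.a0 S (l + 1) = Prog.unif d fun i => Prog.reset fun x0 =>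
      (Prog.loop l (fun t x => exploreBody M.a0 S l i t x) x0).bind fun _ =>
        (unifAction M.a0 l).bind fun a => Prog.act a Prog.ret := rfl
  have h1 : MF M mle fun _ : X =>
      ((unifAction M.a0 l).bind fun a => Prog.act a Prog.ret : Prog X K (Model Φ Υ) X) :=
    .bind (mf_unifAction M.a0 l) (.act measurable_snd)
  have h2 : Measurable fun z : X × (ℕ × X) => ∫⁻ y, g y ∂law M mle
      ((unifAction M.a0 l).bind fun a => Prog.act a Prog.ret : Prog X K (Model Φ Υ) X) z.2 :=
    (Measure.measurable_lintegral hg).comp h1.meas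
  have h3 : Measurable fun p : X × Fin K => ∫⁻ x', g (x', (l + 1, x')) ∂M.T l p :=
    (Measure.measurable_lintegral (by fun_prop)).comp (M.T l).measurable
  rw [h0]
  simp only [law, lintegral_smul_measure, lintegral_finsetSum_measure, smul_eq_mul]
  congr 1
  refine Finset.sum_congr rfl fun i _ => ?_
  rw [(wf_exploreLoop hΦ S l i l M.x0).lintegral_bind h1 _ hg,
    lintegral_exploreLoop hΦ S l i le_rfl h2]
  simp only [lintegral_unifAction_bind, lintegral_act _ _ _ hg]
  rw [stateLaw, lintegral_nextLaw l (by fun_prop),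
    lintegral_occupancy_unif hΦ S i le_rfl h3]

/-- The result of `sampleTriple` has law `dataLaw ⊗ T`, whatever the state of the environment when
the program is started. -/
theorem law_sampleTriple (hΦ : SimplexFeatures Φ) (hd : d ≠ 0) {h : ℕ} (S : Memory Φ Υ h) (t : ℕ)
    (s : ℕ × X) : (law M mle (sampleTriple M.a0 S t) s).map Prod.fst =
      triples (S.dataLaw M hΦ t) (M.T t) := by
  have := isProbabilityMeasure_dataLaw (M := M) (hF := S.measurable_feat hΦ) (P := S.plan)
    (Nat.pos_of_ne_zero hd) t
  refine Measure.ext_of_lintegral _ fun g hg => ?_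
  have hg' : Measurable fun z : (X × Fin K × X) × (ℕ × X) => g z.1 := by fun_prop
  rw [lintegral_map hg measurable_fst, Memory.dataLaw, lintegral_triples hg]
  have m1 : MF M mle fun z : X => ((unifAction M.a0 t).bind fun a =>
      (Prog.act a Prog.ret).bind fun x' => Prog.ret (z, a, x') :
      Prog X K (Model Φ Υ) (X × Fin K × X)) :=
    .bind (mf_unifAction M.a0 t) (.bind (.act measurable_snd) (.ret (by fun_prop)))
  have h2 : Measurable fun z : X × (ℕ × X) => ∫⁻ y, g y.1 ∂law M mle
      ((unifAction M.a0 t).bind fun a => (Prog.act a Prog.ret).bind fun x' =>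
        Prog.ret (z.1, a, x') : Prog X K (Model Φ Υ) (X × Fin K × X)) z.2 :=
    (Measure.measurable_lintegral hg').comp m1.meas
  have h3 : Measurable fun p : X × Fin K => ∫⁻ x', g (p.1, p.2, x') ∂M.T t p :=
    Measurable.lintegral_kernel_prod_right (f := fun (p : X × Fin K) x' => g (p.1, p.2, x'))
      (by fun_prop)
  have h4 : ∀ x : X, ∫⁻ y, g y.1 ∂law M mle ((unifAction M.a0 t).bind fun a =>
      (Prog.act a Prog.ret).bind fun x' => Prog.ret (x, a, x') :
        Prog X K (Model Φ Υ) (X × Fin K × X)) (t, x) =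
      ∫⁻ a, ∫⁻ x', g (x, a, x') ∂M.T t (x, a) ∂actionLaw M.a0 t := fun x => by
    rw [lintegral_unifAction_bind]
    refine lintegral_congr fun a => ?_
    have m2 : MF M mle fun x' => (Prog.ret (x, a, x') : Prog X K (Model Φ Υ) (X × Fin K × X)) :=
      .ret (by fun_prop)
    have m3 : Measurable fun z : X × (ℕ × X) => ∫⁻ y, g y.1 ∂law M mle
        (Prog.ret (x, a, z.1) : Prog X K (Model Φ Υ) (X × Fin K × X)) z.2 :=
      (Measure.measurable_lintegral hg').comp m2.meas
    rw [((MF.act (Ω := Unit) (a := fun _ => a) measurable_const).wf ()).lintegral_bind m2 _ hg',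
      lintegral_act a t x m3]
    refine lintegral_congr fun x' => ?_
    rw [law, lintegral_dirac' _ hg']
  rw [sampleTriple, ((mf_explore hΦ hd M.a0 t).wf S).lintegral_bind m1 _ hg']
  cases t with
  | zero =>
    rw [explore, law, law, lintegral_dirac' _ h2, h4, Flambe.dataLaw, lintegral_dirac' _ h3,
      actionLaw, if_pos rfl, lintegral_dirac]
  | succ l =>
    rw [lintegral_explore_succ hΦ S l s h2, Flambe.dataLaw, lintegral_smul_measure,
      lintegral_finsetSum_measure, smul_eq_mul]
    congr 1
    refine Finset.sum_congr rfl fun i _ => ?_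
    simp only [h4]
    rw [← lintegral_occupancy_unif hΦ S i (Nat.le_succ l) h3]
    rfl

end SampleLaw

/-! ### One fitted Q-iteration step -/

section Regression

variable {X : Type u} [MeasurableSpace X] {K d : ℕ} {vol : Measure X}
  {φ φs : Feature X K d} {μ μs : Emission X d} {ν : Measure (X × Fin K)} [IsProbabilityMeasure ν]
  {κ : Kernel (X × Fin K) X} [IsMarkovKernel κ] {V : X → ℝ} {h : ℝ}

theorem integrable_of_mem_Icc (hV : Measurable V) (hVh : ∀ x, V x ∈ Set.Icc 0 h) (P : Measure X)
    [IsProbabilityMeasure P] : Integrable V P :=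
  integrable_of_bound hV (c := h) fun x => by rw [abs_of_nonneg (hVh x).1]; exact (hVh x).2

theorem integral_mem_Icc (hV : Measurable V) (hVh : ∀ x, V x ∈ Set.Icc 0 h) (P : Measure X)
    [IsProbabilityMeasure P] : ∫ x, V x ∂P ∈ Set.Icc 0 h := by
  refine ⟨integral_nonneg fun x => (hVh x).1, ?_⟩
  calc ∫ x, V x ∂P ≤ ∫ _, h ∂P := integral_mono (integrable_of_mem_Icc hV hVh P)
        (integrable_const _) fun x => (hVh x).2
    _ = h := by simp

/-- The mean of `V` under a low rank model is linear in the features. -/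
theorem integral_densityMeasure (hφ : GoodFeature φ) (hμ : GoodEmission vol μ) (hV : Measurable V)
    (hVh : ∀ x, V x ∈ Set.Icc 0 h) (x : X) (a : Fin K) :
    ∫ x', V x' ∂densityMeasure vol φ μ x a =
      ∑ j, (∫ x', V x' ∂emissionMeasure vol μ j) * φ x a j := by
  have h1 := isProbabilityMeasure_densityMeasure hφ hμ x a
  have h2 := hμ.isProbabilityMeasure
  have h3 := lintegral_densityMeasure hφ hμ x a hV.ennreal_ofReal
  have h4 : ∀ (P : Measure X) [IsProbabilityMeasure P],
      ∫⁻ x', ENNReal.ofReal (V x') ∂P = ENNReal.ofReal (∫ x', V x' ∂P) := fun P _ =>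
    (ofReal_integral_eq_lintegral_ofReal (integrable_of_mem_Icc hV hVh P)
      (.of_forall fun x => (hVh x).1)).symm
  simp only [h4] at h3
  have h5 : ∀ j, 0 ≤ ∫ x', V x' ∂emissionMeasure vol μ j := fun j =>
    (integral_mem_Icc hV hVh _).1
  have h6 : ∀ j, ENNReal.ofReal (φ x a j) * ENNReal.ofReal (∫ x', V x' ∂emissionMeasure vol μ j) =
      ENNReal.ofReal ((∫ x', V x' ∂emissionMeasure vol μ j) * φ x a j) := fun j => by
    rw [mul_comm, ENNReal.ofReal_mul (h5 j)]
  simp only [h6] at h3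
  have h7 : ∀ j ∈ Finset.univ, 0 ≤ (∫ x', V x' ∂emissionMeasure vol μ j) * φ x a j := fun j _ =>
    mul_nonneg (h5 j) (hφ.nonneg x a j)
  rw [← ENNReal.ofReal_sum_of_nonneg h7] at h3
  exact (ENNReal.ofReal_eq_ofReal_iff (integral_mem_Icc hV hVh _).1 (Finset.sum_nonneg h7)).mp h3

/-- The means of a function with values in `[0, h]` under two models differ by at most `h` times the
`L¹` distance. -/
theorem ofReal_sq_integral_sub_le (hφ : GoodFeature φ) (hμ : GoodEmission vol μ)
    (hφs : GoodFeature φs) (hμs : GoodEmission vol μs) (hh : 0 < h) (hV : Measurable V)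
    (hVh : ∀ x, V x ∈ Set.Icc 0 h) (x : X) (a : Fin K) :
    ENNReal.ofReal ((∫ x', V x' ∂densityMeasure vol φ μ x a -
      ∫ x', V x' ∂densityMeasure vol φs μs x a) ^ 2) ≤
      ENNReal.ofReal (h ^ 2) * l1Dist vol (density φ μ x a) (density φs μs x a) ^ 2 := by
  have i1 := isProbabilityMeasure_densityMeasure hφ hμ x a
  have i2 := isProbabilityMeasure_densityMeasure hφs hμs x a
  set D := l1Dist vol (density φ μ x a) (density φs μs x a) with hD
  have hsymm : l1Dist vol (density φs μs x a) (density φ μ x a) = D := by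
    simp only [hD, l1Dist, abs_sub_comm]
  rcases eq_or_ne D ⊤ with hT | hT
  · rw [hT]
    have : ENNReal.ofReal (h ^ 2) ≠ 0 := by simp; positivity
    simp [ENNReal.mul_top this]
  have hW : Measurable fun x => ENNReal.ofReal (V x / h) := (hV.div_const h).ennreal_ofReal
  have hW1 : ∀ x, ENNReal.ofReal (V x / h) ≤ 1 := fun x =>
    ENNReal.ofReal_le_one.mpr ((div_le_one hh).mpr (hVh x).2)
  have e : ∀ (P : Measure X) [IsProbabilityMeasure P],
      ∫⁻ x', ENNReal.ofReal (V x' / h) ∂P = ENNReal.ofReal ((∫ x', V x' ∂P) / h) := fun P _ => by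
    rw [← ofReal_integral_eq_lintegral_ofReal ((integrable_of_mem_Icc hV hVh P).div_const h)
      (.of_forall fun x => div_nonneg (hVh x).1 hh.le), integral_div]
  have k1 := lintegral_densityMeasure_le (φ := φ) (φ' := φs) hμ hμs x a hW hW1
  have k2 := lintegral_densityMeasure_le (φ := φs) (φ' := φ) hμs hμ x a hW hW1
  rw [hsymm] at k2
  rw [e, e, ← hD] at k1
  rw [e, e] at k2
  have n1 := (integral_mem_Icc hV hVh (densityMeasure vol φ μ x a)).1
  have n2 := (integral_mem_Icc hV hVh (densityMeasure vol φs μs x a)).1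
  have r1 := ENNReal.toReal_mono (by finiteness) k1
  have r2 := ENNReal.toReal_mono (by finiteness) k2
  rw [ENNReal.toReal_add (by finiteness) hT, ENNReal.toReal_ofReal (by positivity),
    ENNReal.toReal_ofReal (by positivity)] at r1 r2
  rw [← ENNReal.ofReal_toReal hT, ← ENNReal.ofReal_pow ENNReal.toReal_nonneg,
    ← ENNReal.ofReal_mul (by positivity)]
  refine ENNReal.ofReal_le_ofReal ?_
  rw [← mul_pow]
  refine sq_le_sq' ?_ ?_
  · rw [div_le_iff₀ hh, add_mul, div_mul_cancel₀ _ hh.ne'] at r2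
    linarith
  · rw [div_le_iff₀ hh, add_mul, div_mul_cancel₀ _ hh.ne'] at r1
    linarith

/-- The regression of `V(x')` on the learned features: up to the model error, the regression
function is linear in the features, with the weights `∫ V dμ_j`, which lie in the ball of radius `h
√d`. -/
theorem measure_bellman_bad_le [SigmaFinite vol] (hd : 0 < d) (hh : 0 < h) (hφ : GoodFeature φ)
    (hμ : GoodEmission vol μ) (hφs : GoodFeature φs) (hμs : GoodEmission vol μs)
    (hκ : ∀ x a, κ (x, a) = densityMeasure vol φs μs x a) (hV : Measurable V)
    (hVh : ∀ x, V x ∈ Set.Icc 0 h) {ζ : ℝ} (hζ : 0 ≤ ζ)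
    (hmodel : meanHellinger vol ν φ φs μ μs ≤ ENNReal.ofReal (2 * ζ)) (γ : ℝ) {τ : ℝ} (hτ : 0 ≤ τ)
    {n : ℕ} (hn : 0 < n) :
    (Measure.pi fun _ : Fin n => triples ν κ) {D | ¬ ∀ θ : Fin d → ℝ, ∑ i, θ i ^ 2 ≤ h ^ 2 * d →
      (∀ θ' : Fin d → ℝ, ∑ i, θ' i ^ 2 ≤ h ^ 2 * d →
        sqLoss (fun j => (φ (D j).1 (D j).2.1, V (D j).2.2) : Rows d n) θ ≤
          sqLoss (fun j => (φ (D j).1 (D j).2.1, V (D j).2.2) : Rows d n) θ' + n * γ) →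
      ∫⁻ p, ENNReal.ofReal ((∑ j, θ j * φ p.1 p.2 j - ∫ x, V x ∂κ p) ^ 2) ∂ν ≤
        ENNReal.ofReal (8 * h ^ 2 * ζ + γ + 6 * (d : ℝ) ^ 2 * h ^ 2 * τ)} ≤
      ENNReal.ofReal ((d ^ 2 + d) * (2 * Real.exp (-2 * n * τ ^ 2))) := by
  have mb : Measurable fun p => ∫ x, V x ∂κ p :=
    (StronglyMeasurable.integral_kernel hV.stronglyMeasurable).measurable
  have mf := hφ.measurable_coord
  have mf' := hφ.measurable_uncurry
  set f : X × Fin K × X → Fin d → ℝ := fun z => φ z.1 z.2.1 with hf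
  set y : X × Fin K × X → ℝ := fun z => V z.2.2 with hy
  set g : X × Fin K × X → ℝ := fun z => ∫ x, V x ∂κ (z.1, z.2.1) with hg
  have mF : Measurable f := mf'.comp (f := fun z : X × Fin K × X => (z.1, z.2.1)) (by fun_prop)
  have mg : Measurable g := mb.comp (f := fun z : X × Fin K × X => (z.1, z.2.1)) (by fun_prop)
  have my : Measurable y := by fun_prop
  have hgh : ∀ z, g z ∈ Set.Icc 0 h := fun z => integral_mem_Icc hV hVh _
  -- The residual of the conditional mean `g` is orthogonal to functions of the features.
  have horth : ∀ θ : Fin d → ℝ,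
      ∫ z, (∑ i, θ i * f z i - g z) * (y z - g z) ∂triples ν κ = 0 := fun θ => by
    have mA : Measurable fun p : X × Fin K => ∑ i, θ i * φ p.1 p.2 i - ∫ x, V x ∂κ p := by
      fun_prop
    have mint : Measurable fun z : (X × Fin K) × X =>
        (∑ i, θ i * φ z.1.1 z.1.2 i - ∫ x, V x ∂κ z.1) * (V z.2 - ∫ x, V x ∂κ z.1) :=
      (mA.comp measurable_fst).mul
        ((hV.comp measurable_snd).sub (mb.comp measurable_fst))
    have hint : Integrable (fun z : (X × Fin K) × X =>
        (∑ i, θ i * φ z.1.1 z.1.2 i - ∫ x, V x ∂κ z.1) * (V z.2 - ∫ x, V x ∂κ z.1))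
        (ν ⊗ₘ κ) := by
      refine integrable_of_bound mint (c := (∑ i, |θ i| + h) * h) fun z => ?_
      rw [abs_mul]
      have b1 := integral_mem_Icc hV hVh (κ z.1)
      refine mul_le_mul ((abs_sub _ _).trans (add_le_add ?_ ?_)) ?_ (abs_nonneg _) (by positivity)
      · refine (Finset.abs_sum_le_sum_abs _ _).trans (Finset.sum_le_sum fun i _ => ?_)
        rw [abs_mul, abs_of_nonneg (hφ.nonneg _ _ _)]
        exact mul_le_of_le_one_right (abs_nonneg _) (hφ.le_one _ _ _)
      · rw [abs_of_nonneg b1.1]; exact b1.2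
      · exact abs_sub_le_iff.mpr ⟨by linarith [(hVh z.2).2, b1.1], by linarith [(hVh z.2).1, b1.2]⟩
    rw [triples, integral_map (by fun_prop)]
    · rw [show (fun z : (X × Fin K) × X => (∑ i, θ i * f (z.1.1, z.1.2, z.2) i -
          g (z.1.1, z.1.2, z.2)) * (y (z.1.1, z.1.2, z.2) - g (z.1.1, z.1.2, z.2))) =
          fun z => (∑ i, θ i * φ z.1.1 z.1.2 i - ∫ x, V x ∂κ z.1) * (V z.2 - ∫ x, V x ∂κ z.1)
        from rfl, Measure.integral_compProd hint]
      refine (integral_congr_ae (.of_forall fun p => ?_)).trans (integral_zero _ _)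
      change ∫ x', (∑ i, θ i * φ p.1 p.2 i - ∫ x, V x ∂κ p) * (V x' - ∫ x, V x ∂κ p) ∂κ p = 0
      rw [integral_const_mul, integral_sub (integrable_of_mem_Icc hV hVh _) (integrable_const _)]
      simp
    · have m3 : Measurable fun z => ∑ i, θ i * f z i - g z := by fun_prop
      exact (m3.mul (my.sub mg)).aestronglyMeasurable
  -- The competitor is the regression function of the learned model.
  set θ₀ : Fin d → ℝ := fun j => ∫ x', V x' ∂emissionMeasure vol μ j with hθ₀
  have hθ₀b : ∀ j, θ₀ j ∈ Set.Icc 0 h := fun j => by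
    have := hμ.isProbabilityMeasure j
    exact integral_mem_Icc hV hVh _
  have hball : ∑ i, θ₀ i ^ 2 ≤ h ^ 2 * d := by
    calc ∑ i, θ₀ i ^ 2 ≤ ∑ _i : Fin d, h ^ 2 := Finset.sum_le_sum fun i _ =>
          pow_le_pow_left₀ (hθ₀b i).1 (hθ₀b i).2 2
      _ = h ^ 2 * d := by simp [mul_comm]
  -- Integrals over triples of functions of the first two components are integrals against `ν`.
  have hred : ∀ θ : Fin d → ℝ, ENNReal.ofReal (∫ z, (∑ i, θ i * f z i - g z) ^ 2 ∂triples ν κ) =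
      ∫⁻ p, ENNReal.ofReal ((∑ j, θ j * φ p.1 p.2 j - ∫ x, V x ∂κ p) ^ 2) ∂ν := fun θ => by
    have m3 : Measurable fun z => ∑ i, θ i * f z i - g z := by fun_prop
    rw [ofReal_integral_eq_lintegral_ofReal, lintegral_triples (by fun_prop)]
    · refine lintegral_congr fun p => ?_
      simp [hf, hg]
    · refine integrable_of_bound (m3.pow_const 2) (c := (∑ i, |θ i| + h) ^ 2) fun z => ?_
      rw [abs_pow]
      refine pow_le_pow_left₀ (abs_nonneg _) ((abs_sub _ _).trans (add_le_add ?_ ?_)) 2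
      · refine (Finset.abs_sum_le_sum_abs _ _).trans (Finset.sum_le_sum fun i _ => ?_)
        rw [abs_mul, abs_of_nonneg (hφ.nonneg _ _ _)]
        exact mul_le_of_le_one_right (abs_nonneg _) (hφ.le_one _ _ _)
      · rw [abs_of_nonneg (hgh z).1]; exact (hgh z).2
    · exact .of_forall fun z => sq_nonneg _
  have hbias : ∫ z, (∑ i, θ₀ i * f z i - g z) ^ 2 ∂triples ν κ ≤ 8 * h ^ 2 * ζ := by
    rw [← ENNReal.ofReal_le_ofReal_iff (by positivity), hred]
    have mD := measurable_sqHellinger hφ hμ hφs hμs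
    calc ∫⁻ p, ENNReal.ofReal ((∑ j, θ₀ j * φ p.1 p.2 j - ∫ x, V x ∂κ p) ^ 2) ∂ν
        ≤ ∫⁻ p, ENNReal.ofReal (h ^ 2) * (4 *
            sqHellinger vol (density φ μ p.1 p.2) (density φs μs p.1 p.2)) ∂ν := by
          refine lintegral_mono fun p => ?_
          rw [show κ p = densityMeasure vol φs μs p.1 p.2 from hκ p.1 p.2,
            ← integral_densityMeasure hφ hμ hV hVh]
          refine (ofReal_sq_integral_sub_le hφ hμ hφs hμs hh hV hVh p.1 p.2).trans ?_
          gcongr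
          exact l1Dist_sq_le (measurable_density_right hμ _ _) (measurable_density_right hμs _ _)
            (density_nonneg hφ hμ _ _) (density_nonneg hφs hμs _ _) (lintegral_density hφ hμ _ _)
            (lintegral_density hφs hμs _ _)
      _ = ENNReal.ofReal (h ^ 2) * (4 * meanHellinger vol ν φ φs μ μs) := by
          rw [lintegral_const_mul _ (by fun_prop), lintegral_const_mul _ (by fun_prop),
            meanHellinger]
      _ ≤ ENNReal.ofReal (h ^ 2) * (ENNReal.ofReal 4 * ENNReal.ofReal (2 * ζ)) := by
          gcongr
          simp
      _ = ENNReal.ofReal (8 * h ^ 2 * ζ) := by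
          rw [← ENNReal.ofReal_mul (by norm_num), ← ENNReal.ofReal_mul (by positivity)]
          congr 1; ring
  refine le_trans (measure_mono ?_) (measure_regression_bad_le (ν := triples ν κ) hd hh mF
    (fun z i => ⟨hφ.nonneg _ _ _, hφ.le_one _ _ _⟩) my (fun z => hVh _) mg hgh horth hball γ hτ hn)
  intro D hD hgood
  refine hD fun θ hθ hgap => ?_
  rw [← hred]
  refine ENNReal.ofReal_le_ofReal ((hgood θ hθ (hgap θ₀ hball)).trans ?_)
  linarith

end Regression

/-! ### Regression errors as functions of the memory -/

section RegressionError

open Prog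

variable {X : Type u} [MeasurableSpace X] {K d : ℕ} {vol : Measure X}
  {Φ : Finset (Feature X K d)} {Υ : Finset (Emission X d)} {M : MDP X K} {h : ℕ}

theorem triples_map_pair (ν : Measure (X × Fin K)) [IsProbabilityMeasure ν]
    (κ : Kernel (X × Fin K) X) [IsMarkovKernel κ] :
    (triples ν κ).map (fun z => (z.1, z.2.1)) = ν := by
  refine Measure.ext_of_lintegral _ fun f hf => ?_
  rw [lintegral_map hf (by fun_prop), lintegral_triples (by fun_prop)]
  simp

theorem Memory.isProbabilityMeasure_dataLaw (hΦ : SimplexFeatures Φ) (hd : d ≠ 0)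
    (S : Memory Φ Υ h) (t : ℕ) : IsProbabilityMeasure (S.dataLaw M hΦ t) :=
  Flambe.isProbabilityMeasure_dataLaw (Nat.pos_of_ne_zero hd) t

/-- The law of the data depends measurably on the memory, because it is the law of the result of a
program. -/
theorem Memory.measurable_dataLaw (mle : ∀ n, Dataset X K n → Model Φ Υ) (hΦ : SimplexFeatures Φ)
    (hd : d ≠ 0) (t : ℕ) : Measurable fun S : Memory Φ Υ h => S.dataLaw M hΦ t := by
  have h1 : ∀ S : Memory Φ Υ h, S.dataLaw M hΦ t =
      (law M mle (sampleTriple M.a0 S t) (0, M.x0)).map fun z => (z.1.1, z.1.2.1) := fun S => by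
    have := S.isProbabilityMeasure_dataLaw (M := M) hΦ hd t
    rw [← triples_map_pair (S.dataLaw M hΦ t) (M.T t), ← law_sampleTriple (mle := mle) hΦ hd S t
      (0, M.x0), Measure.map_map (by fun_prop) measurable_fst]
    rfl
  simp only [h1]
  exact (Measure.measurable_map _ (by fun_prop)).comp ((mf_sampleTriple hΦ hd M.a0 t).meas.comp
    (f := fun S : Memory Φ Υ h => (S, (0, M.x0))) (by fun_prop))

/-- The mean squared error of the regression at time `t` for planning horizon `l` and reward
coordinate `i`, with weights `θ` at time `t` and `θ'` at time `t + 1`. -/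
noncomputable def Memory.regressionError (M : MDP X K) (hΦ : SimplexFeatures Φ) (S : Memory Φ Υ h)
    (l : ℕ) (i : Fin d) (t : ℕ) (θ θ' : Fin d → ℝ) : ℝ≥0∞ :=
  ∫⁻ p, ENNReal.ofReal (bellmanError M (S.feat t) (S.feat (t + 1)) l i t θ θ' p ^ 2)
    ∂S.dataLaw M hΦ t

theorem Memory.measurable_feat_comp {Ω : Type*} [MeasurableSpace Ω] (hΦ : SimplexFeatures Φ)
    {S : Ω → Memory Φ Υ h} {x : Ω → X} {a : Ω → Fin K} (hS : Measurable S) (hx : Measurable x)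
    (ha : Measurable a) (t : ℕ) : Measurable fun ω => (S ω).feat t (x ω) (a ω) := by
  have h1 : Measurable fun z : (Memory Φ Υ h × X) × Fin K => z.1.1.feat t z.1.2 z.2 :=
    measurable_from_prod_countable_left fun a => Memory.measurable_feat_uncurry hΦ t a
  exact h1.comp (f := fun ω => ((S ω, x ω), a ω)) (by fun_prop)

theorem Memory.measurable_regressionError {Ω : Type*} [MeasurableSpace Ω]
    (mle : ∀ n, Dataset X K n → Model Φ Υ) (hΦ : SimplexFeatures Φ) (hd : d ≠ 0)
    {S : Ω → Memory Φ Υ h} {θ θ' : Ω → Fin d → ℝ} (hS : Measurable S) (hθ : Measurable θ)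
    (hθ' : Measurable θ') (l : ℕ) (i : Fin d) (t : ℕ) :
    Measurable fun ω => (S ω).regressionError M hΦ l i t (θ ω) (θ' ω) := by
  let κ : Kernel Ω (X × Fin K) :=
    ⟨fun ω => (S ω).dataLaw M hΦ t, (Memory.measurable_dataLaw mle hΦ hd t).comp hS⟩
  have : IsMarkovKernel κ := ⟨fun ω => (S ω).isProbabilityMeasure_dataLaw hΦ hd t⟩
  have h1 : Measurable fun z : Ω × (X × Fin K) => (S z.1).feat t z.2.1 z.2.2 :=
    Memory.measurable_feat_comp hΦ (by fun_prop) (by fun_prop) (by fun_prop) t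
  have h2 : Measurable fun z : Ω × (X × Fin K) =>
      ∫ x, planValue M.a0 ((S z.1).feat (t + 1)) l i (t + 1) (θ' z.1) x ∂M.T t z.2 := by
    have h3 : Measurable fun y : (Ω × (X × Fin K)) × X =>
        planValue M.a0 ((S y.1.1).feat (t + 1)) l i (t + 1) (θ' y.1.1) y.2 :=
      measurable_planValue M.a0 (φ := fun y : (Ω × (X × Fin K)) × X => (S y.1.1).feat (t + 1))
        (x := fun y => y.2) (θ := fun y => θ' y.1.1)
        (fun a => Memory.measurable_feat_comp hΦ (by fun_prop) (by fun_prop) (by fun_prop) _)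
        (by fun_prop) l i (t + 1)
    exact (StronglyMeasurable.integral_kernel_prod_right (κ := (M.T t).comap
      (fun z : Ω × (X × Fin K) => z.2) measurable_snd)
      (f := fun z x => planValue M.a0 ((S z.1).feat (t + 1)) l i (t + 1) (θ' z.1) x)
      h3.stronglyMeasurable).measurable
  refine Measurable.lintegral_kernel_prod_right (κ := κ) (f := fun ω p =>
    ENNReal.ofReal (bellmanError M ((S ω).feat t) ((S ω).feat (t + 1)) l i t (θ ω) (θ' ω) p ^ 2)) ?_
  have h4 : Measurable fun z : Ω × (X × Fin K) =>
      bellmanError M ((S z.1).feat t) ((S z.1).feat (t + 1)) l i t (θ z.1) (θ' z.1) z.2 := by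
    refine Measurable.sub (Finset.measurable_sum _ fun j _ => ?_) h2
    have := (measurable_pi_apply j).comp h1
    have h5 : Measurable fun z : Ω × (X × Fin K) => θ z.1 j := by fun_prop
    exact h5.mul this
  exact (h4.pow_const 2).ennreal_ofReal

theorem Memory.dataLaw_snoc (hΦ : SimplexFeatures Φ) (S : Memory Φ Υ h) (m : Model Φ Υ)
    (plan : Plan d) {t : ℕ} (ht : t ≤ h) :
    (S.snoc m plan).dataLaw M hΦ t = S.dataLaw M hΦ t :=
  dataLaw_congr (fun _ hs => S.feat_snoc m plan (by omega))
    fun _ hs => S.plan_snoc m plan (by omega)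

/-- At the last time before the planning horizon, the regression target is `0`, so that the features
of the next time do not matter. -/
theorem Memory.regressionError_snoc (hΦ : SimplexFeatures Φ) (S : Memory Φ Υ h) (m : Model Φ Υ)
    (plan : Plan d) {l t : ℕ} (hl : l ≤ h) (ht : t < l) (i : Fin d) (θ θ' : Fin d → ℝ) :
    (S.snoc m plan).regressionError M hΦ l i t θ θ' = S.regressionError M hΦ l i t θ θ' := by
  rw [Memory.regressionError, Memory.regressionError, S.dataLaw_snoc hΦ m plan (by omega),
    S.feat_snoc m plan (by omega)]
  refine lintegral_congr fun p => ?_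
  rcases eq_or_ne (t + 1) l with h1 | h1
  · simp only [bellmanError, planValue, if_pos h1]
  · rw [S.feat_snoc m plan (by omega)]

/-- The memories for which all models are accurate on the data of their time step, and all
regressions of the planner have a small mean squared error. -/
def goodMemory (vol : Measure X) (M : MDP X K) (Υ : Finset (Emission X d)) (hΦ : SimplexFeatures Φ)
    (φs : ℕ → Feature X K d) (μs : ℕ → Emission X d) (ζ ρ : ℝ) (h : ℕ) : Set (Memory Φ Υ h) :=
  {S | (∀ t : Fin h, meanHellinger vol (S.dataLaw M hΦ t) (S.1 t).phi (φs t) (S.1 t).mu (μs t) ≤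
      ENNReal.ofReal (2 * ζ)) ∧
    ∀ l < h, ∀ i t, t < l →
      S.regressionError M hΦ l i t (S.plan l i t) (S.plan l i (t + 1)) ≤ ENNReal.ofReal ρ}

variable {φs : ℕ → Feature X K d} {μs : ℕ → Emission X d} {ζ ρ : ℝ}

theorem measurableSet_goodMemory [SigmaFinite vol] (mle : ∀ n, Dataset X K n → Model Φ Υ)
    (hΦ : SimplexFeatures Φ) (hΥ : DensityEmissions vol Υ) (hd : d ≠ 0)
    (hs : ∀ t < h, φs t ∈ Φ ∧ μs t ∈ Υ) :
    MeasurableSet (goodMemory vol M Υ hΦ φs μs ζ ρ h) := by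
  have h1 : ∀ t : Fin h, Measurable fun S : Memory Φ Υ h =>
      meanHellinger vol (S.dataLaw M hΦ t) (S.1 t).phi (φs t) (S.1 t).mu (μs t) := fun t => by
    have h2 : Measurable fun z : Model Φ Υ × Memory Φ Υ h =>
        meanHellinger vol (z.2.dataLaw M hΦ t) z.1.phi (φs t) z.1.mu (μs t) :=
      measurable_from_prod_countable_right fun m => (Measure.measurable_lintegral
        (measurable_sqHellinger (m.goodFeature hΦ) (m.goodEmission hΥ)
          (goodFeature_of_mem hΦ (hs t t.2).1) (goodEmission_of_mem hΥ (hs t t.2).2))).comp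
        (Memory.measurable_dataLaw mle hΦ hd t)
    exact h2.comp (f := fun S : Memory Φ Υ h => (S.1 t, S)) (by fun_prop)
  have h3 : ∀ l (i : Fin d) t, Measurable fun S : Memory Φ Υ h =>
      S.regressionError M hΦ l i t (S.plan l i t) (S.plan l i (t + 1)) := fun l i t => by
    have := Memory.measurable_plan (Φ := Φ) (Υ := Υ) (h := h) l
    exact Memory.measurable_regressionError mle hΦ hd measurable_id (by fun_prop) (by fun_prop)
      l i t
  have h4 : goodMemory vol M Υ hΦ φs μs ζ ρ h =
      (⋂ t : Fin h, {S : Memory Φ Υ h | meanHellinger vol (S.dataLaw M hΦ t) (S.1 t).phi (φs t)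
        (S.1 t).mu (μs t) ≤ ENNReal.ofReal (2 * ζ)}) ∩
      ⋂ (l : ℕ) (_ : l < h) (i : Fin d) (t : ℕ) (_ : t < l), {S : Memory Φ Υ h |
        S.regressionError M hΦ l i t (S.plan l i t) (S.plan l i (t + 1)) ≤ ENNReal.ofReal ρ} := by
    ext S; simp [goodMemory]
  rw [h4]
  refine (MeasurableSet.iInter fun t => measurableSet_le (h1 t) measurable_const).inter ?_
  exact MeasurableSet.iInter fun l => MeasurableSet.iInter fun _ => MeasurableSet.iInter fun i =>
    MeasurableSet.iInter fun t => MeasurableSet.iInter fun _ =>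
      measurableSet_le (h3 l i t) measurable_const

/-- A stage only adds to the memory, and what was known before remains true: the data of a time step
and the regression errors depend only on earlier entries. -/
theorem snoc_mem_goodMemory {hΦ : SimplexFeatures Φ} {S : Memory Φ Υ h}
    (hS : S ∈ goodMemory vol M Υ hΦ φs μs ζ ρ h) {m : Model Φ Υ} {plan : Plan d}
    (hm : meanHellinger vol (S.dataLaw M hΦ h) m.phi (φs h) m.mu (μs h) ≤ ENNReal.ofReal (2 * ζ))
    (hp : ∀ i, ∀ t < h, S.regressionError M hΦ h i t (plan i t) (plan i (t + 1)) ≤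
      ENNReal.ofReal ρ) :
    S.snoc m plan ∈ goodMemory vol M Υ hΦ φs μs ζ ρ (h + 1) := by
  refine ⟨fun t => ?_, fun l hl i t ht => ?_⟩
  · rw [S.dataLaw_snoc hΦ m plan (by omega)]
    refine Fin.lastCases ?_ (fun t => ?_) t
    · have : (S.snoc m plan).1 (Fin.last h) = m :=
        Fin.snoc_last (α := fun _ => Model Φ Υ) m S.1
      rw [this]
      exact hm
    · have : (S.snoc m plan).1 t.castSucc = S.1 t :=
        Fin.snoc_castSucc (α := fun _ => Model Φ Υ) m S.1 t
      rw [this]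
      exact hS.1 t
  · rw [S.regressionError_snoc hΦ m plan (by omega) ht]
    rcases Nat.lt_succ_iff_lt_or_eq.mp hl with hl | rfl
    · rw [S.plan_snoc m plan hl]
      exact hS.2 l hl i t ht
    · rw [S.plan_snoc_last m plan]
      exact hp i t ht

end RegressionError

/-! ### Analysis of the planner -/

section Planner

open Prog

variable {X : Type u} {K d : ℕ} {Φ : Finset (Feature X K d)} {Υ : Finset (Emission X d)} {h : ℕ}

/-- The regression data computed from a dataset in the iteration for time `t`. -/
noncomputable def fqiRows (a0 : Fin K) {n : ℕ} (S : Memory Φ Υ h) (i : Fin d) (t : ℕ)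
    (θ : Fin d → ℝ) (D : Dataset X K n) : Rows d n :=
  fun j => (S.feat t (D j).1 (D j).2.1, planValue a0 (S.feat (t + 1)) h i (t + 1) θ (D j).2.2)

/-- The part of an iteration of Linear-FQI that follows the collection of the data. -/
noncomputable def fqiFit (ls : LSRoutine X K (Model Φ Υ) d) (a0 : Fin K) {n : ℕ}
    (S : Memory Φ Υ h) (i : Fin d) (t : ℕ) (θ : ℕ → Fin d → ℝ) (D : Dataset X K n) :
    Prog X K (Model Φ Υ) (ℕ → Fin d → ℝ) :=
  (Prog.collect n fun j =>
    (Prog.feature (S.feat t) (D j).1 (D j).2.1).bind fun f =>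
    (if t + 1 = h then Prog.ret 0
      else value a0 (S.feat (t + 1)) h i (t + 1) (θ (t + 1)) (D j).2.2).bind fun y =>
    Prog.ret (f, y)).bind fun rows =>
  (ls n (h * Real.sqrt d) rows).bind fun θt => Prog.ret (Function.update θ t θt)

/-- One iteration of Linear-FQI. -/
noncomputable def fqiIter (ls : LSRoutine X K (Model Φ Υ) d) (a0 : Fin K) (n : ℕ)
    (S : Memory Φ Υ h) (i : Fin d) (t : ℕ) (θ : ℕ → Fin d → ℝ) :
    Prog X K (Model Φ Υ) (ℕ → Fin d → ℝ) :=
  (Prog.collect n fun _ => sampleTriple a0 S t).bind fun D => fqiFit ls a0 S i t θ D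

theorem linearFQI_eq_loop (ls : LSRoutine X K (Model Φ Υ) d) (a0 : Fin K) (n : ℕ)
    (S : Memory Φ Υ h) (i : Fin d) :
    linearFQI ls a0 n S i = Prog.loop h (fun k θ => fqiIter ls a0 n S i (h - 1 - k) θ) 0 := rfl

variable {ls : LSRoutine X K (Model Φ Υ) d} {sol : ∀ n : ℕ, ℝ → Rows d n → Fin d → ℝ}
  {γ : ℝ → ℝ}

theorem evals_fqiFit (hls : SolvesLS ls sol γ) (a0 : Fin K) {n : ℕ} (S : Memory Φ Υ h) (i : Fin d)
    (t : ℕ) (θ : ℕ → Fin d → ℝ) (D : Dataset X K n) : Evals (fqiFit ls a0 S i t θ D)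
      (Function.update θ t (sol n (h * √d) (fqiRows a0 S i t (θ (t + 1)) D))) := by
  refine Evals.bind (r := fqiRows a0 S i t (θ (t + 1)) D) (.collect fun j => ?_)
    ((hls.evals _ _ _).bind (.ret _))
  refine (Evals.feature _ _ _).bind (Evals.bind
    (r := planValue a0 (S.feat (t + 1)) h i (t + 1) (θ (t + 1)) (D j).2.2) ?_ (.ret _))
  unfold planValue
  split_ifs
  · exact .ret _
  · exact evals_value _ _ _ _ _ _ _

variable [MeasurableSpace X] {vol : Measure X} {M : MDP X K}
  {mle : ∀ n, Dataset X K n → Model Φ Υ}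

theorem measurable_update_apply {α : Type*} [MeasurableSpace α] (t : ℕ) :
    Measurable fun z : (ℕ → α) × α => Function.update z.1 t z.2 := by
  refine measurable_pi_lambda _ fun s => ?_
  rcases eq_or_ne s t with rfl | hs
  · simpa using measurable_snd
  · simp only [Function.update_of_ne hs]; fun_prop

theorem measurable_fqiRows {Ω : Type*} [MeasurableSpace Ω] (hΦ : SimplexFeatures Φ) (a0 : Fin K)
    {n : ℕ} {S : Ω → Memory Φ Υ h} {θ : Ω → Fin d → ℝ} {D : Ω → Dataset X K n} (hS : Measurable S)
    (hθ : Measurable θ) (hD : Measurable D) (i : Fin d) (t : ℕ) :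
    Measurable fun ω => fqiRows a0 (S ω) i t (θ ω) (D ω) := by
  refine measurable_pi_lambda _ fun j => Measurable.prodMk ?_ ?_
  · exact Memory.measurable_feat_comp hΦ hS (by fun_prop) (by fun_prop) t
  · exact measurable_planValue a0 (φ := fun ω => (S ω).feat (t + 1)) (x := fun ω => (D ω j).2.2)
      (fun a => Memory.measurable_feat_comp hΦ hS (by fun_prop) (by fun_prop) _) hθ h i (t + 1)

theorem mf_fqiIter (hΦ : SimplexFeatures Φ) (hd : d ≠ 0) (hls : SolvesLS ls sol γ) (a0 : Fin K)
    (n : ℕ) (i : Fin d) (t : ℕ) :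
    MF M mle fun z : Memory Φ Υ h × (ℕ → Fin d → ℝ) => fqiIter ls a0 n z.1 i t z.2 := by
  refine .bind (.collect fun _ => (mf_sampleTriple hΦ hd a0 t).comp measurable_fst)
    (.of_evals (fun z => evals_fqiFit hls a0 z.1.1 i t z.1.2 z.2) ?_)
  refine (measurable_update_apply t).comp (f := fun z : (Memory Φ Υ h × (ℕ → Fin d → ℝ)) ×
    Dataset X K n => (z.1.2, sol n (h * √d) (fqiRows a0 z.1.1 i t (z.1.2 (t + 1)) z.2))) ?_
  refine Measurable.prodMk (by fun_prop) ((hls.meas n _).comp ?_)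
  exact measurable_fqiRows hΦ a0 (by fun_prop) (by fun_prop) (by fun_prop) i t

theorem mf_linearFQI (hΦ : SimplexFeatures Φ) (hd : d ≠ 0) (hls : SolvesLS ls sol γ) (a0 : Fin K)
    (n : ℕ) (i : Fin d) : MF M mle fun S : Memory Φ Υ h => linearFQI ls a0 n S i := by
  simp only [linearFQI_eq_loop]
  exact .loop (f := fun (S : Memory Φ Υ h) k θ => fqiIter ls a0 n S i (h - 1 - k) θ)
    (fun k => mf_fqiIter hΦ hd hls a0 n i _) measurable_const

/-- The weight vectors of the times `t, …, h-1` have small regression errors. -/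
def goodWeights (M : MDP X K) (hΦ : SimplexFeatures Φ) (S : Memory Φ Υ h) (i : Fin d) (ρ : ℝ)
    (t : ℕ) : Set (ℕ → Fin d → ℝ) :=
  {θ | ∀ s, t ≤ s → s < h →
    S.regressionError M hΦ h i s (θ s) (θ (s + 1)) ≤ ENNReal.ofReal ρ}

theorem measurableSet_goodWeights (mle : ∀ n, Dataset X K n → Model Φ Υ) (hΦ : SimplexFeatures Φ)
    (hd : d ≠ 0) (S : Memory Φ Υ h) (i : Fin d) (ρ : ℝ) (t : ℕ) :
    MeasurableSet (goodWeights M hΦ S i ρ t) := by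
  have h1 : goodWeights M hΦ S i ρ t = ⋂ (s : ℕ) (_ : t ≤ s) (_ : s < h), {θ : ℕ → Fin d → ℝ |
      S.regressionError M hΦ h i s (θ s) (θ (s + 1)) ≤ ENNReal.ofReal ρ} := by
    ext; simp [goodWeights]
  rw [h1]
  exact MeasurableSet.iInter fun s => MeasurableSet.iInter fun _ => MeasurableSet.iInter fun _ =>
    measurableSet_le (Memory.measurable_regressionError mle hΦ hd measurable_const
      (by fun_prop) (by fun_prop) h i s) measurable_const

variable {φs : ℕ → Feature X K d} {μs : ℕ → Emission X d} {ζ τ ρ : ℝ}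

/-- An iteration of Linear-FQI extends the range of times with small regression errors by one. -/
theorem fail_fqiIter [SigmaFinite vol] (hΦ : SimplexFeatures Φ) (hΥ : DensityEmissions vol Υ)
    (hd : d ≠ 0) (hls : SolvesLS ls sol γ) {n : ℕ} (hn : 0 < n) (hζ : 0 ≤ ζ) (hτ : 0 ≤ τ)
    (S : Memory Φ Υ h) (i : Fin d) {t : ℕ} (ht : t < h) (hs : φs t ∈ Φ ∧ μs t ∈ Υ)
    (hκ : ∀ x a, M.T t (x, a) = densityMeasure vol (φs t) (μs t) x a)
    (hmodel : meanHellinger vol (S.dataLaw M hΦ t) (S.1 ⟨t, ht⟩).phi (φs t) (S.1 ⟨t, ht⟩).mu (μs t)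
      ≤ ENNReal.ofReal (2 * ζ))
    (hρ : 8 * (h : ℝ) ^ 2 * ζ + γ (h * √d) + 6 * (d : ℝ) ^ 2 * (h : ℝ) ^ 2 * τ ≤ ρ)
    {θ : ℕ → Fin d → ℝ} (hθ : θ ∈ goodWeights M hΦ S i ρ (t + 1)) :
    Fail M mle (fqiIter ls M.a0 n S i t θ) (goodWeights M hΦ S i ρ t)
      (ENNReal.ofReal ((d ^ 2 + d) * (2 * Real.exp (-2 * n * τ ^ 2)))) := by
  have hh : (0 : ℝ) < h := by exact_mod_cast (Nat.zero_le t).trans_lt ht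
  have hB : (0 : ℝ) ≤ h * √d := by positivity
  have hB2 : ((h : ℝ) * √d) ^ 2 = h ^ 2 * d := by
    rw [mul_pow, Real.sq_sqrt d.cast_nonneg]
  have hfeat : S.feat t = (S.1 ⟨t, ht⟩).phi := by rw [Memory.feat, dif_pos ht]
  have hgood : GoodFeature (S.feat t) := S.goodFeature_feat hΦ ht
  have hν := S.isProbabilityMeasure_dataLaw (M := M) hΦ hd t
  set V : X → ℝ := planValue M.a0 (S.feat (t + 1)) h i (t + 1) (θ (t + 1)) with hV
  have mV : Measurable V := measurable_planValue_right (M := M) (S.measurable_feat hΦ) (t + 1)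
  have msamp : MF M mle fun _ : Unit => sampleTriple M.a0 S t :=
    (mf_sampleTriple hΦ hd M.a0 t).comp (g := fun _ => S) measurable_const
  have hset := measurableSet_goodWeights (M := M) mle hΦ hd S i ρ t
  set Q : Set (Dataset X K n) := {D | Function.update θ t (sol n (h * √d)
    (fqiRows M.a0 S i t (θ (t + 1)) D)) ∈ goodWeights M hΦ S i ρ t} with hQ
  have mfit : Measurable fun D : Dataset X K n => Function.update θ t (sol n (h * √d)
      (fqiRows M.a0 S i t (θ (t + 1)) D)) :=
    (measurable_update_apply t).comp (f := fun D => (θ, sol n (h * √d)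
      (fqiRows M.a0 S i t (θ (t + 1)) D))) (measurable_const.prodMk ((hls.meas n _).comp
      (measurable_fqiRows hΦ M.a0 measurable_const measurable_const measurable_id i t)))
  have mQ : MeasurableSet Q := mfit hset
  have hcollect : Fail M mle (Prog.collect n fun _ => sampleTriple M.a0 S t) Q
      (ENNReal.ofReal ((d ^ 2 + d) * (2 * Real.exp (-2 * n * τ ^ 2)))) := fun s => by
    have h1 : Prog.law M mle (Prog.collect n fun _ => sampleTriple M.a0 S t) s {z | z.1 ∉ Q} =
        (Measure.pi fun _ : Fin n => triples (S.dataLaw M hΦ t) (M.T t)) Qᶜ := by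
      rw [← law_collect_iid msamp (law_sampleTriple hΦ hd S t) n s,
        Measure.map_apply measurable_fst mQ.compl]
      rfl
    rw [h1]
    have hpos : 0 < d := Nat.pos_of_ne_zero hd
    refine (measure_mono ?_).trans (measure_bellman_bad_le (vol := vol) (φ := S.feat t)
      (μ := (S.1 ⟨t, ht⟩).mu) (φs := φs t) (μs := μs t) (V := V) hpos hh hgood
      ((S.1 ⟨t, ht⟩).goodEmission hΥ) (goodFeature_of_mem hΦ hs.1) (goodEmission_of_mem hΥ hs.2) hκ
      mV (fun x => planValue_mem _ _ _ _ _ _ x) hζ (by rw [hfeat]; exact hmodel)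
      (γ (h * √d)) hτ hn)
    intro D hD hD'
    refine hD fun s hs1 hs2 => ?_
    have hrow : ∀ j, ∑ i', (fqiRows M.a0 S i t (θ (t + 1)) D j).1 i' ^ 2 ≤ 1 := fun j =>
      hgood.sum_sq_le _ _
    -- Only the weights of time `t` are new; those of later times, and their targets, are unchanged.
    rcases eq_or_lt_of_le hs1 with rfl | hlt
    · rw [Function.update_self, Function.update_of_ne (by omega), Memory.regressionError]
      refine (hD' _ (by rw [← hB2]; exact hls.ball n _ hB _ hrow) fun θ' hθ' =>
        hls.gap n _ hB _ hrow θ' (by rw [hB2]; exact hθ')).trans (ENNReal.ofReal_le_ofReal hρ)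
    · rw [Function.update_of_ne (by omega), Function.update_of_ne (by omega)]
      exact hθ s hlt hs2
  have h2 := Fail.bind hcollect (Q' := goodWeights M hΦ S i ρ t) (δ' := 0)
    (f := fun D => fqiFit ls M.a0 S i t θ D)
    (fun D hD => (evals_fqiFit hls M.a0 S i t θ D).fail hD hset)
    ((MF.collect (f := fun _ _ => sampleTriple M.a0 S t) fun _ => msamp).wf ())
    (.of_evals (fun D => evals_fqiFit hls M.a0 S i t θ D) mfit) mQ hset
  rwa [add_zero] at h2

theorem fail_linearFQI [SigmaFinite vol] (hΦ : SimplexFeatures Φ) (hΥ : DensityEmissions vol Υ)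
    (hd : d ≠ 0) (hls : SolvesLS ls sol γ) {n : ℕ} (hn : 0 < n) (hζ : 0 ≤ ζ) (hτ : 0 ≤ τ)
    (hs : ∀ t < h, φs t ∈ Φ ∧ μs t ∈ Υ) (hfac : Factorizes vol M h φs μs) (S : Memory Φ Υ h)
    (hmodel : ∀ t : Fin h, meanHellinger vol (S.dataLaw M hΦ t) (S.1 t).phi (φs t) (S.1 t).mu
      (μs t) ≤ ENNReal.ofReal (2 * ζ))
    (hρ : 8 * (h : ℝ) ^ 2 * ζ + γ (h * √d) + 6 * (d : ℝ) ^ 2 * (h : ℝ) ^ 2 * τ ≤ ρ) (i : Fin d) :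
    Fail M mle (linearFQI ls M.a0 n S i) (goodWeights M hΦ S i ρ 0)
      (h * ENNReal.ofReal ((d ^ 2 + d) * (2 * Real.exp (-2 * n * τ ^ 2)))) := by
  rw [linearFQI_eq_loop]
  have h1 := Fail.loop (E := M) (orc := mle) (n := h)
    (f := fun k θ => fqiIter ls M.a0 n S i (h - 1 - k) θ)
    (I := fun k => goodWeights M hΦ S i ρ (h - k)) (δ := ENNReal.ofReal ((d ^ 2 + d) *
      (2 * Real.exp (-2 * n * τ ^ 2)))) (s := 0) (fun k θ hθ => ?_) (fun k => ?_)
    (fun k => measurableSet_goodWeights mle hΦ hd S i ρ _) ?_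
  · simpa using h1
  · have ht : h - 1 - (k : ℕ) < h := by omega
    have e1 : h - 1 - (k : ℕ) + 1 = h - k := by omega
    have e2 : h - 1 - (k : ℕ) = h - (k + 1) := by omega
    have h2 := fail_fqiIter (M := M) (mle := mle) hΦ hΥ hd hls hn hζ hτ S i ht (hs _ ht) (hfac _ ht)
      (hmodel ⟨_, ht⟩) hρ (θ := θ) (by rw [e1]; exact hθ)
    rw [← e2]
    exact h2
  · exact (mf_fqiIter hΦ hd hls M.a0 n i _).comp (g := fun θ => (S, θ)) (by fun_prop)
  · intro s hs1 hs2
    simp only [Nat.sub_zero] at hs1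
    omega

end Planner

/-! ### Analysis of the stages -/

section Stages

open Prog

variable {X : Type u} {K d : ℕ} {Φ : Finset (Feature X K d)} {Υ : Finset (Emission X d)} {h : ℕ}

/-- Stage `h` of the algorithm. -/
noncomputable def flambeStage (ls : LSRoutine X K (Model Φ Υ) d) (a0 : Fin K) (n n' : ℕ)
    (S : Memory Φ Υ h) : Prog X K (Model Φ Υ) (Memory Φ Υ (h + 1)) :=
  (Prog.collect n fun _ => sampleTriple a0 S h).bind fun D =>
  (Prog.mle n D Prog.ret).bind fun m =>
  (Prog.collect d fun i => linearFQI ls a0 n' S i).bind fun plan =>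
  Prog.ret (S.snoc m plan)

theorem flambeStages_succ (ls : LSRoutine X K (Model Φ Υ) d) (a0 : Fin K) (n n' h : ℕ) :
    flambeStages ls a0 n n' (h + 1) =
      (flambeStages ls a0 n n' h).bind (flambeStage ls a0 n n') := rfl

theorem Memory.measurable_snoc : Measurable fun z : Memory Φ Υ h × Model Φ Υ × Plan d =>
    z.1.snoc z.2.1 z.2.2 :=
  (Flambe.measurable_snoc.comp (f := fun z : Memory Φ Υ h × Model Φ Υ × Plan d => (z.1.1, z.2.1))
    (by fun_prop)).prodMk (Flambe.measurable_snoc.comp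
    (f := fun z : Memory Φ Υ h × Model Φ Υ × Plan d => (z.1.2, z.2.2)) (by fun_prop))

variable [MeasurableSpace X] {vol : Measure X} {M : MDP X K}
  {mle : ∀ n, Dataset X K n → Model Φ Υ} {ls : LSRoutine X K (Model Φ Υ) d}
  {sol : ∀ n : ℕ, ℝ → Rows d n → Fin d → ℝ} {γ : ℝ → ℝ}

theorem mf_flambeStage (hΦ : SimplexFeatures Φ) (hd : d ≠ 0) (hls : SolvesLS ls sol γ)
    (hmle : ∀ n, Measurable (mle n)) (a0 : Fin K) (n n' : ℕ) :
    MF M mle fun S : Memory Φ Υ h => flambeStage ls a0 n n' S := by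
  refine .bind (.collect fun _ => mf_sampleTriple hΦ hd a0 h) (.bind (.mle hmle measurable_snd)
    (.bind (.collect fun i => (mf_linearFQI hΦ hd hls a0 n' i).comp (by fun_prop)) (.ret ?_)))
  exact Memory.measurable_snoc.comp (f := fun z : ((Memory Φ Υ h × Dataset X K n) × Model Φ Υ) ×
    Plan d => (z.1.1.1, z.1.2, z.2)) (by fun_prop)

theorem wf_flambeStages (hΦ : SimplexFeatures Φ) (hd : d ≠ 0) (hls : SolvesLS ls sol γ)
    (hmle : ∀ n, Measurable (mle n)) (a0 : Fin K) (n n' h : ℕ) :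
    WF M mle (flambeStages ls a0 n n' h) := by
  induction h with
  | zero => trivial
  | succ h ih =>
    rw [flambeStages_succ]
    exact ih.bind (mf_flambeStage hΦ hd hls hmle a0 n n').meas
      (mf_flambeStage hΦ hd hls hmle a0 n n').wf

variable {φs : ℕ → Feature X K d} {μs : ℕ → Emission X d} {ζ τ ρ : ℝ}

/-- A stage preserves `goodMemory`, up to the failure probabilities of one maximum likelihood
estimation and `d h` regressions. -/
theorem fail_flambeStage [SigmaFinite vol] (hΦ : SimplexFeatures Φ) (hΥ : DensityEmissions vol Υ)
    (hd : d ≠ 0) (hls : SolvesLS ls sol γ) (hmle : IsMLE mle) (n : ℕ) {n' : ℕ} (hn' : 0 < n')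
    (hζ : 0 ≤ ζ) (hτ : 0 ≤ τ) (hs : ∀ t < h + 1, φs t ∈ Φ ∧ μs t ∈ Υ)
    (hfac : Factorizes vol M (h + 1) φs μs)
    (hρ : 8 * (h : ℝ) ^ 2 * ζ + γ (h * √d) + 6 * (d : ℝ) ^ 2 * (h : ℝ) ^ 2 * τ ≤ ρ)
    {S : Memory Φ Υ h} (hS : S ∈ goodMemory vol M Υ hΦ φs μs ζ ρ h) :
    Fail M mle (flambeStage ls M.a0 n n' S) (goodMemory vol M Υ hΦ φs μs ζ ρ (h + 1))
      (ENNReal.ofReal (Φ.card * Υ.card * Real.exp (-n * ζ)) + d * (h *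
        ENNReal.ofReal ((d ^ 2 + d) * (2 * Real.exp (-2 * n' * τ ^ 2))))) := by
  have hν := S.isProbabilityMeasure_dataLaw (M := M) hΦ hd h
  have mgood := measurableSet_goodMemory (M := M) (vol := vol) (φs := φs) (μs := μs) (ζ := ζ)
    (ρ := ρ) mle hΦ hΥ hd hs
  have msamp : MF M mle fun _ : Unit => sampleTriple M.a0 S h :=
    (mf_sampleTriple hΦ hd M.a0 h).comp (g := fun _ => S) measurable_const
  have mfqi : ∀ i, MF M mle fun _ : Unit => linearFQI ls M.a0 n' S i := fun i =>
    (mf_linearFQI hΦ hd hls M.a0 n' i).comp (g := fun _ => S) measurable_const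
  set Q : Set (Dataset X K n) := {D | meanHellinger vol (S.dataLaw M hΦ h) (mle n D).phi (φs h)
    (mle n D).mu (μs h) ≤ ENNReal.ofReal (2 * ζ)} with hQ
  have mQ : MeasurableSet Q := hmle.1 n (MeasurableSet.of_discrete (s := {m : Model Φ Υ |
    meanHellinger vol (S.dataLaw M hΦ h) m.phi (φs h) m.mu (μs h) ≤ ENNReal.ofReal (2 * ζ)}))
  refine Fail.bind (Q := Q) (fun s => ?_) (fun D hD => ?_)
    ((MF.collect (f := fun _ _ => sampleTriple M.a0 S h) fun _ => msamp).wf ()) ?_ mQ mgood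
  · have h1 : Prog.law M mle (Prog.collect n fun _ => sampleTriple M.a0 S h) s {z | z.1 ∉ Q} =
        (Measure.pi fun _ : Fin n => triples (S.dataLaw M hΦ h) (M.T h)) Qᶜ := by
      rw [← law_collect_iid msamp (law_sampleTriple hΦ hd S h) n s,
        Measure.map_apply measurable_fst mQ.compl]
      rfl
    rw [h1]
    exact measure_mle_bad_le hΦ hΥ (hs h h.lt_succ_self).1 (hs h h.lt_succ_self).2
      (hfac h h.lt_succ_self) hmle hζ n
  · have h2 : Fail M mle ((Prog.collect d fun i => linearFQI ls M.a0 n' S i).bind fun plan =>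
        Prog.ret (S.snoc (mle n D) plan)) (goodMemory vol M Υ hΦ φs μs ζ ρ (h + 1))
        (d * (h * ENNReal.ofReal ((d ^ 2 + d) * (2 * Real.exp (-2 * n' * τ ^ 2)))) + 0) := by
      refine Fail.bind (Fail.collect (fun i => fail_linearFQI hΦ hΥ hd hls hn' hζ hτ
        (fun t ht => hs t (by omega)) (fun t ht => hfac t (by omega)) S hS.1 hρ i) mfqi
        fun i => measurableSet_goodWeights mle hΦ hd S i ρ 0) (fun plan hplan => ?_)
        ((MF.collect (f := fun _ i => linearFQI ls M.a0 n' S i) mfqi).wf ())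
        (.ret (Memory.measurable_snoc.comp (f := fun plan : Plan d => (S, mle n D, plan))
          (by fun_prop))) ?_ mgood
      · exact Evals.fail (.ret _) (snoc_mem_goodMemory hS hD fun i t ht =>
          hplan i t t.zero_le ht) mgood
      · have h3 : {plan : Plan d | ∀ i, plan i ∈ goodWeights M hΦ S i ρ 0} =
            ⋂ i, (fun plan : Plan d => plan i) ⁻¹' goodWeights M hΦ S i ρ 0 := by ext; simp
        rw [h3]
        exact MeasurableSet.iInter fun i =>
          measurable_pi_apply i (measurableSet_goodWeights mle hΦ hd S i ρ 0)
    rw [add_zero] at h2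
    exact h2
  · refine .bind (.mle hmle.1 measurable_id) (.bind (.collect fun i => (mfqi i).comp
      (g := fun _ => ()) measurable_const) (.ret ?_))
    exact Memory.measurable_snoc.comp (f := fun z : (Dataset X K n × Model Φ Υ) × Plan d =>
      (S, z.1.2, z.2)) (by fun_prop)

end Stages

/-! ### System identification with high probability -/

section SystemIdentification

open Prog

/-- Jensen's inequality for the square. -/
theorem sq_lintegral_le {α : Type*} [MeasurableSpace α] (ν : Measure α) [IsProbabilityMeasure ν]
    {f : α → ℝ≥0∞} (hf : Measurable f) : (∫⁻ a, f a ∂ν) ^ 2 ≤ ∫⁻ a, f a ^ 2 ∂ν := by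
  have h := ENNReal.lintegral_mul_le_Lp_mul_Lq ν Real.HolderConjugate.two_two hf.aemeasurable
    (measurable_const (a := (1 : ℝ≥0∞))).aemeasurable
  simp only [Pi.mul_apply, mul_one, lintegral_const, measure_univ,
    ENNReal.rpow_two, one_pow, ENNReal.one_rpow] at h
  calc (∫⁻ a, f a ∂ν) ^ 2 ≤ ((∫⁻ a, f a ^ 2 ∂ν) ^ (1 / (2 : ℝ))) ^ 2 := by gcongr
    _ = ∫⁻ a, f a ^ 2 ∂ν := by
      rw [← ENNReal.rpow_natCast, ← ENNReal.rpow_mul]; norm_num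

theorem lintegral_le_of_sq_le {α : Type*} [MeasurableSpace α] (ν : Measure α)
    [IsProbabilityMeasure ν] {f : α → ℝ≥0∞} (hf : Measurable f) {e : ℝ} (he : 0 ≤ e)
    (h : ∫⁻ a, f a ^ 2 ∂ν ≤ ENNReal.ofReal (e ^ 2)) : ∫⁻ a, f a ∂ν ≤ ENNReal.ofReal e := by
  have h1 := (sq_lintegral_le ν hf).trans h
  rw [ENNReal.ofReal_pow he] at h1
  exact (ENNReal.pow_le_pow_left_iff two_ne_zero).mp h1

variable {X : Type u} [MeasurableSpace X] {K d : ℕ} {vol : Measure X} [SigmaFinite vol]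
  {Φ : Finset (Feature X K d)} {Υ : Finset (Emission X d)} {M : MDP X K}
  {mle : ∀ n, Dataset X K n → Model Φ Υ} {ls : LSRoutine X K (Model Φ Υ) d}
  {sol : ∀ n : ℕ, ℝ → Rows d n → Fin d → ℝ} {γ : ℝ → ℝ} {φs : ℕ → Feature X K d}
  {μs : ℕ → Emission X d}

theorem fail_flambeStages {ζ τ ρ : ℝ} (hΦ : SimplexFeatures Φ) (hΥ : DensityEmissions vol Υ)
    (hd : d ≠ 0) (hls : SolvesLS ls sol γ) (hmle : IsMLE mle) (n : ℕ) {n' : ℕ} (hn' : 0 < n')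
    (hζ : 0 ≤ ζ) (hτ : 0 ≤ τ) {H : ℕ} (hs : ∀ t < H, φs t ∈ Φ ∧ μs t ∈ Υ)
    (hfac : Factorizes vol M H φs μs)
    (hρ : ∀ h < H,
      8 * (h : ℝ) ^ 2 * ζ + γ (h * √d) + 6 * (d : ℝ) ^ 2 * (h : ℝ) ^ 2 * τ ≤ ρ)
    {h : ℕ} (hh : h ≤ H) :
    Fail M mle (flambeStages ls M.a0 n n' h) (goodMemory vol M Υ hΦ φs μs ζ ρ h)
      (h * (ENNReal.ofReal (Φ.card * Υ.card * Real.exp (-n * ζ)) + d * (H *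
        ENNReal.ofReal ((d ^ 2 + d) * (2 * Real.exp (-2 * n' * τ ^ 2)))))) := by
  have mgood : ∀ {h}, h ≤ H → MeasurableSet (goodMemory vol M Υ hΦ φs μs ζ ρ h) := fun hh =>
    measurableSet_goodMemory mle hΦ hΥ hd fun t ht => hs t (by omega)
  induction h with
  | zero =>
    have h1 := Evals.fail (E := M) (orc := mle) (Q := goodMemory vol M Υ hΦ φs μs ζ ρ 0)
      (.ret (Fin.elim0, Fin.elim0)) ⟨fun t => t.elim0, fun l hl => absurd hl (by omega)⟩
      (mgood (Nat.zero_le H))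
    rw [Nat.cast_zero, zero_mul]
    exact h1
  | succ h ih =>
    rw [flambeStages_succ]
    refine (Fail.bind (δ' := ENNReal.ofReal (Φ.card * Υ.card * Real.exp (-n * ζ)) + d * (H *
      ENNReal.ofReal ((d ^ 2 + d) * (2 * Real.exp (-2 * n' * τ ^ 2))))) (ih (by omega))
      (fun S hS => ?_) (wf_flambeStages hΦ hd hls hmle.1 M.a0 n n' h)
      (mf_flambeStage hΦ hd hls hmle.1 M.a0 n n') (mgood (by omega)) (mgood hh)).mono le_rfl
      (le_of_eq ?_)
    · refine (fail_flambeStage hΦ hΥ hd hls hmle n hn' hζ hτ (fun t ht => hs t (by omega))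
        (fun t ht => hfac t (by omega)) (hρ h (by omega)) hS).mono le_rfl ?_
      have : (h : ℝ≥0∞) ≤ H := by exact_mod_cast (by omega : h ≤ H)
      gcongr
    · push_cast; ring

/-- If the models have mean `L¹` error at most `e₁` and the regressions mean absolute error at most
`e₂` on the collected data, and both are small enough, then the models identify the system. -/
theorem sysId_of_mem_goodMemory {H : ℕ} (hΦ : SimplexFeatures Φ) (hΥ : DensityEmissions vol Υ)
    (hd : 0 < d) (hs : ∀ t < H, φs t ∈ Φ ∧ μs t ∈ Υ) (hfac : Factorizes vol M H φs μs)
    {η ε e₁ e₂ κ : ℝ} (hη : 0 < η) (hη1 : η ≤ 1) (hreach : Reachable M H φs η)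
    (hκ : κ = K * (η⁻¹ * (2 * K) * d)) (he₁ : 0 ≤ e₁) (he₂ : 0 ≤ e₂)
    (h₁ : κ * e₁ ≤ ε)
    (h₂ : 2 * (K * (κ * e₁ + d * (2 * (H * (κ * e₂))) + d * (κ * e₁))) ≤ η)
    {S : Memory Φ Υ H}
    (hS : S ∈ goodMemory vol M Υ hΦ φs μs (e₁ ^ 2 / 8) (e₂ ^ 2) H) : SysId vol M ε S.1 := by
  have gs : ∀ t < H, GoodFeature (φs t) := fun t ht => goodFeature_of_mem hΦ (hs t ht).1
  have es : ∀ t < H, GoodEmission vol (μs t) := fun t ht => goodEmission_of_mem hΥ (hs t ht).2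
  have hκ0 : 0 ≤ κ := by rw [hκ]; positivity
  let G : ℕ → Emission X d := fun t => if ht : t < H then (S.1 ⟨t, ht⟩).mu else 0
  have hG : ∀ t : Fin H, G t = (S.1 t).mu := fun t => dif_pos t.2
  have hF : ∀ t : Fin H, S.feat t = (S.1 t).phi := fun t => dif_pos t.2
  have eG : ∀ t < H, GoodEmission vol (G t) := fun t ht => by
    have := hG ⟨t, ht⟩
    simp only at this
    rw [this]; exact (S.1 _).goodEmission hΥ
  have gF : ∀ t < H, GoodFeature (S.feat t) := fun t ht => S.goodFeature_feat hΦ ht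
  have hprob := fun t => S.isProbabilityMeasure_dataLaw (M := M) hΦ hd.ne' t
  have key := modelError_le (F := S.feat) (G := G) (hF := S.measurable_feat hΦ) (P := S.plan)
    (κ := ENNReal.ofReal κ) (ε := ENNReal.ofReal (κ * e₁)) (ε₁ := ENNReal.ofReal e₁)
    (ε₂ := ENNReal.ofReal e₂) hfac gs es gF eG hd hη hη1 hreach ?_ ?_ ?_ ?_ ?_
  · intro π t
    refine le_trans ?_ ((key t t.2 π).trans (ENNReal.ofReal_le_ofReal h₁))
    rw [modelError, hF, hG]
    refine lintegral_mono fun p => ?_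
    have h1 := hfac t t.2 p.1 p.2
    simp only [Prod.mk.eta] at h1
    rw [h1]
    exact tvDist_le_l1Dist ((S.1 t).goodFeature hΦ) (gs t t.2) ((S.1 t).goodEmission hΥ)
      (es t t.2) p.1 p.2
  · rw [hκ, ENNReal.ofReal_mul K.cast_nonneg, ENNReal.ofReal_mul (by positivity),
      ENNReal.ofReal_mul (by positivity), ENNReal.ofReal_mul (by norm_num),
      ENNReal.ofReal_inv_of_pos hη]
    simp
  · intro t ht
    have := hprob t
    have hm := hS.1 ⟨t, ht⟩
    have hG' := hG ⟨t, ht⟩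
    have hF' := hF ⟨t, ht⟩
    simp only at hm hG' hF'
    rw [← hG', ← hF'] at hm
    refine lintegral_le_of_sq_le (S.dataLaw M hΦ t)
      (measurable_l1Dist (gF t ht) (eG t ht) (gs t ht) (es t ht)) he₁ ?_
    calc ∫⁻ p, l1Dist vol (density (S.feat t) (G t) p.1 p.2) (density (φs t) (μs t) p.1 p.2) ^ 2
          ∂S.dataLaw M hΦ t
        ≤ ∫⁻ p, 4 * sqHellinger vol (density (S.feat t) (G t) p.1 p.2)
          (density (φs t) (μs t) p.1 p.2) ∂S.dataLaw M hΦ t :=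
          lintegral_mono fun p => l1Dist_sq_le (measurable_density_right (eG t ht) _ _)
            (measurable_density_right (es t ht) _ _)
            (fun x => density_nonneg (gF t ht) (eG t ht) _ _ x)
            (fun x => density_nonneg (gs t ht) (es t ht) _ _ x)
            (lintegral_density (gF t ht) (eG t ht) _ _)
            (lintegral_density (gs t ht) (es t ht) _ _)
      _ = 4 * meanHellinger vol (S.dataLaw M hΦ t) (S.feat t) (φs t) (G t) (μs t) :=
          lintegral_const_mul _ (measurable_sqHellinger (gF t ht) (eG t ht) (gs t ht) (es t ht))
      _ ≤ 4 * ENNReal.ofReal (2 * (e₁ ^ 2 / 8)) := by gcongr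
      _ = ENNReal.ofReal (e₁ ^ 2) := by
          have : (4 : ℝ≥0∞) = ENNReal.ofReal 4 := by simp
          rw [this, ← ENNReal.ofReal_mul (by norm_num)]
          congr 1; ring
  · intro l hl i t _ htl
    have := hprob t
    have hm := measurable_bellmanError (M := M) (l := l) (i := i) (θ := S.plan l i)
      (S.measurable_feat hΦ) t
    refine lintegral_le_of_sq_le (S.dataLaw M hΦ t) (by fun_prop) he₂ ?_
    refine le_trans (le_of_eq ?_) (hS.2 l hl i t htl)
    refine lintegral_congr fun p => ?_
    rw [← ENNReal.ofReal_pow (abs_nonneg _), sq_abs]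
  · rw [← ENNReal.ofReal_mul hκ0]
  · have h3 := ENNReal.ofReal_le_ofReal h₂
    refine le_trans (le_of_eq ?_) h3
    symm
    rw [ENNReal.ofReal_mul (p := 2) (by norm_num), ENNReal.ofReal_mul (p := K) K.cast_nonneg,
      ENNReal.ofReal_add (by positivity) (by positivity),
      ENNReal.ofReal_add (by positivity) (by positivity),
      ENNReal.ofReal_mul (p := d) d.cast_nonneg, ENNReal.ofReal_mul (p := 2) (by norm_num),
      ENNReal.ofReal_mul (p := H) H.cast_nonneg,
      ENNReal.ofReal_mul (p := d) d.cast_nonneg]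
    simp only [ENNReal.ofReal_natCast, ENNReal.ofReal_ofNat, ENNReal.ofReal_mul hκ0]

/-- The success probability of the algorithm in terms of the sample sizes. -/
theorem le_law_sysId {H : ℕ} (hΦ : SimplexFeatures Φ) (hΥ : DensityEmissions vol Υ)
    (hd : 0 < d) (hs : ∀ t < H, φs t ∈ Φ ∧ μs t ∈ Υ) (hfac : Factorizes vol M H φs μs)
    {η ε e₁ e₂ κ τ δ : ℝ} (hη : 0 < η) (hη1 : η ≤ 1) (hreach : Reachable M H φs η)
    (hκ : κ = K * (η⁻¹ * (2 * K) * d)) (he₁ : 0 ≤ e₁) (he₂ : 0 ≤ e₂)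
    (h₁ : κ * e₁ ≤ ε)
    (h₂ : 2 * (K * (κ * e₁ + d * (2 * (H * (κ * e₂))) + d * (κ * e₁))) ≤ η)
    (hls : SolvesLS ls sol γ) (hmle : IsMLE mle) {n n' : ℕ} (hn' : 0 < n') (hτ : 0 ≤ τ)
    (hρ : ∀ h < H,
      8 * (h : ℝ) ^ 2 * (e₁ ^ 2 / 8) + γ (h * √d) + 6 * (d : ℝ) ^ 2 * (h : ℝ) ^ 2 * τ ≤ e₂ ^ 2)
    (hδ : H * (Φ.card * Υ.card * Real.exp (-n * (e₁ ^ 2 / 8)) + d * (H *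
      ((d ^ 2 + d) * (2 * Real.exp (-2 * n' * τ ^ 2))))) ≤ δ) (s : ℕ × X) :
    ENNReal.ofReal (1 - δ) ≤
      (flambe ls M.a0 n n' H).law M mle s {out | SysId vol M ε out.1} := by
  have hf := fail_flambeStages hΦ hΥ hd.ne' hls hmle n hn' (ζ := e₁ ^ 2 / 8) (by positivity) hτ hs
    hfac hρ le_rfl
  have wS := wf_flambeStages (M := M) hΦ hd.ne' hls hmle.1 M.a0 n n' H
  have mret : MF M mle fun S : Memory Φ Υ H => (Prog.ret S.1 :
      Prog X K (Model Φ Υ) (Fin H → Model Φ Υ)) := .ret measurable_fst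
  have mgood := measurableSet_goodMemory (M := M) (vol := vol) (φs := φs) (μs := μs)
    (ζ := e₁ ^ 2 / 8) (ρ := e₂ ^ 2) mle hΦ hΥ hd.ne' hs
  have mQ : MeasurableSet {m : Fin H → Model Φ Υ | SysId vol M ε m} := MeasurableSet.of_discrete
  have hF : Fail M mle (flambe ls M.a0 n n' H) {m | SysId vol M ε m} _ :=
    Fail.bind hf (fun S hS => Evals.fail (.ret _) (sysId_of_mem_goodMemory hΦ hΥ hd hs hfac hη hη1
      hreach hκ he₁ he₂ h₁ h₂ hS) mQ) wS mret mgood mQ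
  have wF : WF M mle (flambe ls M.a0 n n' H) := wS.bind mret.meas mret.wf
  have hp := wF.isProbabilityMeasure s
  have mS : MeasurableSet {out : (Fin H → Model Φ Υ) × (ℕ × X) | SysId vol M ε out.1} :=
    measurable_fst mQ
  have h3 := hF s
  rw [add_zero] at h3
  have h4 : (H : ℝ≥0∞) * (ENNReal.ofReal (Φ.card * Υ.card * Real.exp (-n * (e₁ ^ 2 / 8))) + d *
      (H * ENNReal.ofReal ((d ^ 2 + d) * (2 * Real.exp (-2 * n' * τ ^ 2))))) ≤
      ENNReal.ofReal δ := by
    refine le_trans (le_of_eq ?_) (ENNReal.ofReal_le_ofReal hδ)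
    rw [ENNReal.ofReal_mul H.cast_nonneg, ENNReal.ofReal_add (by positivity) (by positivity),
      ENNReal.ofReal_mul d.cast_nonneg, ENNReal.ofReal_mul H.cast_nonneg]
    simp only [ENNReal.ofReal_natCast]
  have h5 := prob_compl_eq_one_sub (μ := (flambe ls M.a0 n n' H).law M mle s) mS.compl
  rw [compl_compl] at h5
  rw [h5, ENNReal.ofReal_sub _ ?_, ENNReal.ofReal_one]
  · exact tsub_le_tsub_left (h3.trans h4) 1
  · exact le_trans (by positivity) hδ

end SystemIdentification

/-! ### The cost of the algorithm -/

section Cost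

open Prog

variable {X : Type u} {K d : ℕ} {Φ : Finset (Feature X K d)} {Υ : Finset (Emission X d)} {h : ℕ}
  {r o e : ℕ∞}

/-- Number of instructions needed to take the greedy action. -/
def greedyCost (d K : ℕ) : ℕ := K * (5 * d + 4)

theorem cost_greedy (a0 : Fin K) (φ : Feature X K d) (l : ℕ) (i : Fin d) (t : ℕ) (θ : Fin d → ℝ)
    (x : X) : (greedy a0 φ l i t θ x : Prog X K (Model Φ Υ) _).cost r o e ≤
      greedyCost d K * e := by
  have h1 : ∀ a, (qValue φ l i t θ x a : Prog X K (Model Φ Υ) ℝ).cost r o e ≤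
      d * (e + e) + (d * (e + (e + e)) + e) := fun a => by
    refine cost_bind_le (cost_feature _ _ _) fun f => cost_bind_le (cost_dot _ _) fun p => ?_
    split_ifs
    · exact cost_op _
    · exact (cost_ret p).trans (zero_le)
  refine (cost_bind_le (cost_collect h1) fun q => cost_argmax _ _).trans (le_of_eq ?_)
  unfold greedyCost
  push_cast; ring

theorem cost_value (a0 : Fin K) (φ : Feature X K d) (l : ℕ) (i : Fin d) (t : ℕ) (θ : Fin d → ℝ)
    (x : X) : (value a0 φ l i t θ x : Prog X K (Model Φ Υ) _).cost r o e ≤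
      (greedyCost d K + 2 : ℕ) * e := by
  refine (cost_bind_le (cost_greedy _ _ _ _ _ _ _) fun b => cost_bind_le (cost_op _)
    fun y => cost_op _).trans (le_of_eq ?_)
  push_cast; ring

theorem cost_unifAction (a0 : Fin K) (t : ℕ) :
    (unifAction a0 t : Prog X K (Model Φ Υ) _).cost r o e ≤ e := by
  unfold unifAction
  split_ifs <;> simp [Prog.cost]

theorem cost_act (a : Fin K) : (act a Prog.ret : Prog X K (Model Φ Υ) X).cost r o e ≤ e := by
  simp [Prog.cost]

theorem cost_explore (a0 : Fin K) (S : Memory Φ Υ h) (t : ℕ) :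
    (explore a0 S t).cost r o e ≤ r + (t * (greedyCost d K + 2) + 3 : ℕ) * e := by
  have hr : (Prog.reset Prog.ret : Prog X K (Model Φ Υ) X).cost r o e ≤ r := by simp [Prog.cost]
  cases t with
  | zero => exact hr.trans le_self_add
  | succ l =>
    have h1 : ∀ (i : Fin d) (t : Fin l) x,
        (exploreBody a0 S l i t x).cost r o e ≤ greedyCost d K * e + e := fun i t x => by
      refine cost_bind_le ?_ fun a => cost_act a
      split_ifs
      · exact (cost_ret a0).trans (zero_le)
      · exact (cost_bind_le (cost_greedy _ _ _ _ _ _ _) fun b => cost_ret _).trans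
          (le_of_eq (add_zero _))
    have hu : (Prog.unif d Prog.ret : Prog X K (Model Φ Υ) (Fin d)).cost r o e ≤ e := by
      simp [Prog.cost]
    refine (cost_bind_le hu fun i => cost_bind_le hr fun x0 => cost_bind_le
      (cost_loop (f := fun (t : Fin l) x => exploreBody a0 S l i t x) (h1 i) x0) fun _ =>
        cost_bind_le (cost_unifAction a0 l) fun a => cost_act a).trans ?_
    calc e + (r + (l * (e + (greedyCost d K * e + e)) + (e + e)))
        = r + (l * (greedyCost d K + 2) + 3 : ℕ) * e := by push_cast; ring
      _ ≤ _ := by gcongr; omega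

theorem cost_sampleTriple (a0 : Fin K) (S : Memory Φ Υ h) (t : ℕ) :
    (sampleTriple a0 S t).cost r o e ≤ r + (t * (greedyCost d K + 2) + 5 : ℕ) * e := by
  refine (cost_bind_le (cost_explore a0 S t) fun x => cost_bind_le (cost_unifAction a0 t)
    fun a => cost_bind_le (cost_act a) fun x' => cost_ret _).trans (le_of_eq ?_)
  push_cast; ring

variable {ls : LSRoutine X K (Model Φ Υ) d}

/-- Number of instructions of Linear-FQI with `n` samples per regression, besides the starts of
episodes, if a least squares problem takes `L` instructions. -/
def plannerCost (d K H n L : ℕ) : ℕ :=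
  H * (1 + n * (H * (greedyCost d K + 2) + 9 + 2 * d + greedyCost d K) + L)

theorem cost_linearFQI {n L : ℕ} (hL : ∀ B rows, (ls n B rows).cost r o e ≤ L * e) (a0 : Fin K)
    (S : Memory Φ Υ h) (i : Fin d) :
    (linearFQI ls a0 n S i).cost r o e ≤ (h * n : ℕ) * r + plannerCost d K h n L * e := by
  have hfit : ∀ t θ D, (fqiFit (n := n) ls a0 S i t θ D).cost r o e ≤
      n * (e + (d * (e + e) + (greedyCost d K + 2 : ℕ) * e)) + L * e := fun t θ D => by
    refine (cost_bind_le (cost_collect fun j => cost_bind_le (cost_feature _ _ _) fun f =>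
      cost_bind_le (c := (greedyCost d K + 2 : ℕ) * e) ?_ fun y => cost_ret _) fun rows =>
      cost_bind_le (hL _ _) fun θt => cost_ret _).trans (le_of_eq (by simp))
    split_ifs
    · exact (cost_ret _).trans (zero_le)
    · exact cost_value _ _ _ _ _ _ _
  have hiter : ∀ (k : Fin h) θ, (fqiIter ls a0 n S i (h - 1 - k) θ).cost r o e ≤
      n * (e + (r + (h * (greedyCost d K + 2) + 5 : ℕ) * e)) +
        (n * (e + (d * (e + e) + (greedyCost d K + 2 : ℕ) * e)) + L * e) := fun k θ => by
    refine cost_bind_le (cost_collect fun _ => (cost_sampleTriple a0 S _).trans ?_)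
      fun D => hfit _ _ _
    gcongr
    omega
  rw [linearFQI_eq_loop]
  refine (cost_loop (f := fun (k : Fin h) θ => fqiIter ls a0 n S i (h - 1 - k) θ) hiter 0).trans
    (le_of_eq ?_)
  unfold plannerCost
  push_cast; ring

/-- Number of episodes of one stage. -/
def stageEpisodes (d H n n' : ℕ) : ℕ := n + d * (H * n')

/-- Number of instructions of one stage, besides the starts of episodes and the oracle call. -/
def stageCost (d K H n n' L : ℕ) : ℕ :=
  n * (H * (greedyCost d K + 2) + 6) + d * (1 + plannerCost d K H n' L)

theorem cost_flambeStage {n n' L : ℕ} (hL : ∀ B rows, (ls n' B rows).cost r o e ≤ L * e)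
    (a0 : Fin K) (S : Memory Φ Υ h) : (flambeStage ls a0 n n' S).cost r o e ≤
      stageEpisodes d h n n' * r + o + stageCost d K h n n' L * e := by
  have hm : ∀ D, (Prog.mle n D Prog.ret : Prog X K (Model Φ Υ) _).cost r o e ≤ o := fun D => by
    simp [Prog.cost]
  refine (cost_bind_le (cost_collect fun _ => cost_sampleTriple a0 S h) fun D => cost_bind_le (hm D)
    fun m => cost_bind_le (cost_collect fun i => cost_linearFQI hL a0 S i) fun plan =>
      cost_ret _).trans (le_of_eq ?_)
  unfold stageEpisodes stageCost
  push_cast; ring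

theorem cost_flambe {n n' L : ℕ} (hL : ∀ B rows, (ls n' B rows).cost r o e ≤ L * e) (a0 : Fin K)
    (H : ℕ) : (flambe ls a0 n n' H).cost r o e ≤
      H * (stageEpisodes d H n n' * r + o + stageCost d K H n n' L * e) := by
  have h1 : ∀ h ≤ H, (flambeStages ls a0 n n' h).cost r o e ≤
      h * (stageEpisodes d H n n' * r + o + stageCost d K H n n' L * e) := fun h hh => by
    induction h with
    | zero => simp [flambeStages, Prog.cost]
    | succ h ih =>
      have h2 : stageEpisodes d h n n' ≤ stageEpisodes d H n n' := by
        unfold stageEpisodes; gcongr; omega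
      have h3 : stageCost d K h n n' L ≤ stageCost d K H n n' L := by
        unfold stageCost plannerCost; gcongr <;> omega
      rw [flambeStages_succ]
      refine (cost_bind_le (ih (by omega)) fun S => (cost_flambeStage hL a0 S).trans
        (c := stageEpisodes d H n n' * r + o + stageCost d K H n n' L * e) ?_).trans
        (le_of_eq (by push_cast; ring))
      gcongr
  exact (cost_bind_le (h1 H le_rfl) fun S => cost_ret _).trans (le_of_eq (add_zero _))

theorem cost_exactLS {sol : ∀ n : ℕ, ℝ → Rows d n → Fin d → ℝ} (n : ℕ) (B : ℝ) (D : Rows d n) :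
    (exactLS sol n B D : Prog X K (Model Φ Υ) _).cost r o e ≤ e := cost_op _

theorem cost_conditionalGradient (N n : ℕ) (B : ℝ) (D : Rows d n) :
    (conditionalGradient N n B D : Prog X K (Model Φ Υ) _).cost r o e ≤
      (N * (5 + 10 * d + 2 * n + 6 * (n * d)) : ℕ) * e := by
  refine (cost_loop (c := n * (e + (d * (e + (e + e)) + e)) + (d * (e + n * (e + (e + e))) +
    (d * (e + (e + e)) + (e + (e + (e + (e + d * (e + (e + (e + (e + (e + e)))))))))))) (fun k θ =>
    cost_bind_le (cost_collect fun j => cost_bind_le (cost_dot _ _) fun p => cost_op _) fun r' =>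
    cost_bind_le (cost_collect fun i => cost_sum fun j => cost_op _) fun g =>
    cost_bind_le (cost_dot _ _) fun q => cost_bind_le (cost_op _) fun s =>
    cost_bind_le (cost_op _) fun c => cost_bind_le (cost_op _) fun γ => cost_tick ?_) 0).trans
    (le_of_eq (by push_cast; ring))
  split_ifs
  · exact (cost_ret _).trans (zero_le)
  · exact cost_collect fun i => cost_bind_le (cost_op _) fun b => cost_bind_le (cost_op _) fun _ =>
      cost_bind_le (cost_op _) fun z => cost_bind_le (cost_op _) fun y => cost_op _

end Cost

/-! ### The number of oracle calls -/

section OracleCalls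

open Prog

/-- A program that runs a well-formed program first costs at least as much as the cheapest
continuation. -/
theorem Prog.WF.le_cost_bind {X : Type u} {K : ℕ} {M : Type v} {α : Type w} {β : Type w'}
    [MeasurableSpace X] [MeasurableSpace α] {E : MDP X K} {orc : ∀ n, Dataset X K n → M}
    {r o e c : ℕ∞} {p : Prog X K M α} {f : α → Prog X K M β} (hp : WF E orc p)
    (hf : ∀ z, c ≤ (f z).cost r o e) : c ≤ (p.bind f).cost r o e := by
  induction p with
  | ret z => exact hf z
  | tick p ih => exact (ih hp).trans le_add_self
  | unif n k ih =>
    obtain ⟨i⟩ : Nonempty (Fin n) := ⟨⟨0, Nat.pos_of_ne_zero hp.1⟩⟩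
    exact ((ih i (hp.2 i)).trans (le_iSup (fun i => ((k i).bind f).cost r o e) i)).trans le_add_self
  | reset k ih =>
    exact ((ih _ hp).trans (le_iSup (fun x => ((k x).bind f).cost r o e) E.x0)).trans le_add_self
  | act a k ih =>
    exact ((ih _ (hp.1 E.x0)).trans (le_iSup (fun x => ((k x).bind f).cost r o e) E.x0)).trans
      le_add_self
  | mle n D k ih =>
    exact ((ih _ hp).trans (le_iSup (fun m => ((k m).bind f).cost r o e) (orc n D))).trans
      le_add_self

variable {X : Type u} [MeasurableSpace X] {K d : ℕ} {Φ : Finset (Feature X K d)}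
  {Υ : Finset (Emission X d)} {M : MDP X K}
  {ls : LSRoutine X K (Model Φ Υ) d} {sol : ∀ n : ℕ, ℝ → Rows d n → Fin d → ℝ} {γ : ℝ → ℝ}

/-- Each stage calls the oracle at least once, on every execution. The continuation `f` is needed
for the induction over the stages. -/
theorem le_cost_flambeStages_bind {β : Type w'} (hΦ : SimplexFeatures Φ) (hd : d ≠ 0)
    (hls : SolvesLS ls sol γ) (mle : ∀ n, Dataset X K n → Model Φ Υ) (n n' : ℕ) {r o e : ℕ∞}
    (h : ℕ) {c : ℕ∞}
    {f : Memory Φ Υ h → Prog X K (Model Φ Υ) β} (hf : ∀ S, c ≤ (f S).cost r o e) :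
    h * o + c ≤ ((flambeStages ls M.a0 n n' h).bind f).cost r o e := by
  induction h generalizing c with
  | zero => simpa using! hf _
  | succ h ih =>
    rw [flambeStages_succ, bind_assoc]
    refine le_trans (le_of_eq ?_) (ih (c := o + c) fun S => ?_)
    · push_cast; ring
    have msamp : MF M mle fun _ : Unit => sampleTriple M.a0 S h :=
      (mf_sampleTriple hΦ hd M.a0 h).comp (g := fun _ => S) measurable_const
    have mfqi : ∀ i, MF M mle fun _ : Unit => linearFQI ls M.a0 n' S i := fun i =>
      (mf_linearFQI hΦ hd hls M.a0 n' i).comp (g := fun _ => S) measurable_const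
    rw [flambeStage, bind_assoc]
    refine ((MF.collect (f := fun _ _ => sampleTriple M.a0 S h) fun _ => msamp).wf ()).le_cost_bind
      fun D => ?_
    have h1 : c ≤ (((Prog.collect d fun i => linearFQI ls M.a0 n' S i).bind fun plan =>
        Prog.ret (S.snoc (mle n D) plan)).bind f).cost r o e := by
      rw [bind_assoc]
      exact ((MF.collect (f := fun _ i => linearFQI ls M.a0 n' S i) mfqi).wf ()).le_cost_bind
        fun plan => hf _
    exact add_le_add_right (h1.trans (le_iSup (fun m : Model Φ Υ =>
      (((Prog.collect d fun i => linearFQI ls M.a0 n' S i).bind fun plan =>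
        Prog.ret (S.snoc m plan)).bind f).cost r o e) (mle n D))) o

theorem mleCalls_flambe (hΦ : SimplexFeatures Φ) (hd : d ≠ 0) (hls : SolvesLS ls sol γ)
    (mle : ∀ n, Dataset X K n → Model Φ Υ) (n n' H : ℕ)
    (hL : ∀ B rows, (ls n' B rows).cost 0 1 0 ≤ 0) :
    (flambe ls M.a0 n n' H).mleCalls = H := by
  refine le_antisymm ?_ ?_
  · simpa [mleCalls] using cost_flambe (n := n) (r := 0) (o := 1) (e := 0) (L := 0)
      (by simpa using hL) M.a0 H
  · simpa [mleCalls, flambe] using le_cost_flambeStages_bind (M := M) hΦ hd hls mle n n' H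
      (r := 0) (o := 1) (e := 0) (c := 0) (f := fun S => Prog.ret S.1) fun S => zero_le

end OracleCalls

/-! ### Choice of the parameters -/

section Parameters

/-- All sample sizes and the number of rounds of the conditional gradient method are set to this
value, where `s` exceeds `d`, `H`, `K`, `1/η`, `1/ε` and `log (|Φ| |Υ| / δ)`. -/
noncomputable def sampleSize (s : ℝ) : ℕ := ⌈2 ^ 27 * s ^ 41⌉₊

theorem le_sampleSize (s : ℝ) : 2 ^ 27 * s ^ 41 ≤ sampleSize s := Nat.le_ceil _

theorem sampleSize_le {s : ℝ} (hs : 1 ≤ s) : (sampleSize s : ℝ) ≤ 2 ^ 28 * s ^ 41 := by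
  have h1 : (1 : ℝ) ≤ s ^ 41 := one_le_pow₀ hs
  have h2 := (Nat.ceil_lt_add_one (a := 2 ^ 27 * s ^ 41) (by positivity)).le
  unfold sampleSize
  linarith

theorem self_le_sampleSize {s : ℝ} (hs : 1 ≤ s) : s ≤ sampleSize s := by
  have h1 : s ≤ s ^ 41 := le_self_pow₀ hs (by norm_num)
  have h2 : (0 : ℝ) ≤ s ^ 41 := by positivity
  linarith [le_sampleSize s]

variable {s d H K η ε : ℝ}

/-- The constant `κ` in the coverage property is at most `2 s ^ 4`. -/
theorem coverage_le (hs : 1 ≤ s) (hd0 : 0 ≤ d) (hK0 : 0 ≤ K) (hη : 0 < η) (hd : d ≤ s)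
    (hK : K ≤ s) (hηs : 1 / η ≤ s) : K * (η⁻¹ * (2 * K) * d) ≤ 2 * s ^ 4 := by
  rw [one_div] at hηs
  have : 0 < η⁻¹ := inv_pos.mpr hη
  calc K * (η⁻¹ * (2 * K) * d) ≤ s * (s * (2 * s) * s) := by gcongr
    _ = 2 * s ^ 4 := by ring

/-- The mean `L¹` error `1 / (32 s ^ 9)` of the models on the data suffices for accuracy `ε` under
every policy. -/
theorem model_accuracy_le (hs : 1 ≤ s) {κ : ℝ} (hκ : κ ≤ 2 * s ^ 4) (hε : 0 < ε)
    (hεs : 1 / ε ≤ s) : κ * (1 / (32 * s ^ 9)) ≤ ε := by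
  have h0 : 0 < s := by linarith
  have h1 : 1 / s ≤ ε := (one_div_le h0 hε).mpr hεs
  have h2 : (1 : ℝ) ≤ s ^ 4 := one_le_pow₀ hs
  calc κ * (1 / (32 * s ^ 9)) ≤ 2 * s ^ 4 * (1 / (32 * s ^ 9)) := by gcongr
    _ = 1 / (16 * s ^ 4) * (1 / s) := by field_simp; norm_num
    _ ≤ 1 * (1 / s) := by
      gcongr
      rw [div_le_one (by positivity)]
      linarith
    _ ≤ ε := by linarith

/-- The mean `L¹` error `1 / (32 s ^ 9)` of the models and the mean Bellman error `1 / (16 s ^ 8)`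
of the planner suffice for coverage at the next time. -/
theorem plan_accuracy_le (hs : 1 ≤ s) (hd0 : 0 ≤ d) (hH0 : 0 ≤ H) (hK0 : 0 ≤ K) {κ : ℝ}
    (hκ : κ ≤ 2 * s ^ 4) (hη : 0 < η) (hd : 1 + d ≤ s) (hH : H ≤ s) (hK : K ≤ s)
    (hηs : 1 / η ≤ s) :
    2 * (K * (κ * (1 / (32 * s ^ 9)) + d * (2 * (H * (κ * (1 / (16 * s ^ 8))))) +
      d * (κ * (1 / (32 * s ^ 9))))) ≤ η := by
  have h0 : 0 < s := by linarith
  have h1 : 1 / s ≤ η := (one_div_le h0 hη).mpr hηs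
  have h2 : κ * (1 / (32 * s ^ 9)) ≤ 1 / (16 * s ^ 5) := by
    calc κ * (1 / (32 * s ^ 9)) ≤ 2 * s ^ 4 * (1 / (32 * s ^ 9)) := by gcongr
      _ = 1 / (16 * s ^ 5) := by field_simp; norm_num
  have h3 : κ * (1 / (16 * s ^ 8)) ≤ 1 / (8 * s ^ 4) := by
    calc κ * (1 / (16 * s ^ 8)) ≤ 2 * s ^ 4 * (1 / (16 * s ^ 8)) := by gcongr
      _ = 1 / (8 * s ^ 4) := by field_simp; norm_num
  have h4 : (1 : ℝ) ≤ s ^ 2 := one_le_pow₀ hs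
  calc 2 * (K * (κ * (1 / (32 * s ^ 9)) + d * (2 * (H * (κ * (1 / (16 * s ^ 8))))) +
        d * (κ * (1 / (32 * s ^ 9)))))
      = 2 * (K * ((1 + d) * (κ * (1 / (32 * s ^ 9))) +
        d * (2 * (H * (κ * (1 / (16 * s ^ 8))))))) := by ring
    _ ≤ 2 * (s * (s * (1 / (16 * s ^ 5)) + s * (2 * (s * (1 / (8 * s ^ 4)))))) := by
        have h5 : (1 + d) * (κ * (1 / (32 * s ^ 9))) ≤ s * (1 / (16 * s ^ 5)) :=
          (mul_le_mul_of_nonneg_left h2 (by linarith)).trans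
            (mul_le_mul_of_nonneg_right hd (by positivity))
        have h6 : H * (κ * (1 / (16 * s ^ 8))) ≤ s * (1 / (8 * s ^ 4)) :=
          (mul_le_mul_of_nonneg_left h3 hH0).trans
            (mul_le_mul_of_nonneg_right hH (by positivity))
        have h7 : d * (2 * (H * (κ * (1 / (16 * s ^ 8))))) ≤ s * (2 * (s * (1 / (8 * s ^ 4)))) :=
          (mul_le_mul_of_nonneg_left (mul_le_mul_of_nonneg_left h6 zero_le_two) hd0).trans
            (mul_le_mul_of_nonneg_right (by linarith) (by positivity))
        have h8 := (mul_le_mul_of_nonneg_left (add_le_add h5 h7) hK0).trans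
          (mul_le_mul_of_nonneg_right hK (by positivity))
        linarith
    _ = (1 / (8 * s ^ 2) + 1 / 2) * (1 / s) := by field_simp; ring
    _ ≤ 1 * (1 / s) := by
        gcongr
        have : 1 / (8 * s ^ 2) ≤ 1 / 2 := by
          apply one_div_le_one_div_of_le <;> linarith
        linarith
    _ ≤ η := by linarith

/-- The contributions of the model error, of the optimization error of the least squares routine,
and of the deviation `τ = 1 / (2 ^ 13 s ^ 20)` of the empirical moments to the mean squared Bellman
error. -/
theorem regression_accuracy_le (hs : 1 ≤ s) (hd0 : 0 ≤ d) {h : ℝ} (hh0 : 0 ≤ h) (hd : d ≤ s)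
    (hh : h ≤ s) :
    8 * h ^ 2 * ((1 / (32 * s ^ 9)) ^ 2 / 8) + 16 * (h * √d) ^ 2 / (sampleSize s + 2) +
      6 * d ^ 2 * h ^ 2 * (1 / (2 ^ 13 * s ^ 20)) ≤ (1 / (16 * s ^ 8)) ^ 2 := by
  have h0 : 0 < s := by linarith
  have hN := le_sampleSize s
  have h1 : 8 * h ^ 2 * ((1 / (32 * s ^ 9)) ^ 2 / 8) ≤ 1 / (1024 * s ^ 16) := by
    calc 8 * h ^ 2 * ((1 / (32 * s ^ 9)) ^ 2 / 8) ≤ 8 * s ^ 2 * ((1 / (32 * s ^ 9)) ^ 2 / 8) := by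
          gcongr
      _ = 1 / (1024 * s ^ 16) := by field_simp; norm_num
  have h2 : 16 * (h * √d) ^ 2 / (sampleSize s + 2) ≤ 1 / (1024 * s ^ 16) := by
    rw [mul_pow, Real.sq_sqrt hd0]
    calc 16 * (h ^ 2 * d) / (sampleSize s + 2) ≤ 16 * (s ^ 2 * s) / (2 ^ 27 * s ^ 41) := by
          gcongr; linarith
      _ = 1 / (1024 * s ^ 16) * (1 / (2 ^ 13 * s ^ 22)) := by field_simp; norm_num
      _ ≤ 1 / (1024 * s ^ 16) * 1 := by
          gcongr
          rw [div_le_one (by positivity)]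
          have : (1 : ℝ) ≤ s ^ 22 := one_le_pow₀ hs
          linarith
      _ = _ := mul_one _
  have h3 : 6 * d ^ 2 * h ^ 2 * (1 / (2 ^ 13 * s ^ 20)) ≤ 1 / (1024 * s ^ 16) := by
    calc 6 * d ^ 2 * h ^ 2 * (1 / (2 ^ 13 * s ^ 20))
        ≤ 6 * s ^ 2 * s ^ 2 * (1 / (2 ^ 13 * s ^ 20)) := by gcongr
      _ = 3 / 4 * (1 / (1024 * s ^ 16)) := by field_simp; norm_num
      _ ≤ 1 / (1024 * s ^ 16) := by
          have : 0 < 1 / (1024 * s ^ 16) := by positivity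
          linarith
  have h4 : (1 / (16 * s ^ 8)) ^ 2 = 4 * (1 / (1024 * s ^ 16)) := by field_simp; norm_num
  have h5 : 0 < 1 / (1024 * s ^ 16) := by positivity
  linarith

/-- The total failure probability, where `c` is the number of models. Polynomial factors in `H` and
`d` are absorbed by `x ≤ exp x`. -/
theorem failure_le (hs : 1 ≤ s) (hd0 : 0 ≤ d) (hH0 : 0 ≤ H) {c δ : ℝ} (hc : 1 ≤ c) (hδ : 0 < δ)
    (h : 1 + d + H + Real.log (c / δ) ≤ s) (hℓ : 0 ≤ Real.log (c / δ)) :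
    H * (c * Real.exp (-sampleSize s * ((1 / (32 * s ^ 9)) ^ 2 / 8)) + d * (H *
      ((d ^ 2 + d) * (2 * Real.exp (-2 * sampleSize s * (1 / (2 ^ 13 * s ^ 20)) ^ 2))))) ≤ δ := by
  have h0 : 0 < s := by linarith
  have hN := le_sampleSize s
  set ℓ := Real.log (c / δ) with hl
  have hexp : Real.exp ℓ = c / δ := Real.exp_log (by positivity)
  have hcδ : c * Real.exp (-ℓ) = δ := by
    rw [Real.exp_neg, hexp]; field_simp
  have hδ' : Real.exp (-ℓ) ≤ δ := by
    rw [← hcδ]; exact le_mul_of_one_le_left (Real.exp_pos _).le hc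
  have h2e : 2 * Real.exp (-1) ≤ 1 := by
    rw [Real.exp_neg, mul_inv_le_iff₀ (Real.exp_pos _)]
    linarith [Real.add_one_le_exp (1 : ℝ)]
  have hdexp : d * Real.exp (-d) ≤ 1 := by
    rw [Real.exp_neg, mul_inv_le_iff₀ (Real.exp_pos _)]
    linarith [Real.add_one_le_exp d]
  have hd1exp : (d + 1) * Real.exp (-d) ≤ 1 := by
    rw [Real.exp_neg, mul_inv_le_iff₀ (Real.exp_pos _)]
    linarith [Real.add_one_le_exp d]
  have hHexp : H * Real.exp (-H) ≤ 1 := by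
    rw [Real.exp_neg, mul_inv_le_iff₀ (Real.exp_pos _)]
    linarith [Real.add_one_le_exp H]
  have e1 : s ≤ sampleSize s * ((1 / (32 * s ^ 9)) ^ 2 / 8) := by
    calc s ≤ 2 ^ 14 * s ^ 22 * s := by
          have : (1 : ℝ) ≤ s ^ 22 := one_le_pow₀ hs
          nlinarith
      _ = 2 ^ 27 * s ^ 41 * ((1 / (32 * s ^ 9)) ^ 2 / 8) := by field_simp; norm_num
      _ ≤ _ := by gcongr
  have e2 : 3 * s ≤ 2 * sampleSize s * (1 / (2 ^ 13 * s ^ 20)) ^ 2 := by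
    calc 3 * s ≤ 4 * s := by linarith
      _ = 2 * (2 ^ 27 * s ^ 41) * (1 / (2 ^ 13 * s ^ 20)) ^ 2 := by field_simp; norm_num
      _ ≤ _ := by gcongr
  have p1 : H * (c * Real.exp (-sampleSize s * ((1 / (32 * s ^ 9)) ^ 2 / 8))) ≤ δ / 2 := by
    calc H * (c * Real.exp (-sampleSize s * ((1 / (32 * s ^ 9)) ^ 2 / 8)))
        ≤ H * (c * Real.exp (-ℓ + -H + -1)) := by
          gcongr
          linarith
      _ = (H * Real.exp (-H)) * (c * Real.exp (-ℓ)) * Real.exp (-1) := by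
          rw [Real.exp_add, Real.exp_add]; ring
      _ ≤ 1 * δ * Real.exp (-1) := by rw [hcδ]; gcongr
      _ ≤ δ / 2 := by nlinarith
  have p2 : H * (d * (H * ((d ^ 2 + d) *
      (2 * Real.exp (-2 * sampleSize s * (1 / (2 ^ 13 * s ^ 20)) ^ 2))))) ≤ δ / 2 := by
    calc H * (d * (H * ((d ^ 2 + d) *
          (2 * Real.exp (-2 * sampleSize s * (1 / (2 ^ 13 * s ^ 20)) ^ 2)))))
        ≤ H * (d * (H * ((d ^ 2 + d) *
          (2 * Real.exp (-ℓ + -H + -H + -d + -d + -d + -1 + -1))))) := by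
          gcongr
          linarith
      _ = (H * Real.exp (-H)) * (H * Real.exp (-H)) * (d * Real.exp (-d)) * (d * Real.exp (-d)) *
          ((d + 1) * Real.exp (-d)) * (2 * Real.exp (-1)) * Real.exp (-1) * Real.exp (-ℓ) := by
          simp only [Real.exp_add]; ring
      _ ≤ 1 * 1 * 1 * 1 * 1 * 1 * Real.exp (-1) * δ := by gcongr
      _ ≤ δ / 2 := by nlinarith
  linarith

/-- All instructions together, if all sample sizes and the number of rounds of the conditional
gradient method are `m`. -/
theorem totalCost_le {d H K m : ℕ} (hm : 1 ≤ m) (hd : d ≤ m) (hH : H ≤ m) (hK : K ≤ m) :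
    H * (stageEpisodes d H m m + 1 +
      stageCost d K H m m (m * (5 + 10 * d + 2 * m + 6 * (m * d)) + 1)) ≤ 77 * m ^ 7 := by
  have hp : ∀ {i j : ℕ}, i ≤ j → m ^ i ≤ m ^ j := fun h => Nat.pow_le_pow_right hm h
  have hG : greedyCost d K ≤ 9 * m ^ 2 := by
    unfold greedyCost
    calc K * (5 * d + 4) ≤ m * (5 * m + 4 * m) := by gcongr; omega
      _ = 9 * m ^ 2 := by ring
  have hL : m * (5 + 10 * d + 2 * m + 6 * (m * d)) + 1 ≤ 24 * m ^ 3 := by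
    calc m * (5 + 10 * d + 2 * m + 6 * (m * d)) + 1
        ≤ m * (5 + 10 * m + 2 * m + 6 * (m * m)) + 1 := by gcongr
      _ = 5 * m ^ 1 + 12 * m ^ 2 + 6 * m ^ 3 + m ^ 0 := by ring
      _ ≤ 5 * m ^ 3 + 12 * m ^ 3 + 6 * m ^ 3 + m ^ 3 := by
        gcongr 5 * ?_ + 12 * ?_ + 6 * m ^ 3 + ?_ <;> exact hp (by norm_num)
      _ = 24 * m ^ 3 := by ring
  have hP : plannerCost d K H m (m * (5 + 10 * d + 2 * m + 6 * (m * d)) + 1) ≤ 56 * m ^ 5 := by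
    unfold plannerCost
    calc _ ≤ m * (1 + m * (m * (9 * m ^ 2 + 2) + 9 + 2 * m + 9 * m ^ 2) + 24 * m ^ 3) := by gcongr
      _ = m ^ 1 + 9 * m ^ 5 + 4 * m ^ 3 + 9 * m ^ 2 + 33 * m ^ 4 := by ring
      _ ≤ m ^ 5 + 9 * m ^ 5 + 4 * m ^ 5 + 9 * m ^ 5 + 33 * m ^ 5 := by
        gcongr ?_ + 9 * m ^ 5 + 4 * ?_ + 9 * ?_ + 33 * ?_ <;> exact hp (by norm_num)
      _ = 56 * m ^ 5 := by ring
  have hS : stageCost d K H m m (m * (5 + 10 * d + 2 * m + 6 * (m * d)) + 1) ≤ 74 * m ^ 6 := by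
    unfold stageCost
    calc _ ≤ m * (m * (9 * m ^ 2 + 2) + 6) + m * (1 + 56 * m ^ 5) := by gcongr
      _ = 9 * m ^ 4 + 2 * m ^ 2 + 7 * m ^ 1 + 56 * m ^ 6 := by ring
      _ ≤ 9 * m ^ 6 + 2 * m ^ 6 + 7 * m ^ 6 + 56 * m ^ 6 := by
        gcongr 9 * ?_ + 2 * ?_ + 7 * ?_ + 56 * m ^ 6 <;> exact hp (by norm_num)
      _ = 74 * m ^ 6 := by ring
  have hE : stageEpisodes d H m m ≤ 2 * m ^ 6 := by
    unfold stageEpisodes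
    calc m + d * (H * m) ≤ m + m * (m * m) := by gcongr
      _ = m ^ 1 + m ^ 3 := by ring
      _ ≤ m ^ 6 + m ^ 6 := by gcongr <;> first | exact hm | norm_num
      _ = 2 * m ^ 6 := by ring
  calc _ ≤ m * (2 * m ^ 6 + m ^ 6 + 74 * m ^ 6) := by
        gcongr; exact Nat.one_le_pow _ _ hm
    _ = 77 * m ^ 7 := by ring

end Parameters

/-! ### Range of the reachability parameter -/

/-- If there is at least one transition, then some value of the first latent variable has positive
probability, so that reachability forces `η ≤ 1`. -/
theorem Reachable.le_one {X : Type u} [MeasurableSpace X] {K d H : ℕ} {M : MDP X K}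
    {φs : ℕ → Feature X K d} {η : ℝ} (h : Reachable M H φs η) (hH : 0 < H)
    (hφ : GoodFeature (φs 0)) : η ≤ 1 := by
  obtain ⟨i, hi⟩ : ∃ i, 0 < φs 0 M.x0 M.a0 i := by
    by_contra! hcon
    have h1 := hφ.sum_eq M.x0 M.a0
    have h2 : ∑ i, φs 0 M.x0 M.a0 i ≤ 0 := Finset.sum_nonpos fun i _ => hcon i
    linarith
  let π₀ : Policy X K := ⟨fun _ => Kernel.const X (Measure.dirac M.a0), fun _ => inferInstance⟩
  have h1 : 0 < latentProb M φs π₀ 0 i := by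
    rw [← ENNReal.ofReal_pos, ofReal_latentProb hφ, latentMass,
      lintegral_occupancy_zero (hφ.measurable_coord i).ennreal_ofReal]
    exact ENNReal.ofReal_pos.mpr hi
  obtain ⟨π, hπ⟩ := h 0 hH i ⟨π₀, h1⟩
  have h2 : ENNReal.ofReal (latentProb M φs π 0 i) ≤ 1 := by
    rw [ofReal_latentProb hφ]; exact latentMass_le_one hφ 0 i
  exact hπ.trans (ENNReal.ofReal_le_one.mp h2)

end Flambe

theorem mainTheorem3 :
    ∃ P : MvPolynomial (Fin 6) ℝ,
      ∀ (d H K NΦ NΥ : ℕ) (η ε δ : ℝ), 0 < η → 0 < ε → 0 < δ → δ < 1 →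
      ∃ n n' N : ℕ,
      ∀ (X : Type u) [MeasurableSpace X] (vol : Measure X) [SigmaFinite vol]
        (M : Flambe.MDP X K)
        (Φ : Finset (Flambe.Feature X K d)) (Υ : Finset (Flambe.Emission X d))
        (φs : ℕ → Flambe.Feature X K d) (μs : ℕ → Flambe.Emission X d)
        (mle : ∀ k, Flambe.Dataset X K k → Flambe.Model Φ Υ),
        Φ.card = NΦ → Υ.card = NΥ →
        Flambe.SimplexFeatures Φ → Flambe.DensityEmissions vol Υ →
        (∀ h < H, φs h ∈ Φ ∧ μs h ∈ Υ) → Flambe.Factorizes vol M H φs μs →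
        Flambe.Reachable M H φs η → Flambe.IsMLE mle →
        ∀ ls : Flambe.LSRoutine X K (Flambe.Model Φ Υ) d,
          (ls = Flambe.conditionalGradient N ∨
            ∃ sol, Flambe.IsLeastSquares sol ∧ ls = Flambe.exactLS sol) →
          let alg := Flambe.flambe ls M.a0 n n' H
          let bound : ℝ≥0∞ := ENNReal.ofReal (MvPolynomial.eval
            ![(d : ℝ), (H : ℝ), (K : ℝ), 1 / η, 1 / ε, Real.log ((NΦ : ℝ) * NΥ / δ)] P)
          ENNReal.ofReal (1 - δ) ≤
              (alg.law M mle (0, M.x0)) {out | Flambe.SysId vol M ε out.1} ∧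
            (alg.trajectories : ℝ≥0∞) ≤ bound ∧
            alg.mleCalls = H ∧
            (alg.steps : ℝ≥0∞) ≤ bound := by
  refine ⟨.C 77 * (.C (2 ^ 28) * (1 + ∑ i, .X i) ^ 41) ^ 7,
    fun d H K NΦ NΥ η ε δ hη hε hδ hδ1 => ?_⟩
  set ℓ : ℝ := Real.log ((NΦ : ℝ) * NΥ / δ) with hℓ
  set s : ℝ := 1 + d + H + K + 1 / η + 1 / ε + ℓ with hs
  refine ⟨Flambe.sampleSize s, Flambe.sampleSize s, Flambe.sampleSize s, ?_⟩
  intro X _ vol _ M Φ Υ φs μs mle hNΦ hNΥ hΦ hΥ hmem hfac hreach hmle ls hls alg bound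
  rcases Nat.eq_zero_or_pos H with rfl | hH
  -- Without a stage, the program returns the empty model and identification is vacuous.
  · refine ⟨?_, ?_, ?_, ?_⟩
    · have h1 : alg.law M mle (0, M.x0) = Measure.dirac (Fin.elim0, (0, M.x0)) := rfl
      have h2 : {out : (Fin 0 → Flambe.Model Φ Υ) × (ℕ × X) | Flambe.SysId vol M ε out.1} =
          Set.univ := Set.eq_univ_of_forall fun out π h => h.elim0
      rw [h1, h2, measure_univ]
      exact ENNReal.ofReal_le_one.mpr (by linarith)
    all_goals simp [alg, Flambe.flambe, Flambe.flambeStages, Flambe.Prog.bind,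
      Flambe.Prog.trajectories, Flambe.Prog.mleCalls, Flambe.Prog.steps, Flambe.Prog.cost]
  have hφ0 := Flambe.goodFeature_of_mem hΦ (hmem 0 hH).1
  have hd : 0 < d := Nat.pos_of_ne_zero fun h => by
    subst h
    simpa using hφ0.sum_eq M.x0 M.a0
  have hη1 : η ≤ 1 := hreach.le_one hH hφ0
  have hΦ1 : (1 : ℝ) ≤ NΦ := by
    exact_mod_cast hNΦ ▸ Finset.card_pos.mpr ⟨_, (hmem 0 hH).1⟩
  have hΥ1 : (1 : ℝ) ≤ NΥ := by
    exact_mod_cast hNΥ ▸ Finset.card_pos.mpr ⟨_, (hmem 0 hH).2⟩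
  have hc : (1 : ℝ) ≤ NΦ * NΥ := one_le_mul_of_one_le_of_one_le hΦ1 hΥ1
  have hℓ0 : 0 ≤ ℓ := Real.log_nonneg ((one_le_div hδ).mpr (by linarith))
  have hd0 : (0 : ℝ) ≤ d := d.cast_nonneg
  have hH0 : (0 : ℝ) ≤ H := H.cast_nonneg
  have hK0 : (0 : ℝ) ≤ K := K.cast_nonneg
  have hη0 : 0 < 1 / η := by positivity
  have hε0 : 0 < 1 / ε := by positivity
  have hs1 : 1 ≤ s := by linarith
  have hκ := Flambe.coverage_le (s := s) (d := d) (K := K) hs1 hd0 hK0 hη (by linarith)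
    (by linarith) (by linarith)
  set m := Flambe.sampleSize s with hm
  have hsm : s ≤ m := Flambe.self_le_sampleSize hs1
  have hm1 : 1 ≤ m := by exact_mod_cast hs1.trans hsm
  have hdm : d ≤ m := by exact_mod_cast (show (d : ℝ) ≤ s by linarith).trans hsm
  have hHm : H ≤ m := by exact_mod_cast (show (H : ℝ) ≤ s by linarith).trans hsm
  have hKm : K ≤ m := by exact_mod_cast (show (K : ℝ) ≤ s by linarith).trans hsm
  -- Both least squares routines meet the same specification and cost bound.
  obtain ⟨⟨sol, hsol⟩, hL⟩ : (∃ sol, Flambe.SolvesLS ls sol fun B => 16 * B ^ 2 / (m + 2)) ∧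
      ∀ (r o e : ℕ∞) B rows, (ls m B rows).cost r o e ≤
        (m * (5 + 10 * d + 2 * m + 6 * (m * d)) + 1 : ℕ) * e := by
    rcases hls with rfl | ⟨sol, hsol, rfl⟩
    · refine ⟨⟨_, Flambe.solvesLS_conditionalGradient hm1⟩, fun r o e B rows => ?_⟩
      refine (Flambe.cost_conditionalGradient _ _ _ _).trans ?_
      gcongr
      omega
    · refine ⟨⟨sol, Flambe.solvesLS_exactLS hsol fun B => by positivity⟩, fun r o e B rows => ?_⟩
      refine (Flambe.cost_exactLS _ _ _).trans (le_mul_of_one_le_left' ?_)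
      push_cast
      exact le_add_self
  have hsteps : (alg.steps : ℝ≥0∞) ≤ bound := by
    have h1 : alg.steps ≤ (77 * m ^ 7 : ℕ) := by
      refine (Flambe.cost_flambe (fun B rows => hL 1 1 1 B rows) M.a0 H).trans ?_
      have h2 := Flambe.totalCost_le hm1 hdm hHm hKm
      simp only [mul_one]
      exact_mod_cast h2
    have h3 : ((77 * m ^ 7 : ℕ) : ℝ) ≤ 77 * (2 ^ 28 * s ^ 41) ^ 7 := by
      have h4 := Flambe.sampleSize_le hs1
      calc ((77 * m ^ 7 : ℕ) : ℝ) = 77 * (m : ℝ) ^ 7 := by push_cast; rfl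
        _ ≤ 77 * (2 ^ 28 * s ^ 41) ^ 7 := by gcongr
    have h5 : bound = ENNReal.ofReal (77 * (2 ^ 28 * s ^ 41) ^ 7) := by
      simp only [bound, map_mul, map_pow, map_add, map_one, MvPolynomial.eval_C,
        MvPolynomial.eval_X, Fin.sum_univ_six]
      congr 3
      simp [hs, ← add_assoc]
    rw [h5]
    calc (alg.steps : ℝ≥0∞) ≤ ((77 * m ^ 7 : ℕ) : ℕ∞) := ENat.toENNReal_le.mpr h1
      _ = ENNReal.ofReal ((77 * m ^ 7 : ℕ) : ℝ) := by simp
      _ ≤ _ := ENNReal.ofReal_le_ofReal h3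
  refine ⟨?_, ?_, ?_, hsteps⟩
  · refine Flambe.le_law_sysId hΦ hΥ hd hmem hfac hη hη1 hreach rfl (e₁ := 1 / (32 * s ^ 9))
      (e₂ := 1 / (16 * s ^ 8)) (τ := 1 / (2 ^ 13 * s ^ 20)) (by positivity) (by positivity)
      (Flambe.model_accuracy_le hs1 hκ hε (by linarith))
      (Flambe.plan_accuracy_le hs1 hd0 hH0 hK0 hκ hη (by linarith) (by linarith) (by linarith)
        (by linarith)) hsol hmle hm1 (by positivity) (fun h hh => ?_) ?_ _
    · have : (h : ℝ) ≤ H := by exact_mod_cast hh.le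
      exact Flambe.regression_accuracy_le hs1 hd0 h.cast_nonneg (by linarith) (by linarith)
    · rw [hNΦ, hNΥ]
      exact Flambe.failure_le hs1 hd0 hH0 hc hδ (by linarith) hℓ0
  · exact (ENat.toENNReal_le.mpr (Flambe.Prog.trajectories_le_steps alg)).trans hsteps
  · exact Flambe.mleCalls_flambe hΦ hd.ne' hsol mle _ _ H fun B rows => by
      simpa using hL 0 1 0 B rows
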